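/- Graphs are finite and may have loops and multiple edges; a loop adds $2$ to the degree of its vertex. For a graph $G$, let $d_G(v)$ be the degree of $v$, and for $A\subseteq V(G)$ let $e_G(A)$ be the number of edges (including loops) with both ends in $A$. A graph is $m$-tree-connected if it contains $m$ pairwise edge-disjoint spanning trees, and Eulerian if it is connected and all its degrees are even; its size is its number of edges. Let $k\ge 2$ be an integer. A mapping $f:V(G)\to \mathbb{Z}_k$ is compatible with $G$ if for every partition of $V(G)$ into two (possibly empty) classes $X,Y$ one has $\sum_{v\in X}f(v)-2x\equiv\sum_{v\in Y}f(v) \pmod k$ for some integer $0\le x\le e_G(X)$, or $\sum_{v\in X}f(v)\equiv\sum_{v\in Y}f(v)-2y \pmod k$ for some integer $0\le y\le e_G(Y)$. An $f$-factor of $G$ modulo $k$ is a spanning subgraph $H$ of $G$ with $d_H(v)\equiv f(v)\pmod k$ for every $v\in V(G)$. Theorem. Let $G$ be a graph with $z\in V(G)$, let $k\ge 2$ be an integer, and let $f:V(G)\to\mathbb{Z}_k$ be compatible with $G$. If $G$ is $(6k-2)$-tree-connected, then $G$ has an $f$-factor $H$ modulo $k$ such that for every vertex $v$, $$\left\lfloor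 \frac{d_G(v)}{2}\right\rfloor-(k-1)\le d_H(v)\le \begin{cases}\left\lfloor \frac{d_G(v)}{2}\right\rfloor+k, & v=z,\\[2pt] \left\lceil \frac{d_G(v)}{2}\right\rceil+(k-1), & v\ne z.\end{cases}$$ Furthermore, the upper bound at $z$ cannot be reduced to $\lceil d_G(z)/2\rceil+(k-1)$ (that is, $G$ has no $f$-factor $H$ modulo $k$ with $\lfloor d_G(v)/2\rfloor-(k-1)\le d_H(v)\le\lceil d_G(v)/2\rceil+(k-1)$ for all $v\in V(G)$) if and only if both of the following hold: (i) $G$ is an Eulerian graph of odd size; (ii) $k$ is odd and $f(v)\equiv d_G(v)/2\pmod k$ for all $v\in V(G)$. In this exceptional case, the upper bound at $z$ can be reduced to $\lceil d_G(z)/2\rceil+(k-1)$ if the lower bound at $z$ is relaxed to $\lceil d_G(z)/2\rceil-k$: then $G$ has an $f$-factor $H$ modulo $k$ with $\lceil d_G(z)/2\rceil-k\le d_H(z)\le\lceil d_G(z)/2\rceil+(k-1)$ and $\lfloor d_G(v)/2\rfloor-(k-1)\le d_H(v)\le\lceil d_G(v)/2\rceil+(k-1)$ for all $v\ne z$. 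-/

import Mathlib

open scoped Graph

namespace Graph

/-- The degree `d_G(v)` of a vertex in a multigraph: the number of edges incident with `v`,
where every loop at `v` is counted twice. -/
noncomputable def degree {α β : Type*} (G : Graph α β) (v : α) : ℕ :=
  {e | G.Inc e v}.ncard + {e | G.IsLoopAt e v}.ncard

/-- `e_G(A)`: the number of edges (loops included) with both ends in `A`. -/
noncomputable def edgesWithin {α β : Type*} (G : Graph α β) (A : Set α) : ℕ :=
  {e | ∃ x ∈ A, ∃ y ∈ A, G.IsLink e x y}.ncard

/-- A multigraph is connected if it has a vertex and any two vertices are joined by a walk. -/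
def IsConnected {α β : Type*} (G : Graph α β) : Prop :=
  V(G).Nonempty ∧ ∀ x ∈ V(G), ∀ y ∈ V(G), Relation.ReflTransGen G.Adj x y

/-- The multigraph has a cycle: distinct vertices `v 0, …, v n` and distinct edges
`e 0, …, e n` such that `e i` joins `v i` to the cyclically next vertex. A loop is a cycle
of length one and two parallel edges form a cycle of length two. -/
def HasCycle {α β : Type*} (G : Graph α β) : Prop :=
  ∃ (n : ℕ) (v : Fin (n + 1) → α) (e : Fin (n + 1) → β),
    Function.Injective v ∧ Function.Injective e ∧ ∀ i, G.IsLink (e i) (v i) (v (i + 1))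

/-- A tree is a connected graph without cycles. -/
def IsTree {α β : Type*} (G : Graph α β) : Prop :=
  G.IsConnected ∧ ¬ G.HasCycle

/-- `G` is `m`-tree-connected: it contains `m` pairwise edge-disjoint spanning trees. -/
def IsTreeConnected {α β : Type*} (G : Graph α β) (m : ℕ) : Prop :=
  ∃ T : Fin m → Graph α β,
    (∀ i, T i ≤s G ∧ (T i).IsTree) ∧ Pairwise fun i j => Disjoint E(T i) E(T j)

/-- `G` is Eulerian: connected with all degrees even. -/
def IsEulerian {α β : Type*} (G : Graph α β) : Prop :=
  G.IsConnected ∧ ∀ v ∈ V(G), Even (G.degree v)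

/-- `f` is compatible with `G` with respect to the bipartition `X, Y` of the vertex set. -/
def IsCompatibleWrt {α β : Type*} (G : Graph α β) {k : ℕ} (f : α → ZMod k) (X Y : Set α) : Prop :=
  (∃ x : ℕ, x ≤ G.edgesWithin X ∧ (∑ᶠ v ∈ X, f v) - 2 * (x : ZMod k) = ∑ᶠ v ∈ Y, f v) ∨
  (∃ y : ℕ, y ≤ G.edgesWithin Y ∧ ∑ᶠ v ∈ X, f v = (∑ᶠ v ∈ Y, f v) - 2 * (y : ZMod k))

/-- `f` is compatible with `G`: it is so with respect to every bipartition `X, Y` of `V(G)`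
(one of the two classes may be empty). Only the values of `f` on `V(G)` matter. -/
def IsCompatibleMap {α β : Type*} (G : Graph α β) {k : ℕ} (f : α → ZMod k) : Prop :=
  ∀ X Y : Set α, X ∪ Y = V(G) → Disjoint X Y → G.IsCompatibleWrt f X Y

/-- `H` is an `f`-factor of `G` modulo `k`: a spanning subgraph with `d_H(v) ≡ f(v)` modulo `k`
for each vertex `v`. -/
def IsModFactor {α β : Type*} (H G : Graph α β) {k : ℕ} (f : α → ZMod k) : Prop :=
  H ≤s G ∧ ∀ v ∈ V(G), (H.degree v : ZMod k) = f v

/-- `G` is an Eulerian graph of odd size, `k` is odd and `f(v) ≡ d_G(v) / 2` modulo `k` for each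
vertex `v` (the division is exact, because `G` is Eulerian). -/
def IsExceptional {α β : Type*} (G : Graph α β) {k : ℕ} (f : α → ZMod k) : Prop :=
  (G.IsEulerian ∧ Odd E(G).ncard) ∧
  (Odd k ∧ ∀ v ∈ V(G), f v = ((G.degree v / 2 : ℕ) : ZMod k))

end Graph

/-! Give the edges of `H` the sign `1` and the other edges of `G` the sign `-1`. The excess of signs
at `v` is then `2 d_H(v) - d_G(v)`, so the signing has to have excesses congruent to `t v = 2 f(v) -
d_G(v)` modulo `2k`. The symmetric degree bounds say exactly that all excesses are at most `2k - 1`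
in absolute value.

Reverse the sign convention at the vertices outside a set `X`. Edges between `X` and its complement
become directed edges, and an edge with both ends on one side points out of both ends or into both;
call it odd. The net outflows add up to `2C`, where `C` is the excess of signs within `X` minus the
excess within the complement, and compatibility with respect to `X` says that some attainable `C`
has the required residue. One may assume `|C| ≤ k`. Set one spanning tree aside and let `X` be a
maximum cut of the rest: at least half of the edges of every cut are then directed edges. Two odd
edges at a vertex merge into a directed edge, an odd and a directed one into an odd one; working
along the tree, just `|C|` odd edges are left (`Bidirected.exists_reduction`), and all of them get
the sign of `C`.

What remains is to orient the other edges with prescribed net outflows modulo `2k`, where some edges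
to a further vertex have fixed directions. This is `OrientationProblem.Valid.solvable`, the core of
the proof, an induction in the manner of Lovász, Thomassen, Wu and Zhang. A set `A` needs degree at
least `2k - 2` plus the distance of its prescription from the multiples of `2k`; the further vertex
has at most the analogous degree. Tight sets are contracted, edges are lifted at vertices with
slack, and when all vertices are tight an edge is directed and deleted.

The odd edges have `2|C|` ends, which is too many for the further vertex if `|C| = k`. Hence one end
is set aside at a vertex `w`, which shifts the bound there by one. The shift is harmless if `t w` is
not divisible by `2k`. If every `t v` is divisible by `2k`, then `C` is a multiple of `k`, and `C =
0` avoids the shift unless parity forbids it; that happens only if `k` and the size of `G` are odd.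
In this exceptional case `C = k` and `C = -k` are both possible, so the shift at `z` can have either
direction. It is unavoidable: otherwise all degrees of `H` would be exactly half of those of `G`,
and the size of `G` would be even. -/

/-! ### Distance to the multiples of `2k` -/

/-- The distance from `x` to the nearest multiple of `2 * k`. -/
def modDist (k : ℕ) (x : ℤ) : ℤ := |Int.bmod x (2 * k)|

namespace modDist

variable {k : ℕ} {x y : ℤ}

lemma nonneg (k : ℕ) (x : ℤ) : 0 ≤ modDist k x := abs_nonneg _

lemma le (hk : 0 < k) (x : ℤ) : modDist k x ≤ k := by
  have h1 := Int.le_bmod (x := x) (m := 2 * k) (by omega)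
  have h2 := Int.bmod_lt (x := x) (m := 2 * k) (by omega)
  rw [modDist, abs_le]
  push_cast at h1 h2
  omega

lemma congr (h : (2 * k : ℤ) ∣ x - y) : modDist k x = modDist k y := by
  have : Int.bmod x (2 * k) = Int.bmod y (2 * k) := by
    rw [Int.bmod_eq_bmod_iff_bmod_sub_eq_zero]
    exact Int.bmod_eq_zero_of_dvd (by exact_mod_cast h)
  rw [modDist, modDist, this]

lemma dvd_sub_bmod (k : ℕ) (x : ℤ) : (2 * k : ℤ) ∣ x - Int.bmod x (2 * k) := by
  have := Int.dvd_self_sub_bmod (x := x) (m := 2 * k)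
  exact_mod_cast this

lemma dvd_sub_or_dvd_add (k : ℕ) (x : ℤ) :
    (2 * k : ℤ) ∣ x - modDist k x ∨ (2 * k : ℤ) ∣ x + modDist k x := by
  have h := dvd_sub_bmod k x
  unfold modDist
  rcases abs_choice (Int.bmod x (2 * k)) with h' | h' <;> rw [h']
  · exact Or.inl h
  · right; simpa [sub_eq_add_neg] using h

lemma even_sub (k : ℕ) (x : ℤ) : (2 : ℤ) ∣ x - modDist k x := by
  rcases dvd_sub_or_dvd_add k x with h | h
  · exact (Dvd.intro _ rfl).trans h
  · have := (Dvd.intro _ rfl : (2 : ℤ) ∣ 2 * k).trans h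
    omega

lemma eq_abs (hx : |x| ≤ k) : modDist k x = |x| := by
  rcases Nat.eq_zero_or_pos k with rfl | hk
  · have : x = 0 := by simpa using hx
    simp [this, modDist]
  rw [abs_le] at hx
  by_cases h : x = k
  · subst h
    rcases dvd_sub_or_dvd_add k (k : ℤ) with ⟨c, hc⟩ | ⟨c, hc⟩
    · have h1 := nonneg k k
      have h2 := le hk k
      have : c = 0 := by
        by_contra h0
        rcases lt_or_gt_of_ne h0 with h0 | h0 <;> nlinarith
      subst this
      rw [abs_of_nonneg] <;> omega
    · have h1 := nonneg k k
      have h2 := le hk k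
      have : c = 1 := by
        by_contra h0
        rcases lt_or_gt_of_ne h0 with h0 | h0
        · have : c ≤ 0 := by omega
          nlinarith
        · have : 2 ≤ c := by omega
          nlinarith
      subst this
      rw [abs_of_nonneg] <;> omega
  · rw [modDist, Int.bmod_eq_of_le (by push_cast; omega) (by push_cast; omega)]

lemma le_abs (hk : 0 < k) (x : ℤ) : modDist k x ≤ |x| := by
  by_cases h : |x| ≤ k
  · rw [eq_abs h]
  · exact (le hk x).trans (by omega)

lemma eq_of_dvd_sub (h : (2 * k : ℤ) ∣ x - y) (hy : |y| ≤ k) : modDist k x = |y| := by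
  rw [congr h, eq_abs hy]

lemma neg (hk : 0 < k) (x : ℤ) : modDist k (-x) = modDist k x := by
  have h := dvd_sub_bmod k x
  rw [eq_of_dvd_sub (y := -Int.bmod x (2 * k)), abs_neg]; rfl
  · rw [show -x - -Int.bmod x (2 * k) = -(x - Int.bmod x (2 * k)) by ring]
    exact (dvd_neg).2 h
  · rw [abs_neg]; exact le hk x

lemma add_le (hk : 0 < k) (x y : ℤ) : modDist k (x + y) ≤ modDist k x + modDist k y := by
  have h : (2 * k : ℤ) ∣ (x + y) - (Int.bmod x (2 * k) + Int.bmod y (2 * k)) := by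
    rw [add_sub_add_comm]
    exact dvd_add (dvd_sub_bmod k x) (dvd_sub_bmod k y)
  rw [congr h]
  exact (le_abs hk _).trans (abs_add_le _ _)

lemma add_abs_le (hk : 0 < k) (x y : ℤ) : modDist k (x + y) ≤ modDist k x + |y| :=
  (add_le hk x y).trans (by have := le_abs hk y; omega)

lemma le_add_abs (hk : 0 < k) (x y : ℤ) : modDist k x ≤ modDist k (x + y) + |y| := by
  have := add_abs_le hk (x + y) (-y)
  rwa [add_neg_cancel_right, abs_neg] at this

lemma add_one_le (hk : 0 < k) (x : ℤ) : modDist k (x + 1) ≤ modDist k x + 1 := by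
  simpa using add_abs_le hk x 1

lemma sub_one_le (hk : 0 < k) (x : ℤ) : modDist k (x - 1) ≤ modDist k x + 1 := by
  simpa [sub_eq_add_neg] using add_abs_le hk x (-1)

lemma eq_zero_iff (k : ℕ) (x : ℤ) : modDist k x = 0 ↔ (2 * k : ℤ) ∣ x := by
  constructor
  · intro h
    rcases dvd_sub_or_dvd_add k x with h' | h' <;> simpa [h] using h'
  · intro h
    rw [eq_of_dvd_sub (y := 0) (by simpa using h) (by simp), abs_zero]

/-- If `x ≡ t` with `0 < t ≤ k`, subtracting one decreases the distance. -/
lemma sub_one_eq (hk : 0 < k) (h : (2 * k : ℤ) ∣ x - modDist k x) (h0 : 0 < modDist k x) :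
    modDist k (x - 1) = modDist k x - 1 := by
  have h1 := le hk x
  rw [eq_of_dvd_sub (y := modDist k x - 1), abs_of_nonneg (by omega)]
  · rwa [show x - 1 - (modDist k x - 1) = x - modDist k x by ring]
  · rw [abs_of_nonneg] <;> omega

lemma add_one_eq (hk : 0 < k) (h : (2 * k : ℤ) ∣ x + modDist k x) (h0 : 0 < modDist k x) :
    modDist k (x + 1) = modDist k x - 1 := by
  have := sub_one_eq (x := -x) hk (by
    rw [neg hk, show -x - modDist k x = -(x + modDist k x) by ring]; exact (dvd_neg).2 h)
    (by rwa [neg hk])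
  rwa [show -x - 1 = -(x + 1) by ring, neg hk, neg hk] at this

/-- An integer whose absolute value exceeds its distance to the multiples of `2 * k` by at most
`2 * k - 2` is less than `2 * k` in absolute value. -/
lemma abs_le_of_le (hk : 0 < k) (h : |x| ≤ 2 * k - 2 + modDist k x) : |x| ≤ 2 * k - 1 := by
  by_contra! hlt
  -- If `|x| ≥ 2k`, then `|x| - 2k` lies in the class of `x` or `-x`, so the distance is at most
  -- `|x| - 2k`, two less than the hypothesis requires.
  have h1 : modDist k x = modDist k (|x| - 2 * k) := by
    rcases abs_choice x with h' | h' <;> rw [h']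
    · exact congr (by rw [show x - (x - 2 * k : ℤ) = 2 * k by ring])
    · rw [← neg hk x]
      exact congr (by rw [show -x - (-x - 2 * k : ℤ) = 2 * k by ring])
  have h2 := le_abs hk (|x| - 2 * k)
  rw [abs_of_nonneg (a := |x| - 2 * k) (by omega)] at h2
  omega

end modDist

/-! ### Orientation problems and the deletion of one edge -/

set_option linter.unusedSectionVars false

/-- Whether an edge with ends `x` and `y` leaves the set `A`, as an integer. -/
def crossing {ι : Type*} [DecidableEq ι] (A : Finset ι) (x y : ι) : ℤ :=
  if (x ∈ A ↔ y ∈ A) then 0 else 1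

/-- The contribution of an edge directed from `x` to `y` to the net outflow at `v`. -/
def arc {ι : Type*} [DecidableEq ι] (x y v : ι) : ℤ :=
  (if x = v then 1 else 0) - (if y = v then 1 else 0)

section

variable {ι : Type*} [DecidableEq ι]

lemma crossing_nonneg (A : Finset ι) (x y : ι) : 0 ≤ crossing A x y := by
  unfold crossing; split_ifs <;> simp

lemma crossing_comm (A : Finset ι) (x y : ι) : crossing A x y = crossing A y x := by
  unfold crossing; simp only [iff_comm]

@[simp] lemma crossing_self (A : Finset ι) (x : ι) : crossing A x x = 0 := by simp [crossing]

lemma arc_swap (x y v : ι) : arc y x v = -arc x y v := by unfold arc; ring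

@[simp] lemma arc_self (x v : ι) : arc x x v = 0 := by unfold arc; ring

lemma sum_arc (A : Finset ι) (x y : ι) :
    ∑ v ∈ A, arc x y v = (if x ∈ A then 1 else 0) - (if y ∈ A then 1 else 0) := by
  simp [arc, Finset.sum_sub_distrib, Finset.sum_ite_eq]

lemma abs_arc_le (x y v : ι) : |arc x y v| ≤ crossing {v} x y := by
  unfold arc crossing
  by_cases h1 : x = v <;> by_cases h2 : y = v <;> simp [h1, h2]

end

/-- The data of an orientation problem: a multigraph with vertex set `V`, edge set `E` and ends
`p`, `q`, in which each vertex `v` is joined to a further vertex by `n v` edges whose directions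
are already fixed and contribute `r v` to the net outflow at `v`; the net outflow at `v` is
prescribed to be `b v` modulo `2 * k`. -/
structure OrientationProblem (ι κ : Type*) where
  V : Finset ι
  E : Finset κ
  p : κ → ι
  q : κ → ι
  n : ι → ℤ
  r : ι → ℤ
  b : ι → ℤ

namespace OrientationProblem

variable {ι κ : Type*} [DecidableEq ι] [DecidableEq κ] {k : ℕ} {P : OrientationProblem ι κ}

/-- The number of edges leaving `A`, apart from those joined to the further vertex. -/
def cut (P : OrientationProblem ι κ) (A : Finset ι) : ℤ := ∑ e ∈ P.E, crossing A (P.p e) (P.q e)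

/-- The number of edges leaving `A`. -/
def deg (P : OrientationProblem ι κ) (A : Finset ι) : ℤ := P.cut A + ∑ v ∈ A, P.n v

/-- The net outflow at `v` of the orientation `σ` of the edges of `E`. -/
def flow (P : OrientationProblem ι κ) (σ : κ → ℤ) (v : ι) : ℤ :=
  ∑ e ∈ P.E, σ e * arc (P.p e) (P.q e) v

/-- The orientation problem has a solution whose net outflows are less than `2 * k`. -/
def Solvable (k : ℕ) (P : OrientationProblem ι κ) : Prop :=
  ∃ σ : κ → ℤ, (∀ e, σ e = 1 ∨ σ e = -1) ∧ ∀ v ∈ P.V,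
    (2 * k : ℤ) ∣ P.r v + P.flow σ v - P.b v ∧ |P.r v + P.flow σ v| ≤ 2 * k - 1

/-- The degree condition at the set `A`. -/
def CutCond (k : ℕ) (P : OrientationProblem ι κ) (A : Finset ι) : Prop :=
  2 * k - 2 + modDist k (∑ v ∈ A, P.b v) ≤ P.deg A

/-- The hypotheses under which an orientation problem is solvable. The vertex `v₀` need not satisfy
the degree condition if its prescribed net outflow is zero. -/
structure Valid (k : ℕ) (v₀ : ι) (P : OrientationProblem ι κ) : Prop where
  ends : ∀ e ∈ P.E, P.p e ∈ P.V ∧ P.q e ∈ P.V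
  abs_le : ∀ v ∈ P.V, |P.r v| ≤ P.n v
  even : ∀ v ∈ P.V, (2 : ℤ) ∣ P.n v - P.r v
  parity : ∀ A ⊆ P.V, (2 : ℤ) ∣ P.deg A - ∑ v ∈ A, P.b v
  total : (2 * k : ℤ) ∣ ∑ v ∈ P.V, P.r v - ∑ v ∈ P.V, P.b v
  top : ∑ v ∈ P.V, P.n v ≤ 2 * k - 2 + modDist k (∑ v ∈ P.V, P.b v)
  cutCond : ∀ A ⊆ P.V, A.Nonempty → A ≠ P.V → A = {v₀} ∧ (2 * k : ℤ) ∣ P.b v₀ ∨ P.CutCond k A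

/-- `x` and `y` are the ends of `e`. -/
def Joins (P : OrientationProblem ι κ) (e : κ) (x y : ι) : Prop :=
  P.p e = x ∧ P.q e = y ∨ P.p e = y ∧ P.q e = x

lemma sum_flow (P : OrientationProblem ι κ) (σ : κ → ℤ) (A : Finset ι) :
    ∑ v ∈ A, P.flow σ v =
      ∑ e ∈ P.E, σ e * ((if P.p e ∈ A then 1 else 0) - (if P.q e ∈ A then 1 else 0)) := by
  unfold flow
  rw [Finset.sum_comm]
  refine Finset.sum_congr rfl fun e _ => ?_
  rw [← Finset.mul_sum, sum_arc]

lemma abs_flow_le (P : OrientationProblem ι κ) {σ : κ → ℤ} (hσ : ∀ e, σ e = 1 ∨ σ e = -1) (v : ι) :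
    |P.flow σ v| ≤ P.cut {v} := by
  refine (Finset.abs_sum_le_sum_abs _ _).trans (Finset.sum_le_sum fun e _ => ?_)
  rw [abs_mul]
  rcases hσ e with h | h <;> simpa [h] using abs_arc_le _ _ _

lemma cut_nonneg (P : OrientationProblem ι κ) (A : Finset ι) : 0 ≤ P.cut A :=
  Finset.sum_nonneg fun _ _ => crossing_nonneg _ _ _

lemma deg_singleton (P : OrientationProblem ι κ) (v : ι) : P.deg {v} = P.cut {v} + P.n v := by
  simp [deg]

namespace Valid

variable {v₀ : ι}

lemma n_nonneg (h : P.Valid k v₀) {v : ι} (hv : v ∈ P.V) : 0 ≤ P.n v :=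
  (abs_nonneg _).trans (h.abs_le v hv)

lemma sum_n_nonneg (h : P.Valid k v₀) {A : Finset ι} (hA : A ⊆ P.V) : 0 ≤ ∑ v ∈ A, P.n v :=
  Finset.sum_nonneg fun _ hv => h.n_nonneg (hA hv)

/-- A net outflow in the prescribed class at a vertex of small degree is small. -/
lemma bound_of_deg_le (hk : 0 < k) (h : P.Valid k v₀) {σ : κ → ℤ}
    (hσ : ∀ e, σ e = 1 ∨ σ e = -1) {v : ι} (hv : v ∈ P.V)
    (hd : P.deg {v} ≤ 2 * k - 2 + modDist k (P.b v))
    (hs : (2 * k : ℤ) ∣ P.r v + P.flow σ v - P.b v) :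
    |P.r v + P.flow σ v| ≤ 2 * k - 1 := by
  refine modDist.abs_le_of_le hk ?_
  rw [modDist.congr hs]
  have h1 := P.abs_flow_le hσ v
  have h2 := h.abs_le v hv
  have h3 := abs_add_le (P.r v) (P.flow σ v)
  rw [deg_singleton] at hd
  omega

lemma modDist_r (h : P.Valid k v₀) :
    modDist k (∑ v ∈ P.V, P.b v) = modDist k (∑ v ∈ P.V, P.r v) :=
  (modDist.congr h.total).symm

/-- A set that meets the degree condition barely does so by a margin of two, or not at all. -/
lemma add_two_le (h : P.Valid k v₀) {A : Finset ι} (hA : A ⊆ P.V)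
    (h1 : 2 * k - 2 + modDist k (∑ v ∈ A, P.b v) < P.deg A) :
    2 * k + modDist k (∑ v ∈ A, P.b v) ≤ P.deg A := by
  have h2 := h.parity A hA
  have h3 := modDist.even_sub k (∑ v ∈ A, P.b v)
  omega

/-- Two complementary sets satisfying the degree condition are joined by an edge. -/
lemma exists_edge_between (hk : 2 ≤ k) (h : P.Valid k v₀) {A B : Finset ι} (hAB : A ∪ B = P.V)
    (hd : Disjoint A B) (hA : P.CutCond k A) (hB : P.CutCond k B) :
    ∃ e ∈ P.E, ∃ x ∈ A, ∃ y ∈ B, P.Joins e x y := by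
  by_contra! hcon
  have hz : ∀ e ∈ P.E, (P.p e ∈ A ↔ P.q e ∈ A) ∧ (P.p e ∈ B ↔ P.q e ∈ B) := by
    intro e he
    have h1 := h.ends e he
    have h2 := fun x hx y hy => hcon e he x hx y hy
    simp only [Joins, not_or, not_and] at h2
    have h6 := fun hx hy => (h2 (P.p e) hx (P.q e) hy).1 rfl rfl
    have h7 := fun hx hy => (h2 (P.q e) hx (P.p e) hy).2 rfl rfl
    rw [← hAB, Finset.mem_union, Finset.mem_union] at h1
    have h3 : ∀ x ∈ A, x ∉ B := fun x hx => Finset.disjoint_left.1 hd hx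
    have h4 := h3 (P.p e)
    have h5 := h3 (P.q e)
    tauto
  have cA : P.cut A = 0 := Finset.sum_eq_zero fun e he => by simp [crossing, (hz e he).1]
  have cB : P.cut B = 0 := Finset.sum_eq_zero fun e he => by simp [crossing, (hz e he).2]
  -- Without an edge between them, the degrees of `A` and `B` add up to the total of `n`, and two
  -- terms `2k - 2` do not fit below the single one in `top`, since `2k - 2 > 0`.
  have h1 := h.top
  rw [← hAB, Finset.sum_union hd, Finset.sum_union hd] at h1
  unfold CutCond deg at hA hB
  have h2 := modDist.add_le (k := k) (by omega) (∑ v ∈ A, P.b v) (∑ v ∈ B, P.b v)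
  omega

end Valid

/-- The problem obtained by deleting the edge `e` with ends `x` and `y`, directed so that it
contributes `ε` at `x` and `-ε` at `y`, and changing the data at these two vertices. -/
def eraseEdge (P : OrientationProblem ι κ) (e : κ) (x y : ι) (cx cy rx ry ε : ℤ) :
    OrientationProblem ι κ where
  V := P.V
  E := P.E.erase e
  p := P.p
  q := P.q
  n v := P.n v + ((if v = x then cx else 0) + (if v = y then cy else 0))
  r v := P.r v + ((if v = x then rx else 0) + (if v = y then ry else 0))
  b v := P.b v + ((if v = x then rx - ε else 0) + (if v = y then ry + ε else 0))

lemma Joins.crossing {e : κ} {x y : ι} (h : P.Joins e x y) (A : Finset ι) :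
    crossing A (P.p e) (P.q e) = crossing A x y := by
  rcases h with ⟨rfl, rfl⟩ | ⟨rfl, rfl⟩
  · rfl
  · exact crossing_comm _ _ _

lemma Joins.symm {e : κ} {x y : ι} (h : P.Joins e x y) : P.Joins e y x := Or.symm h

lemma sum_ite_add_ite (A : Finset ι) (f : ι → ℤ) (x y : ι) (c d : ℤ) :
    ∑ v ∈ A, (f v + ((if v = x then c else 0) + (if v = y then d else 0))) =
      ∑ v ∈ A, f v + ((if x ∈ A then c else 0) + (if y ∈ A then d else 0)) := by
  simp [Finset.sum_add_distrib, Finset.sum_ite_eq']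

section eraseEdge

variable {e : κ} {x y : ι} {cx cy rx ry ε : ℤ}

lemma eraseEdge_deg (he : e ∈ P.E) (hj : P.Joins e x y) (A : Finset ι) :
    (P.eraseEdge e x y cx cy rx ry ε).deg A =
      P.deg A - crossing A x y + ((if x ∈ A then cx else 0) + (if y ∈ A then cy else 0)) := by
  have h1 := Finset.add_sum_erase P.E (fun e => crossing A (P.p e) (P.q e)) he
  simp only [hj.crossing] at h1
  simp only [deg, cut, eraseEdge, sum_ite_add_ite]
  omega

/-- The common core of all reductions that direct one edge and delete it. Since `ε` enters with
opposite signs at the two ends, it drops out of `total` and `top`; parity survives because `ε` is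
odd while `cx`, `cy` have the parities of `rx`, `ry`. -/
lemma eraseEdge_valid {v₀ v₁ : ι} (h : P.Valid k v₀) (he : e ∈ P.E) (hj : P.Joins e x y)
    (hxy : x ≠ y) (hε : ε = 1 ∨ ε = -1)
    (hrx : |P.r x + rx| ≤ P.n x + cx) (hry : |P.r y + ry| ≤ P.n y + cy)
    (hcx : (2 : ℤ) ∣ cx - rx) (hcy : (2 : ℤ) ∣ cy - ry)
    (htop : ∑ v ∈ P.V, P.n v + (cx + cy) ≤
      2 * k - 2 + modDist k (∑ v ∈ P.V, P.b v + (rx + ry)))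
    (hcut : ∀ A ⊆ P.V, A.Nonempty → A ≠ P.V →
      A = {v₁} ∧ (2 * k : ℤ) ∣ (P.eraseEdge e x y cx cy rx ry ε).b v₁ ∨
      2 * k - 2 + modDist k (∑ v ∈ A, P.b v +
          ((if x ∈ A then rx - ε else 0) + (if y ∈ A then ry + ε else 0))) ≤
        P.deg A - crossing A x y + ((if x ∈ A then cx else 0) + (if y ∈ A then cy else 0))) :
    (P.eraseEdge e x y cx cy rx ry ε).Valid k v₁ := by
  have hx : x ∈ P.V := by rcases hj with ⟨rfl, rfl⟩ | ⟨rfl, rfl⟩ <;> simp [h.ends e he]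
  have hy : y ∈ P.V := by rcases hj with ⟨rfl, rfl⟩ | ⟨rfl, rfl⟩ <;> simp [h.ends e he]
  constructor
  · intro f hf
    exact h.ends f (Finset.mem_of_mem_erase hf)
  · intro v hv
    have := h.abs_le v hv
    simp only [eraseEdge]
    by_cases h1 : v = x <;> by_cases h2 : v = y
    · exact absurd (h1.symm.trans h2) hxy
    · simpa [h1, hxy] using hrx
    · subst h2; simpa [h1] using hry
    · simpa [h1, h2] using this
  · intro v hv
    have := h.even v hv
    simp only [eraseEdge]
    by_cases h1 : v = x <;> by_cases h2 : v = y
    · exact absurd (h1.symm.trans h2) hxy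
    · subst h1; simp [h2]; omega
    · subst h2; simp [h1]; omega
    · simpa [h1, h2] using this
  · intro A hA
    have h1 := h.parity A hA
    rw [eraseEdge_deg he hj]
    simp only [eraseEdge, sum_ite_add_ite, crossing]
    by_cases h2 : x ∈ A <;> by_cases h3 : y ∈ A <;> simp only [h2, h3] <;> simp <;> omega
  · have h1 := h.total
    simp only [eraseEdge, sum_ite_add_ite, hx, hy, if_true]
    convert h1 using 1; ring
  · simp only [eraseEdge, sum_ite_add_ite, hx, hy, if_true]
    rw [show rx - ε + (ry + ε) = rx + ry by ring]
    exact htop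
  · intro A hA h1 h2
    refine (hcut A hA h1 h2).imp_right fun h3 => ?_
    unfold CutCond
    rw [eraseEdge_deg he hj]
    simpa only [eraseEdge, sum_ite_add_ite] using h3

/-- The congruences carry over because `r` and `b` are changed consistently. For the bound there are
two reasons: either the net outflows do not change at all (`rx = ε`, `ry = -ε`), or all degrees are
so small that the congruence implies the bound. -/
lemma eraseEdge_solvable {v₀ : ι} (hk : 0 < k) (h : P.Valid k v₀) (he : e ∈ P.E)
    (hj : P.Joins e x y) (hε : ε = 1 ∨ ε = -1)
    (hb : (rx = ε ∧ ry = -ε) ∨ ∀ v ∈ P.V, P.deg {v} ≤ 2 * k - 2 + modDist k (P.b v))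
    (hs : (P.eraseEdge e x y cx cy rx ry ε).Solvable k) : P.Solvable k := by
  obtain ⟨σ, hσ, hs⟩ := hs
  obtain ⟨δ, hδ, hδ'⟩ : ∃ δ : ℤ, (δ = 1 ∨ δ = -1) ∧
      ∀ v, δ * arc (P.p e) (P.q e) v = ε * arc x y v := by
    rcases hj with ⟨h1, h2⟩ | ⟨h1, h2⟩
    · exact ⟨ε, hε, fun v => by rw [h1, h2]⟩
    · exact ⟨-ε, by omega, fun v => by rw [h1, h2, arc_swap]; ring⟩
  have hσ' : ∀ f, Function.update σ e δ f = 1 ∨ Function.update σ e δ f = -1 := by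
    intro f
    by_cases hf : f = e
    · subst hf; simpa using hδ
    · simpa [hf] using hσ f
  have hflow : ∀ v, P.flow (Function.update σ e δ) v =
      (P.eraseEdge e x y cx cy rx ry ε).flow σ v + ε * arc x y v := by
    intro v
    unfold flow
    rw [← Finset.add_sum_erase _ _ he, add_comm]
    simp only [Function.update_self, hδ', eraseEdge, add_left_inj]
    refine Finset.sum_congr rfl fun f hf => ?_
    rw [Function.update_of_ne (Finset.ne_of_mem_erase hf)]
  refine ⟨_, hσ', fun v hv => ?_⟩
  have h1 := hs v hv
  have hval : P.r v + P.flow (Function.update σ e δ) v =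
      (P.eraseEdge e x y cx cy rx ry ε).r v + (P.eraseEdge e x y cx cy rx ry ε).flow σ v -
        ((if v = x then rx - ε else 0) + (if v = y then ry + ε else 0)) := by
    rw [hflow]
    simp only [eraseEdge, arc, eq_comm (b := v)]
    split_ifs <;> ring
  have hdvd : (2 * k : ℤ) ∣ P.r v + P.flow (Function.update σ e δ) v - P.b v := by
    have h2 := h1.1
    rw [hval]
    convert h2 using 1
    simp only [eraseEdge]
    ring
  refine ⟨hdvd, ?_⟩
  rcases hb with ⟨hb1, hb2⟩ | hb
  · rw [hval]
    simpa [hb1, hb2] using h1.2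
  · exact h.bound_of_deg_le hk hσ' hv (hb v hv) hdvd

lemma eraseEdge_card (he : e ∈ P.E) :
    (P.eraseEdge e x y cx cy rx ry ε).V.card + (P.eraseEdge e x y cx cy rx ry ε).E.card <
      P.V.card + P.E.card := by
  have := Finset.card_erase_lt_of_mem he
  simp only [eraseEdge]
  omega

end eraseEdge

end OrientationProblem

/-! ### Contraction of a tight set and restriction to it -/

namespace OrientationProblem

variable {ι κ : Type*} [DecidableEq ι] [DecidableEq κ] {k : ℕ} {P : OrientationProblem ι κ} {v₀ : ι}

/-- The problem obtained by identifying vertices with the same image under `π`. -/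
def map (P : OrientationProblem ι κ) (π : ι → ι) : OrientationProblem ι κ where
  V := P.V.image π
  E := P.E
  p e := π (P.p e)
  q e := π (P.q e)
  n u := ∑ v ∈ P.V with π v = u, P.n v
  r u := ∑ v ∈ P.V with π v = u, P.r v
  b u := ∑ v ∈ P.V with π v = u, P.b v

lemma sum_fiber (V : Finset ι) (π : ι → ι) (f : ι → ℤ) (B : Finset ι) :
    ∑ u ∈ B, ∑ v ∈ V with π v = u, f v = ∑ v ∈ V with π v ∈ B, f v := by
  rw [← Finset.sum_fiberwise_of_maps_to (s := V.filter (π · ∈ B)) (t := B) (g := π)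
    (fun v hv => (Finset.mem_filter.1 hv).2)]
  refine Finset.sum_congr rfl fun u hu => ?_
  rw [Finset.filter_filter]
  refine Finset.sum_congr (Finset.filter_congr fun v _ => ?_) fun _ _ => rfl
  constructor
  · rintro rfl; exact ⟨hu, rfl⟩
  · exact fun h => h.2

lemma map_deg (h : P.Valid k v₀) (π : ι → ι) (B : Finset ι) :
    (P.map π).deg B = P.deg {v ∈ P.V | π v ∈ B} := by
  simp only [deg, map, sum_fiber, cut]
  congr 1
  refine Finset.sum_congr rfl fun e he => ?_
  have := h.ends e he
  simp [crossing, this.1, this.2]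

lemma filter_image_eq (V : Finset ι) (π : ι → ι) : {v ∈ V | π v ∈ V.image π} = V :=
  Finset.filter_true_of_mem fun _ hv => Finset.mem_image_of_mem π hv

/-- A set of the contracted problem has the degree and the prescription of its preimage. If the
preimage is the exempt set `{v₀}`, the set is `{π v₀}`, whose fibre is `v₀` alone, so the exemption
is inherited. -/
lemma map_valid (h : P.Valid k v₀) (π : ι → ι) : (P.map π).Valid k (π v₀) := by
  constructor
  · intro e he
    have := h.ends e he
    exact ⟨Finset.mem_image_of_mem π this.1, Finset.mem_image_of_mem π this.2⟩
  · intro u _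
    exact (Finset.abs_sum_le_sum_abs _ _).trans
      (Finset.sum_le_sum fun v hv => h.abs_le v (Finset.mem_filter.1 hv).1)
  · intro u _
    simp only [map, ← Finset.sum_sub_distrib]
    exact Finset.dvd_sum fun v hv => h.even v (Finset.mem_filter.1 hv).1
  · intro B _
    rw [map_deg h]
    simpa only [map, sum_fiber] using h.parity _ (Finset.filter_subset _ _)
  · simpa only [map, sum_fiber, filter_image_eq] using h.total
  · simpa only [map, sum_fiber, filter_image_eq] using h.top
  · intro B hB hne hB'
    have h1 : ({v ∈ P.V | π v ∈ B} : Finset ι).Nonempty := by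
      obtain ⟨u, hu⟩ := hne
      obtain ⟨v, hv, rfl⟩ := Finset.mem_image.1 (hB hu)
      exact ⟨v, by simp [hv, hu]⟩
    have h2 : ({v ∈ P.V | π v ∈ B} : Finset ι) ≠ P.V := by
      intro h2
      refine hB' (hB.antisymm fun u hu => ?_)
      obtain ⟨v, hv, rfl⟩ := Finset.mem_image.1 hu
      rw [← h2] at hv
      exact (Finset.mem_filter.1 hv).2
    refine (h.cutCond _ (Finset.filter_subset _ _) h1 h2).imp ?_ ?_
    · rintro ⟨h3, h4⟩
      have h5 : B = {π v₀} := by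
        ext u
        rw [Finset.mem_singleton]
        constructor
        · intro hu
          obtain ⟨v, hv, rfl⟩ := Finset.mem_image.1 (hB hu)
          have : v ∈ ({v ∈ P.V | π v ∈ B} : Finset ι) := by simp [hv, hu]
          rw [h3, Finset.mem_singleton] at this
          rw [this]
        · rintro rfl
          have : v₀ ∈ ({v ∈ P.V | π v ∈ B} : Finset ι) := by simp [h3]
          exact (Finset.mem_filter.1 this).2
      refine ⟨h5, ?_⟩
      subst h5
      simp only [Finset.mem_singleton] at h3
      simpa [map, h3] using h4
    · intro h3
      unfold CutCond at h3 ⊢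
      rw [map_deg h]
      simpa only [map, sum_fiber] using h3

/-- Edges inside a fibre contribute to two vertices of it with opposite signs and cancel, as do the
loops that they become. -/
lemma map_flow (h : P.Valid k v₀) (π : ι → ι) (σ : κ → ℤ) (u : ι) :
    (P.map π).flow σ u = ∑ v ∈ P.V with π v = u, P.flow σ v := by
  rw [sum_flow]
  refine Finset.sum_congr rfl fun e he => ?_
  have := h.ends e he
  by_cases h1 : π (P.p e) = u <;> by_cases h2 : π (P.q e) = u <;>
    simp [map, arc, this.1, this.2, h1, h2]

/-- The problem on the set `A` in which the other vertices are regarded as the further vertex and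
the edges leaving `A` are directed according to `σ`. -/
def within (P : OrientationProblem ι κ) (A : Finset ι) (σ : κ → ℤ) : OrientationProblem ι κ where
  V := A
  E := {e ∈ P.E | P.p e ∈ A ∧ P.q e ∈ A}
  p := P.p
  q := P.q
  n v := P.n v + ∑ e ∈ P.E with ¬(P.p e ∈ A ∧ P.q e ∈ A), crossing {v} (P.p e) (P.q e)
  r v := P.r v + ∑ e ∈ P.E with ¬(P.p e ∈ A ∧ P.q e ∈ A), σ e * arc (P.p e) (P.q e) v
  b := P.b

section within

variable {A : Finset ι} {σ : κ → ℤ}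

lemma sum_crossing_singleton {B : Finset ι} (hB : B ⊆ A) {x y : ι} (hxy : ¬(x ∈ A ∧ y ∈ A)) :
    ∑ v ∈ B, crossing {v} x y = crossing B x y := by
  have h1 : ∀ v ∈ B, crossing {v} x y = (if x = v then 1 else 0) + (if y = v then 1 else 0) := by
    intro v hv
    unfold crossing
    by_cases h1 : x = v <;> by_cases h2 : y = v
    · subst h1; subst h2; exact absurd ⟨hB hv, hB hv⟩ hxy
    all_goals simp [h1, h2]
  rw [Finset.sum_congr rfl h1, Finset.sum_add_distrib]
  simp only [Finset.sum_ite_eq, crossing]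
  by_cases h2 : x ∈ B <;> by_cases h3 : y ∈ B
  · exact absurd ⟨hB h2, hB h3⟩ hxy
  all_goals simp [h2, h3]

lemma within_deg {B : Finset ι} (hB : B ⊆ A) : (P.within A σ).deg B = P.deg B := by
  simp only [deg, cut, within, Finset.sum_add_distrib]
  rw [Finset.sum_comm, ← Finset.sum_filter_add_sum_filter_not P.E
    (fun e => P.p e ∈ A ∧ P.q e ∈ A) (fun e => crossing B (P.p e) (P.q e))]
  rw [Finset.sum_congr rfl (g := fun e => crossing B (P.p e) (P.q e)) fun e he =>
    sum_crossing_singleton hB (Finset.mem_filter.1 he).2]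
  ring

lemma within_r_add_flow (σ' : κ → ℤ) (v : ι) :
    (P.within A σ).r v + (P.within A σ).flow σ' v =
      P.r v + P.flow (fun e => if P.p e ∈ A ∧ P.q e ∈ A then σ' e else σ e) v := by
  simp only [within, flow]
  rw [← Finset.sum_filter_add_sum_filter_not P.E (fun e => P.p e ∈ A ∧ P.q e ∈ A), add_assoc,
    add_comm (Finset.sum _ _)]
  congr 2
  · exact Finset.sum_congr rfl fun e he => by rw [if_pos (Finset.mem_filter.1 he).2]
  · exact Finset.sum_congr rfl fun e he => by rw [if_neg (Finset.mem_filter.1 he).2]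

/-- The edges leaving `A` become edges of fixed direction, so the total of the new `n` is the degree
of `A`. Tightness of `A` is thus exactly the condition `top`, and the congruence `hsum` of the outer
orientation is the condition `total`. -/
lemma within_valid (h : P.Valid k v₀) (hσ : ∀ e, σ e = 1 ∨ σ e = -1) (hA : A ⊆ P.V) (hA' : A ≠ P.V)
    (htop : P.deg A ≤ 2 * k - 2 + modDist k (∑ v ∈ A, P.b v))
    (hsum : (2 * k : ℤ) ∣ ∑ v ∈ A, (P.r v + P.flow σ v) - ∑ v ∈ A, P.b v) :
    (P.within A σ).Valid k v₀ := by
  have harc : ∀ e v, |σ e * arc (P.p e) (P.q e) v| ≤ crossing {v} (P.p e) (P.q e) := by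
    intro e v
    rw [abs_mul]
    rcases hσ e with h | h <;> simpa [h] using abs_arc_le _ _ _
  constructor
  · intro e he
    exact (Finset.mem_filter.1 he).2
  · intro v hv
    refine (abs_add_le _ _).trans (add_le_add (h.abs_le v (hA hv)) ?_)
    exact (Finset.abs_sum_le_sum_abs _ _).trans (Finset.sum_le_sum fun e _ => harc e v)
  · intro v hv
    simp only [within, add_sub_add_comm, ← Finset.sum_sub_distrib]
    refine dvd_add (h.even v (hA hv)) (Finset.dvd_sum fun e _ => ?_)
    unfold arc crossing
    rcases hσ e with h | h <;> by_cases h1 : P.p e = v <;> by_cases h2 : P.q e = v <;>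
      simp [h, h1, h2]
  · intro B hB
    rw [within_deg (A := A) hB]
    exact h.parity B (hB.trans hA)
  · have : ∑ v ∈ A, (P.within A σ).r v = ∑ v ∈ A, (P.r v + P.flow σ v) := by
      have h1 := fun v => within_r_add_flow (P := P) (A := A) (σ := σ) σ v
      simp only [ite_self] at h1
      rw [← Finset.sum_congr rfl fun v _ => h1 v, Finset.sum_add_distrib, sum_flow, left_eq_add]
      refine Finset.sum_eq_zero fun e he => ?_
      have := (Finset.mem_filter.1 he).2
      simp [within, this.1, this.2]
    change (2 * k : ℤ) ∣ ∑ v ∈ A, (P.within A σ).r v - ∑ v ∈ A, P.b v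
    rwa [this]
  · have h1 : (P.within A σ).deg A = ∑ v ∈ A, (P.within A σ).n v := by
      rw [deg, add_eq_right]
      refine Finset.sum_eq_zero fun e he => ?_
      have := (Finset.mem_filter.1 he).2
      simp [within, crossing, this.1, this.2]
    change ∑ v ∈ A, (P.within A σ).n v ≤ _
    rw [← h1, within_deg subset_rfl]
    exact htop
  · intro B hB hne hB'
    refine (h.cutCond B (hB.trans hA) hne ?_).imp_right fun h1 => ?_
    · rintro rfl
      exact hA' (hA.antisymm hB)
    · unfold CutCond at h1 ⊢
      rwa [within_deg (A := A) hB]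

end within

/-- If a nontrivial set barely satisfies the degree condition, a solution is composed of one of the
problem in which the set is contracted and one of the problem within the set. -/
lemma solvable_of_tight (h : P.Valid k v₀) {A : Finset ι} (hA : A ⊆ P.V) (hA' : A ≠ P.V)
    (hA2 : 2 ≤ A.card) (htop : P.deg A ≤ 2 * k - 2 + modDist k (∑ v ∈ A, P.b v))
    (ih : ∀ (P' : OrientationProblem ι κ) (v : ι), P'.Valid k v →
      P'.V.card + P'.E.card < P.V.card + P.E.card → P'.Solvable k) : P.Solvable k := by
  obtain ⟨a, ha⟩ : A.Nonempty := Finset.card_pos.1 (by omega)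
  set π : ι → ι := fun v => if v ∈ A then a else v with hπ
  have hfa : ({v ∈ P.V | π v = a} : Finset ι) = A := by
    ext v
    simp only [Finset.mem_filter, hπ]
    by_cases hv : v ∈ A
    · simp [hv, hA hv]
    · simp only [hv, if_false, iff_false, not_and]
      rintro - rfl
      exact hv ha
  have hfv : ∀ u ∈ P.V, u ∉ A → ({v ∈ P.V | π v = u} : Finset ι) = {u} := by
    intro u hu huA
    ext v
    simp only [Finset.mem_filter, hπ, Finset.mem_singleton]
    by_cases hv : v ∈ A
    · simp only [hv, if_true]
      constructor
      · rintro ⟨-, rfl⟩; exact absurd ha huA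
      · rintro rfl; exact absurd hv huA
    · simp only [hv, if_false]
      constructor
      · exact fun h => h.2
      · rintro rfl; exact ⟨hu, rfl⟩
  have hcard : (P.map π).V.card < P.V.card := by
    refine lt_of_le_of_ne Finset.card_image_le fun heq => ?_
    have hinj := Finset.card_image_iff.1 heq
    obtain ⟨c, hc, hca⟩ := Finset.exists_mem_ne (by omega : 1 < A.card) a
    exact hca (hinj (hA hc) (hA ha) (by simp [hπ, hc]))
  obtain ⟨σ₁, hσ₁, hs₁⟩ := ih (P.map π) _ (map_valid h π) (by
    change _ + P.E.card < _
    omega)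
  have hval : ∀ u, (P.map π).r u + (P.map π).flow σ₁ u =
      ∑ v ∈ P.V with π v = u, (P.r v + P.flow σ₁ v) := by
    intro u
    rw [map_flow h, Finset.sum_add_distrib]; rfl
  have hsum : (2 * k : ℤ) ∣ ∑ v ∈ A, (P.r v + P.flow σ₁ v) - ∑ v ∈ A, P.b v := by
    have h1 := (hs₁ a (Finset.mem_image.2 ⟨a, hA ha, by simp [hπ]⟩)).1
    rw [hval] at h1
    simpa only [map, hfa] using h1
  obtain ⟨σ₂, hσ₂, hs₂⟩ := ih (P.within A σ₁) _ (within_valid h hσ₁ hA hA' htop hsum) (by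
    have h1 : A.card < P.V.card := Finset.card_lt_card (hA.ssubset_of_ne hA')
    have h2 : ({e ∈ P.E | P.p e ∈ A ∧ P.q e ∈ A} : Finset κ).card ≤ P.E.card :=
      Finset.card_filter_le _ _
    simp only [within]
    omega)
  -- Edges inside `A` are loops of the contracted problem, so `σ₁` may be overwritten on them
  -- without affecting the vertices outside `A`.
  refine ⟨fun e => if P.p e ∈ A ∧ P.q e ∈ A then σ₂ e else σ₁ e, fun e => ?_, fun v hv => ?_⟩
  · dsimp only; split_ifs
    · exact hσ₂ e
    · exact hσ₁ e
  · by_cases hvA : v ∈ A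
    · have := hs₂ v hvA
      rwa [within_r_add_flow] at this
    · have h1 : P.flow (fun e => if P.p e ∈ A ∧ P.q e ∈ A then σ₂ e else σ₁ e) v =
          P.flow σ₁ v := by
        refine Finset.sum_congr rfl fun e _ => ?_
        dsimp only
        split_ifs with h2
        · have h3 : P.p e ≠ v := fun h3 => hvA (h3 ▸ h2.1)
          have h4 : P.q e ≠ v := fun h3 => hvA (h3 ▸ h2.2)
          simp [arc, h3, h4]
        · rfl
      have h2 := hs₁ v (Finset.mem_image.2 ⟨v, hv, by simp [hπ, hvA]⟩)
      rw [hval, hfv v hv hvA, Finset.sum_singleton] at h2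
      rw [h1]
      simpa only [map, hfv v hv hvA, Finset.sum_singleton] using h2

end OrientationProblem

/-! ### Lifting edges at a vertex with slack -/

namespace OrientationProblem

variable {ι κ : Type*} [DecidableEq ι] [DecidableEq κ] {k : ℕ} {P : OrientationProblem ι κ}

/-- All problems that are smaller than `P` in terms of vertices and edges are solvable. -/
def SmallerSolvable (k : ℕ) (P : OrientationProblem ι κ) : Prop :=
  ∀ (P' : OrientationProblem ι κ) (v : ι), P'.Valid k v →
    P'.V.card + P'.E.card < P.V.card + P.E.card → P'.Solvable k

/-- Sets other than single vertices and `V` satisfy the degree condition with a margin. -/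
def Strict (k : ℕ) (P : OrientationProblem ι κ) : Prop :=
  ∀ A ⊆ P.V, 2 ≤ A.card → A ≠ P.V → 2 * k + modDist k (∑ v ∈ A, P.b v) ≤ P.deg A

lemma Joins.exists_sign {e : κ} {x y : ι} (h : P.Joins e x y) : ∃ δ : ℤ, (δ = 1 ∨ δ = -1) ∧
    ∀ v, δ * arc (P.p e) (P.q e) v = arc x y v := by
  rcases h with ⟨h1, h2⟩ | ⟨h1, h2⟩
  · exact ⟨1, Or.inl rfl, fun v => by rw [h1, h2, one_mul]⟩
  · exact ⟨-1, Or.inr rfl, fun v => by rw [h1, h2, arc_swap]; ring⟩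

lemma Joins.left_mem {v₀ : ι} (hP : P.Valid k v₀) {e : κ} {x y : ι} (h : P.Joins e x y)
    (he : e ∈ P.E) : x ∈ P.V := by
  rcases h with ⟨rfl, rfl⟩ | ⟨rfl, rfl⟩ <;> simp [hP.ends e he]

lemma Joins.right_mem {v₀ : ι} (hP : P.Valid k v₀) {e : κ} {x y : ι} (h : P.Joins e x y)
    (he : e ∈ P.E) : y ∈ P.V := h.symm.left_mem hP he

lemma Joins.right_unique {e : κ} {x y w : ι} (h : P.Joins e x y) (h' : P.Joins e x w) : y = w := by
  rcases h with ⟨h1, h2⟩ | ⟨h1, h2⟩ <;> rcases h' with ⟨h3, h4⟩ | ⟨h3, h4⟩ <;> simp_all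

lemma Joins.ne (hl : ∀ e ∈ P.E, P.p e ≠ P.q e) {e : κ} {x y : ι} (h : P.Joins e x y)
    (he : e ∈ P.E) : x ≠ y := by
  rintro rfl
  rcases h with ⟨h1, h2⟩ | ⟨h1, h2⟩ <;> exact hl e he (h1.trans h2.symm)

lemma exists_joins_of_crossing_ne_zero {e : κ} {x : ι} (h : crossing {x} (P.p e) (P.q e) ≠ 0) :
    ∃ y, P.Joins e x y := by
  unfold crossing at h
  by_cases h1 : P.p e = x
  · exact ⟨_, Or.inl ⟨h1, rfl⟩⟩
  · by_cases h2 : P.q e = x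
    · exact ⟨_, Or.inr ⟨rfl, h2⟩⟩
    · simp [h1, h2] at h

lemma Valid.n_pos {v₀ : ι} (h : P.Valid k v₀) {v : ι} (hv : v ∈ P.V) (h0 : P.n v ≠ 0) :
    1 ≤ P.n v := by have := h.n_nonneg hv; omega

/-- The problem obtained by replacing the edges `e` and `f` by an edge joining `y` and `w`. -/
def lift (P : OrientationProblem ι κ) (e f : κ) (y w : ι) : OrientationProblem ι κ where
  V := P.V
  E := P.E.erase f
  p := Function.update P.p e y
  q := Function.update P.q e w
  n := P.n
  r := P.r
  b := P.b

section lift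

variable {e f : κ} {c y w : ι}

lemma lift_sum (he : e ∈ P.E) (hf : f ∈ P.E) (hef : e ≠ f) (g : κ → ι → ι → ℤ) :
    ∑ d ∈ (P.lift e f y w).E, g d ((P.lift e f y w).p d) ((P.lift e f y w).q d) =
      ∑ d ∈ P.E, g d (P.p d) (P.q d) - g e (P.p e) (P.q e) - g f (P.p f) (P.q f) + g e y w := by
  have he' : e ∈ P.E.erase f := Finset.mem_erase.2 ⟨hef, he⟩
  simp only [lift]
  rw [← Finset.add_sum_erase _ _ hf, ← Finset.add_sum_erase _ _ he', ← Finset.add_sum_erase _ _ he',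
    Function.update_self, Function.update_self]
  have : ∑ d ∈ (P.E.erase f).erase e, g d (Function.update P.p e y d) (Function.update P.q e w d) =
      ∑ d ∈ (P.E.erase f).erase e, g d (P.p d) (P.q d) := by
    refine Finset.sum_congr rfl fun d hd => ?_
    have := Finset.ne_of_mem_erase hd
    rw [Function.update_of_ne this, Function.update_of_ne this]
  rw [this]
  ring

lemma lift_deg (he : e ∈ P.E) (hf : f ∈ P.E) (hef : e ≠ f) (hje : P.Joins e c y)
    (hjf : P.Joins f c w) (A : Finset ι) :
    (P.lift e f y w).deg A = P.deg A - crossing A c y - crossing A c w + crossing A y w := by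
  have := lift_sum (y := y) (w := w) he hf hef (fun _ a b => crossing A a b)
  rw [hje.crossing, hjf.crossing] at this
  simp only [deg, cut]
  rw [this]
  simp only [lift]
  ring

/-- The directed edge between `y` and `w` is turned back into a directed path through `c`; its two
edges cancel at `c`, so no net outflow changes. -/
lemma lift_solvable (he : e ∈ P.E) (hf : f ∈ P.E) (hef : e ≠ f) (hje : P.Joins e c y)
    (hjf : P.Joins f c w) (hs : (P.lift e f y w).Solvable k) : P.Solvable k := by
  obtain ⟨σ, hσ, hs⟩ := hs
  obtain ⟨δ, hδ, hδ'⟩ := hje.symm.exists_sign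
  obtain ⟨η, hη, hη'⟩ := hjf.exists_sign
  set τ : κ → ℤ := fun d => if d = e then σ e * δ else if d = f then σ e * η else σ d with hτ
  have hflow : ∀ v, P.flow τ v = (P.lift e f y w).flow σ v := by
    intro v
    have h1 := lift_sum (y := y) (w := w) he hf hef (fun d a b => τ d * arc a b v)
    have h2 : (P.lift e f y w).flow σ v = ∑ d ∈ (P.lift e f y w).E,
        τ d * arc ((P.lift e f y w).p d) ((P.lift e f y w).q d) v - σ e * δ * arc y w v
          + σ e * arc y w v := by
      have he' : e ∈ (P.lift e f y w).E := Finset.mem_erase.2 ⟨hef, he⟩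
      rw [flow, ← Finset.add_sum_erase _ _ he', ← Finset.add_sum_erase _ _ he']
      have : ∑ d ∈ (P.lift e f y w).E.erase e,
          σ d * arc ((P.lift e f y w).p d) ((P.lift e f y w).q d) v =
          ∑ d ∈ (P.lift e f y w).E.erase e,
          τ d * arc ((P.lift e f y w).p d) ((P.lift e f y w).q d) v := by
        refine Finset.sum_congr rfl fun d hd => ?_
        have h3 := Finset.ne_of_mem_erase hd
        have h4 := Finset.ne_of_mem_erase (Finset.mem_of_mem_erase hd)
        simp [hτ, h3, h4]
      rw [this]
      simp only [hτ, if_true, lift, Function.update_self]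
      ring
    rw [h2, h1]
    simp only [hτ, if_true, if_neg hef.symm]
    have h3 := hδ' v
    have h4 := hη' v
    have h5 : arc y w v = arc y c v + arc c w v := by unfold arc; ring
    rw [flow]
    rw [mul_assoc (σ e) δ (arc (P.p e) (P.q e) v), h3, mul_assoc (σ e) η, h4, h5]
    ring
  refine ⟨τ, fun d => ?_, fun v hv => ?_⟩
  · have h1 := hσ e
    have h2 := hσ d
    simp only [hτ]
    split_ifs
    · rcases h1 with h1 | h1 <;> rcases hδ with h3 | h3 <;> simp [h1, h3]
    · rcases h1 with h1 | h1 <;> rcases hη with h3 | h3 <;> simp [h1, h3]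
    · exact h2
  · rw [hflow]
    exact hs v hv

/-- Lifting two edges at a vertex whose degree is not needed in full. -/
lemma solvable_of_lift (h : P.Valid k v₀) (hst : P.Strict k)
    (hl : ∀ e ∈ P.E, P.p e ≠ P.q e) (he : e ∈ P.E) (hf : f ∈ P.E)
    (hje : P.Joins e c y) (hjf : P.Joins f c w) (hyw : y ≠ w)
    (hc : c = v₀ ∧ (2 * k : ℤ) ∣ P.b v₀ ∨ 2 * k + modDist k (P.b c) ≤ P.deg {c})
    (ih : P.SmallerSolvable k) : P.Solvable k := by
  have hef : e ≠ f := by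
    rintro rfl
    exact hyw (hje.right_unique hjf)
  have hcy := hje.ne hl he
  have hcw := hjf.ne hl hf
  refine lift_solvable he hf hef hje hjf (ih _ v₀ ?_ ?_)
  · have hdeg := lift_deg he hf hef hje hjf
    constructor
    · intro d hd
      have h1 := h.ends d (Finset.mem_of_mem_erase hd)
      have h2 := hje.right_mem h he
      have h3 := hjf.right_mem h hf
      simp only [lift]
      by_cases h4 : d = e
      · subst h4; simp [h2, h3]
      · simpa [h4] using h1
    · exact h.abs_le
    · exact h.even
    · intro A hA
      have h1 := h.parity A hA
      rw [hdeg]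
      simp only [lift, crossing]
      split_ifs <;> first | omega | tauto
    · exact h.total
    · exact h.top
    · intro A hA hne hA'
      unfold CutCond
      rw [hdeg]
      by_cases hcard : 2 ≤ A.card
      · right
        have h1 := hst A hA hcard hA'
        -- A lift costs a set at most two edges, which is the margin granted by `Strict`.
        have h2 : crossing A c y + crossing A c w - crossing A y w ≤ 2 := by
          unfold crossing; split_ifs <;> omega
        simp only [lift]
        omega
      · have h1 : A.card = 1 := by have := hne.card_pos; omega
        obtain ⟨v, rfl⟩ := Finset.card_eq_one.1 h1
        by_cases hvc : v = c
        · subst hvc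
          rcases hc with ⟨rfl, hc⟩ | hc
          · exact Or.inl ⟨rfl, hc⟩
          · right
            simp only [lift, Finset.sum_singleton, crossing, Finset.mem_singleton, hcy.symm,
              hcw.symm]
            simp
            omega
        · refine (h.cutCond {v} hA hne hA').imp_right fun h2 => ?_
          -- A single vertex other than `c` keeps its degree; `y ≠ w` is needed here, as otherwise
          -- the new edge would be a loop.
          have h3 : crossing {v} c y + crossing {v} c w - crossing {v} y w = 0 := by
            simp only [crossing, Finset.mem_singleton, Ne.symm hvc]
            by_cases h4 : y = v <;> by_cases h5 : w = v <;> simp [h4, h5]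
            exact hyw (h4.trans h5.symm)
          unfold CutCond at h2
          simp only [lift]
          omega
  · have := Finset.card_erase_lt_of_mem hf
    simp only [lift]
    omega

/-- Lifting an edge together with an edge of fixed direction. -/
lemma solvable_of_lift_fixed (hk : 0 < k) (h : P.Valid k v₀) (hst : P.Strict k)
    (hl : ∀ e ∈ P.E, P.p e ≠ P.q e) (he : e ∈ P.E) (hje : P.Joins e c y) (hn : P.n c ≠ 0)
    (hc : c = v₀ ∧ (2 * k : ℤ) ∣ P.b v₀ ∨ 2 * k + modDist k (P.b c) ≤ P.deg {c})
    (ih : P.SmallerSolvable k) : P.Solvable k := by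
  have hcy := hje.ne hl he
  have hcV := hje.left_mem h he
  have hyV := hje.right_mem h he
  have h1 := h.abs_le c hcV
  have h2 := h.abs_le y hyV
  have h3 := h.even c hcV
  have hn' := h.n_pos hcV hn
  rw [_root_.abs_le] at h1 h2
  -- `ε` is the direction of at least half of the fixed edges at `c`, so that a fixed edge of this
  -- direction exists. Together with `e` it is replaced by a fixed edge of the same direction at
  -- `y`.
  obtain ⟨ε, hε, hε'⟩ : ∃ ε : ℤ, (ε = 1 ∨ ε = -1) ∧ |P.r c + -ε| ≤ P.n c + -1 := by
    by_cases h4 : 0 < P.r c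
    · exact ⟨1, Or.inl rfl, by rw [_root_.abs_le]; omega⟩
    · exact ⟨-1, Or.inr rfl, by rw [_root_.abs_le]; omega⟩
  refine eraseEdge_solvable (cx := -1) (cy := 1) (rx := -ε) (ry := ε) (ε := -ε) hk h he hje
    (by omega) (Or.inl ⟨rfl, by ring⟩)
    (ih _ v₀ (eraseEdge_valid h he hje hcy (by omega) hε' ?_ (by omega) (by omega) ?_ ?_)
      (eraseEdge_card he))
  · rw [_root_.abs_le]; omega
  · simpa using h.top
  · intro A hA hne hA'
    have hb : (P.eraseEdge e c y (-1) 1 (-ε) ε (-ε)).b v₀ = P.b v₀ := by simp [eraseEdge]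
    rw [hb]
    simp only [sub_self, add_neg_cancel, ite_self, add_zero]
    by_cases hcard : 2 ≤ A.card
    · right
      have h1 := hst A hA hcard hA'
      unfold crossing; split_ifs <;> omega
    · have h1 : A.card = 1 := by have := hne.card_pos; omega
      obtain ⟨v, rfl⟩ := Finset.card_eq_one.1 h1
      by_cases hvc : v = c
      · subst hvc
        rcases hc with ⟨rfl, hc⟩ | hc
        · exact Or.inl ⟨rfl, hc⟩
        · right
          simp [crossing, hcy.symm]
          omega
      · refine (h.cutCond {v} hA hne hA').imp_right fun h2 => ?_
        unfold CutCond at h2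
        simp only [crossing, Finset.mem_singleton, Ne.symm hvc, false_iff, if_false]
        by_cases h4 : y = v <;> simp [h4] <;> simpa using h2

end lift

/-- Deleting a vertex of degree zero. -/
lemma solvable_of_deg_eq_zero {x : ι} (h : P.Valid k x) (hl : ∀ e ∈ P.E, P.p e ≠ P.q e)
    (hk : 0 < k) (hx : x ∈ P.V) (hd : P.deg {x} = 0) (hb : (2 * k : ℤ) ∣ P.b x)
    (ih : P.SmallerSolvable k) : P.Solvable k := by
  have h1 := P.cut_nonneg {x}
  have h2 := h.n_nonneg hx
  rw [deg_singleton] at hd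
  have hn : P.n x = 0 := by omega
  have hr : P.r x = 0 := by have := h.abs_le x hx; rw [hn] at this; simpa using this
  have hcut : P.cut {x} = 0 := by omega
  have hne : ∀ e ∈ P.E, P.p e ≠ x ∧ P.q e ≠ x := by
    intro e he
    have h3 := (Finset.sum_eq_zero_iff_of_nonneg
      (fun e _ => crossing_nonneg {x} (P.p e) (P.q e))).1 hcut e he
    have h4 := hl e he
    simp only [crossing, Finset.mem_singleton, ite_eq_left_iff, one_ne_zero, imp_false,
      not_not] at h3
    constructor
    · intro h5; exact h4 (h5.trans (h3.1 h5).symm)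
    · intro h5; exact h4 ((h3.2 h5).trans h5.symm)
  have hsr := Finset.add_sum_erase P.V P.r hx
  have hsb := Finset.add_sum_erase P.V P.b hx
  have hsn := Finset.add_sum_erase P.V P.n hx
  obtain ⟨σ, hσ, hs⟩ := ih { P with V := P.V.erase x } x (by
    constructor
    · intro e he
      have h3 := h.ends e he
      have h4 := hne e he
      simp [h3, h4]
    · exact fun v hv => h.abs_le v (Finset.mem_of_mem_erase hv)
    · exact fun v hv => h.even v (Finset.mem_of_mem_erase hv)
    · exact fun A hA => h.parity A (hA.trans (Finset.erase_subset _ _))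
    · have h3 := dvd_add h.total hb
      dsimp only
      rwa [show ∑ v ∈ P.V.erase x, P.r v - ∑ v ∈ P.V.erase x, P.b v =
        ∑ v ∈ P.V, P.r v - ∑ v ∈ P.V, P.b v + P.b x by omega]
    · have h3 := h.top
      dsimp only
      rw [modDist.congr (y := ∑ v ∈ P.V, P.b v) (by
        rw [← hsb, sub_add_cancel_right]; exact (dvd_neg).2 hb)]
      omega
    · intro A hA hA1 hA2
      have hxA : x ∉ A := fun h3 => by simpa using hA h3
      refine (h.cutCond A (hA.trans (Finset.erase_subset _ _)) hA1 ?_).imp_left ?_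
      · rintro rfl; exact hxA hx
      · rintro ⟨rfl, -⟩; simp at hxA) (by
    have := Finset.card_erase_lt_of_mem hx
    dsimp only
    omega)
  refine ⟨σ, hσ, fun v hv => ?_⟩
  by_cases hvx : v = x
  · subst hvx
    have h3 := P.abs_flow_le hσ v
    rw [hcut] at h3
    have h4 : P.flow σ v = 0 := by simpa using h3
    rw [hr, h4]
    refine ⟨by simpa using hb, ?_⟩
    rw [add_zero, abs_zero]
    omega
  · exact hs v (Finset.mem_erase.2 ⟨hvx, hv⟩)

lemma crossing_singleton_eq_one {e : κ} {x y : ι} (h : P.Joins e x y) (hxy : x ≠ y) :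
    crossing {x} (P.p e) (P.q e) = 1 := by
  rw [h.crossing]; simp [crossing, hxy.symm]

/-- A reduction at a vertex whose degree is not needed in full. -/
lemma solvable_of_slack {x : ι} (hk : 2 ≤ k) (h : P.Valid k x) (hst : P.Strict k)
    (hl : ∀ e ∈ P.E, P.p e ≠ P.q e) (hcard : 2 ≤ P.V.card) (hxV : x ∈ P.V)
    (hx : (2 * k : ℤ) ∣ P.b x ∨ 2 * k + modDist k (P.b x) ≤ P.deg {x})
    (htop : 2 * k - 4 + modDist k (∑ v ∈ P.V, P.b v) < ∑ v ∈ P.V, P.n v)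
    (ih : P.SmallerSolvable k) : P.Solvable k := by
  have hk0 : 0 < k := by omega
  have hc : x = x ∧ (2 * k : ℤ) ∣ P.b x ∨ 2 * k + modDist k (P.b x) ≤ P.deg {x} :=
    hx.imp_left fun h => ⟨rfl, h⟩
  have hxb := modDist.nonneg k (P.b x)
  have hpar := h.parity {x} (by simpa using hxV)
  rw [Finset.sum_singleton] at hpar
  by_cases hd : P.deg {x} = 0
  · refine solvable_of_deg_eq_zero h hl hk0 hxV hd ?_ ih
    rcases hx with hx | hx
    · exact hx
    · omega
  -- If `2k` divides `P.b x`, the degree of `x` is even and nonzero.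
  have hd2 : 2 + modDist k (P.b x) ≤ P.deg {x} := by
    rcases hx with hx | hx
    · have h1 := P.cut_nonneg {x}
      have h2 := h.n_nonneg hxV
      have h3 := (modDist.eq_zero_iff k _).2 hx
      have h4 := deg_singleton P x
      have h5 := (Dvd.intro _ rfl : (2 : ℤ) ∣ 2 * k).trans hx
      omega
    · omega
  have hdx := deg_singleton P x
  by_cases hS : ∃ e ∈ P.E, ∃ y, P.Joins e x y
  · obtain ⟨e, he, y, hje⟩ := hS
    by_cases hn : P.n x = 0
    · by_cases hw : ∃ f ∈ P.E, ∃ w, P.Joins f x w ∧ y ≠ w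
      · obtain ⟨f, hf, w, hjf, hyw⟩ := hw
        exact solvable_of_lift h hst hl he hf hje hjf hyw hc ih
      -- All edges at `x` lead to `y`, so no lift at `x` is possible. Then `y` turns out to have
      -- slack, and the lift takes place there.
      · push Not at hw
        have hxy := hje.ne hl he
        have hyV := hje.right_mem h he
        have hdy := deg_singleton P y
        have hle : ∀ f ∈ P.E, crossing {x} (P.p f) (P.q f) ≠ 0 → P.Joins f x y := by
          intro f hf h1
          obtain ⟨w, hjf⟩ := exists_joins_of_crossing_ne_zero h1
          rwa [hw f hf w hjf]
        have hpair : P.deg {x, y} = P.deg {y} - P.deg {x} := by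
          have h1 : P.cut {x, y} = P.cut {y} - P.cut {x} := by
            unfold cut
            rw [← Finset.sum_sub_distrib]
            refine Finset.sum_congr rfl fun f hf => ?_
            by_cases h1 : crossing {x} (P.p f) (P.q f) = 0
            · rw [h1, sub_zero]
              have h2 := hl f hf
              simp only [crossing, Finset.mem_singleton, ite_eq_left_iff, one_ne_zero, imp_false,
                not_not] at h1
              have h3 : P.p f ≠ x := fun h3 => h2 (h3.trans (h1.1 h3).symm)
              have h4 : P.q f ≠ x := fun h4 => h2 ((h1.2 h4).trans h4.symm)
              simp [crossing, h3, h4]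
            · have h2 := hle f hf h1
              rw [h2.crossing, h2.crossing, h2.crossing]
              simp [crossing, hxy, hxy.symm]
          rw [deg, h1, Finset.sum_pair hxy]
          omega
        have hsum : P.deg {y} = P.deg {x} + P.deg {x, y} := by omega
        have hxyV : ({x, y} : Finset ι) ⊆ P.V := by
          intro v hv
          rcases Finset.mem_insert.1 hv with rfl | hv
          · exact hxV
          · rwa [Finset.mem_singleton.1 hv]
        -- If `x` and `y` are the only vertices, the degree condition for the pair comes from `htop`
        -- and parity, otherwise from `Strict`.
        have hpair2 : 2 * k - 2 + modDist k (P.b x + P.b y) ≤ P.deg {x, y} ∧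
            (2 * k + modDist k (P.b x + P.b y) ≤ P.deg {x, y} ∨ P.n y ≠ 0) := by
          by_cases hV : ({x, y} : Finset ι) = P.V
          · rw [← hV, Finset.sum_pair hxy, Finset.sum_pair hxy] at htop
            have h1 := h.parity {x, y} hxyV
            rw [Finset.sum_pair hxy] at h1
            have h2 := modDist.even_sub k (P.b x + P.b y)
            have h3 := modDist.nonneg k (P.b x + P.b y)
            have h4 := P.cut_nonneg {x, y}
            have h5 : P.deg {x, y} = P.cut {x, y} + (P.n x + P.n y) := by
              rw [deg, Finset.sum_pair hxy]
            omega
          · have h1 := hst {x, y} hxyV (by rw [Finset.card_pair hxy]) hV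
            rw [Finset.sum_pair hxy] at h1
            omega
        -- The degree of `y` is the sum of those of `x` and `{x, y}`, hence at least `2 + modDist k
        -- (P.b x)` plus `2k - 2 + modDist k (P.b x + P.b y)`. The triangle inequality bounds this
        -- below by `2k + modDist k (P.b y)`.
        have hcy : y = x ∧ (2 * k : ℤ) ∣ P.b x ∨ 2 * k + modDist k (P.b y) ≤ P.deg {y} := by
          right
          have h1 := modDist.add_le hk0 (P.b x + P.b y) (-P.b x)
          rw [modDist.neg hk0, show P.b x + P.b y + -P.b x = P.b y by ring] at h1
          omega
        by_cases hny : P.n y = 0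
        -- If all edges at `y` led to `x`, the degree of `y` would not exceed that of `x`, although
        -- `{x, y}` has positive degree.
        · have : ∃ f ∈ P.E, ∃ w, P.Joins f y w ∧ x ≠ w := by
            by_contra! hcon
            have h1 : P.cut {y} ≤ P.cut {x} := by
              refine Finset.sum_le_sum fun f hf => ?_
              by_cases h1 : crossing {y} (P.p f) (P.q f) = 0
              · rw [h1]; exact crossing_nonneg _ _ _
              · obtain ⟨w, hjf⟩ := exists_joins_of_crossing_ne_zero h1
                have := hcon f hf w hjf
                subst this
                rw [crossing_singleton_eq_one hjf hxy.symm,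
                  crossing_singleton_eq_one hjf.symm hxy]
            have h2 := modDist.nonneg k (P.b x + P.b y)
            omega
          obtain ⟨f, hf, w, hjf, hxw⟩ := this
          exact solvable_of_lift h hst hl he hf hje.symm hjf hxw hcy ih
        · exact solvable_of_lift_fixed hk0 h hst hl he hje.symm hny hcy ih
    · exact solvable_of_lift_fixed hk0 h hst hl he hje hn hc ih
  -- Now `x` has only edges of fixed direction. Adding its degree to that of the complement gives a
  -- total of `n` of at least `2k` plus the distance, which violates `top`.
  · exfalso
    have hcut : P.cut {x} = 0 := by
      refine Finset.sum_eq_zero fun e he => ?_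
      by_contra h1
      obtain ⟨y, hy⟩ := exists_joins_of_crossing_ne_zero h1
      exact hS ⟨e, he, y, hy⟩
    have hcut' : P.cut (P.V.erase x) = 0 := by
      rw [← hcut]
      refine Finset.sum_congr rfl fun e he => ?_
      have h1 := h.ends e he
      simp only [crossing, Finset.mem_erase, h1.1, h1.2, and_true, Finset.mem_singleton, not_iff_not]
    have hxe : x ∉ P.V.erase x := by simp
    have h1 : P.CutCond k (P.V.erase x) := by
      refine (h.cutCond _ (Finset.erase_subset _ _) ?_ ?_).resolve_left ?_
      · rw [← Finset.card_pos, Finset.card_erase_of_mem hxV]; omega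
      · intro h2; rw [h2] at hxe; exact hxe hxV
      · rintro ⟨h2, -⟩; simp [h2] at hxe
    have hsb := Finset.sum_erase_add P.V P.b hxV
    have hsn := Finset.sum_erase_add P.V P.n hxV
    have h2 := h.top
    have h3 := modDist.add_le hk0 (∑ v ∈ P.V.erase x, P.b v) (P.b x)
    unfold CutCond deg at h1
    rw [hsb] at h3
    omega

end OrientationProblem

/-! ### Problems without slack, and the induction -/

namespace OrientationProblem

variable {ι κ : Type*} [DecidableEq ι] [DecidableEq κ] {k : ℕ} {P : OrientationProblem ι κ} {v₀ : ι}

lemma solvable_of_loop (h : P.Valid k v₀) {e : κ} (he : e ∈ P.E) (hl : P.p e = P.q e)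
    (ih : P.SmallerSolvable k) : P.Solvable k := by
  have hdeg : ∀ A, ({ P with E := P.E.erase e } : OrientationProblem ι κ).deg A = P.deg A := by
    intro A
    have := Finset.add_sum_erase P.E (fun e => crossing A (P.p e) (P.q e)) he
    rw [hl, crossing_self, zero_add] at this
    simp only [deg, cut, this]
  obtain ⟨σ, hσ, hs⟩ := ih { P with E := P.E.erase e } v₀ (by
    constructor
    · exact fun f hf => h.ends f (Finset.mem_of_mem_erase hf)
    · exact h.abs_le
    · exact h.even
    · exact fun A hA => by rw [hdeg]; exact h.parity A hA
    · exact h.total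
    · exact h.top
    · intro A hA h1 h2
      unfold CutCond
      rw [hdeg]
      exact h.cutCond A hA h1 h2) (by
    have := Finset.card_erase_lt_of_mem he
    dsimp only
    omega)
  refine ⟨σ, hσ, fun v hv => ?_⟩
  have : P.flow σ v = ({ P with E := P.E.erase e } : OrientationProblem ι κ).flow σ v := by
    have := Finset.add_sum_erase P.E (fun e => σ e * arc (P.p e) (P.q e) v) he
    rw [hl, arc_self, mul_zero, zero_add] at this
    simp only [flow, this]
  rw [this]
  exact hs v hv

/-- Redirecting an edge via the further vertex. -/
lemma solvable_of_subdivide (hk : 0 < k) (h : P.Valid k v₀) (hl : ∀ e ∈ P.E, P.p e ≠ P.q e)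
    {e : κ} (he : e ∈ P.E)
    (htop : ∑ v ∈ P.V, P.n v + 2 ≤ 2 * k - 2 + modDist k (∑ v ∈ P.V, P.b v))
    (ih : P.SmallerSolvable k) : P.Solvable k := by
  have hje : P.Joins e (P.p e) (P.q e) := Or.inl ⟨rfl, rfl⟩
  have h1 := h.abs_le _ (h.ends e he).1
  have h2 := h.abs_le _ (h.ends e he).2
  rw [_root_.abs_le] at h1 h2
  -- The edge becomes a fixed edge out of `p e` and a fixed edge into `q e`. No degree drops; the
  -- only cost is two more edges at the further vertex.
  refine eraseEdge_solvable (cx := 1) (cy := 1) (rx := 1) (ry := -1) (ε := 1) hk h he hje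
    (by omega) (Or.inl ⟨rfl, rfl⟩) (ih _ v₀ (eraseEdge_valid h he hje (hl e he) (by omega)
      (by rw [_root_.abs_le]; omega) (by rw [_root_.abs_le]; omega) (by omega) (by omega)
      (by simpa using htop) ?_) (eraseEdge_card he))
  intro A hA hne hA'
  refine (h.cutCond A hA hne hA').imp ?_ fun h3 => ?_
  · rintro ⟨rfl, h4⟩
    exact ⟨rfl, by simpa [eraseEdge] using h4⟩
  · unfold CutCond at h3
    simp only [sub_self, neg_add_cancel, ite_self, add_zero]
    unfold crossing
    split_ifs <;> first | omega | tauto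

/-- The problem with all directions reversed. -/
def neg (P : OrientationProblem ι κ) : OrientationProblem ι κ :=
  { P with r := fun v => -P.r v, b := fun v => -P.b v }

lemma neg_cutCond (hk : 0 < k) {A : Finset ι} (h : P.CutCond k A) : P.neg.CutCond k A := by
  unfold CutCond at h ⊢
  simp only [neg, Finset.sum_neg_distrib, modDist.neg hk]
  exact h

lemma neg_valid (hk : 0 < k) (h : P.Valid k v₀) : P.neg.Valid k v₀ := by
  constructor
  · exact h.ends
  · intro v hv
    simpa [neg] using h.abs_le v hv
  · intro v hv
    have := h.even v hv
    simp only [neg]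
    omega
  · intro A hA
    have := h.parity A hA
    change (2 : ℤ) ∣ P.deg A - ∑ v ∈ A, -P.b v
    rw [Finset.sum_neg_distrib]
    omega
  · have := (dvd_neg).2 h.total
    simp only [neg, Finset.sum_neg_distrib]
    rwa [neg_sub_neg, ← neg_sub]
  · simpa only [neg, Finset.sum_neg_distrib, modDist.neg hk] using h.top
  · intro A hA h1 h2
    exact (h.cutCond A hA h1 h2).imp (fun h3 => ⟨h3.1, (dvd_neg).2 h3.2⟩) (neg_cutCond hk)

lemma neg_solvable (h : P.neg.Solvable k) : P.Solvable k := by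
  obtain ⟨σ, hσ, hs⟩ := h
  refine ⟨fun e => -σ e, fun e => ?_, fun v hv => ?_⟩
  · have := hσ e
    dsimp only
    omega
  · have h1 : P.flow (fun e => -σ e) v = -P.neg.flow σ v := by
      simp [flow, neg]
    obtain ⟨h2, h3⟩ := hs v hv
    rw [h1, show P.r v + -P.neg.flow σ v = -(P.neg.r v + P.neg.flow σ v) by simp [neg]; ring,
      abs_neg]
    refine ⟨?_, h3⟩
    rw [← dvd_neg]
    rwa [show -(-(P.neg.r v + P.neg.flow σ v) - P.b v) = P.neg.r v + P.neg.flow σ v - P.neg.b v by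
      simp [neg]; ring]

lemma solvable_of_card_le_one (hk : 0 < k) (h : P.Valid k v₀) (hV : P.V.card ≤ 1) :
    P.Solvable k := by
  refine ⟨fun _ => 1, fun _ => Or.inl rfl, fun v hv => ?_⟩
  have hV' : P.V = {v} := Finset.eq_singleton_iff_unique_mem.2
    ⟨hv, fun u hu => Finset.card_le_one.1 hV u hu v hv⟩
  have hflow : P.flow (fun _ => 1) v = 0 := by
    refine Finset.sum_eq_zero fun e he => ?_
    have := h.ends e he
    rw [hV', Finset.mem_singleton, Finset.mem_singleton] at this
    rw [this.1, this.2, arc_self, mul_zero]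
  have h1 := h.total
  have h2 := h.top
  have h3 := h.abs_le v hv
  rw [hV'] at h1 h2
  simp only [Finset.sum_singleton] at h1 h2
  rw [hflow, add_zero]
  refine ⟨h1, modDist.abs_le_of_le hk ?_⟩
  rw [modDist.congr h1]
  omega

/-- The conditions to which every problem can be reduced: each vertex barely satisfies the degree
condition and has nonzero prescribed net outflow. -/
structure Reduced (k : ℕ) (P : OrientationProblem ι κ) : Prop where
  loopless : ∀ e ∈ P.E, P.p e ≠ P.q e
  two_le : 2 ≤ P.V.card
  strict : P.Strict k
  cutCond : ∀ A ⊆ P.V, A.Nonempty → A ≠ P.V → P.CutCond k A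
  deg_le : ∀ v ∈ P.V, P.deg {v} ≤ 2 * k - 2 + modDist k (P.b v)
  pos : ∀ v ∈ P.V, 0 < modDist k (P.b v)
  lt_top : 2 * k - 4 + modDist k (∑ v ∈ P.V, P.b v) < ∑ v ∈ P.V, P.n v

lemma neg_reduced (hk : 0 < k) (h : P.Reduced k) : P.neg.Reduced k := by
  constructor
  · exact h.loopless
  · exact h.two_le
  · intro A h1 h2 h3
    simp only [neg, Finset.sum_neg_distrib, modDist.neg hk]
    exact h.strict A h1 h2 h3
  · exact fun A h1 h2 h3 => neg_cutCond hk (h.cutCond A h1 h2 h3)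
  · intro v hv
    simp only [neg, modDist.neg hk]
    exact h.deg_le v hv
  · intro v hv
    simp only [neg, modDist.neg hk]
    exact h.pos v hv
  · simpa only [neg, Finset.sum_neg_distrib, modDist.neg hk] using h.lt_top

lemma Reduced.singleton_ne (hr : P.Reduced k) (v : ι) : ({v} : Finset ι) ≠ P.V := by
  intro h
  have := hr.two_le
  rw [← h, Finset.card_singleton] at this
  omega

/-- Directing and deleting an edge that decreases the prescribed net outflow at both ends. -/
lemma solvable_of_opposite (hk : 0 < k) (h : P.Valid k v₀) (hr : P.Reduced k) {e : κ} {x y : ι}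
    (he : e ∈ P.E) (hje : P.Joins e x y) (hx : (2 * k : ℤ) ∣ P.b x - modDist k (P.b x))
    (hy : (2 * k : ℤ) ∣ P.b y + modDist k (P.b y)) (ih : P.SmallerSolvable k) : P.Solvable k := by
  have hxV := hje.left_mem h he
  have hyV := hje.right_mem h he
  have hxy := hje.ne hr.loopless he
  refine eraseEdge_solvable (cx := 0) (cy := 0) (rx := 0) (ry := 0) (ε := 1) hk h he hje
    (by omega) (Or.inr hr.deg_le) (ih _ v₀ (eraseEdge_valid h he hje hxy (by omega)
      (by simpa using h.abs_le x hxV) (by simpa using h.abs_le y hyV) (by omega) (by omega)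
      (by simpa using h.top) ?_) (eraseEdge_card he))
  intro A hA hne hA'
  right
  simp only [ite_self, add_zero, zero_sub, zero_add]
  have h1 := hr.cutCond A hA hne hA'
  unfold CutCond at h1
  have h2 := modDist.add_one_le hk (∑ v ∈ A, P.b v)
  have h3 := modDist.sub_one_le hk (∑ v ∈ A, P.b v)
  by_cases hcard : 2 ≤ A.card
  -- The degree falls by at most one and the distance grows by at most one, so the margin two
  -- suffices.
  · have h4 := hr.strict A hA hcard hA'
    by_cases hxA : x ∈ A <;> by_cases hyA : y ∈ A <;> simp [hxA, hyA, crossing, ← sub_eq_add_neg] <;>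
      omega
  · have h4 : A.card = 1 := by have := hne.card_pos; omega
    obtain ⟨v, rfl⟩ := Finset.card_eq_one.1 h4
    rw [Finset.sum_singleton] at *
    by_cases hvx : v = x
    · subst hvx
      -- At a tight end of the edge the distance has to fall along with the degree; this dictates
      -- the direction of the edge.
      have h5 := modDist.sub_one_eq hk hx (hr.pos v hxV)
      simp [crossing, hxy.symm, ← sub_eq_add_neg]
      omega
    · by_cases hvy : v = y
      · subst hvy
        have h5 := modDist.add_one_eq hk hy (hr.pos v hyV)
        simp [crossing, hxy]
        omega
      · simp [crossing, Ne.symm hvx, Ne.symm hvy]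
        exact h1

/-- Deleting an edge of fixed direction that decreases the prescribed net outflow. -/
lemma solvable_of_drop (hk : 0 < k) (h : P.Valid k v₀) (hr : P.Reduced k) {x : ι} {ε : ℤ}
    (hε : ε = 1 ∨ ε = -1) (hx : x ∈ P.V) (hb : modDist k (P.b x - ε) = modDist k (P.b x) - 1)
    (hrn : P.r x ≠ -ε * P.n x)
    (ih : ∀ P' : OrientationProblem ι κ, P'.Valid k v₀ → P'.V.card + P'.E.card = P.V.card + P.E.card →
      ∑ v ∈ P'.V, P'.n v < ∑ v ∈ P.V, P.n v → P'.Solvable k) : P.Solvable k := by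
  have h1 := h.abs_le x hx
  have h2 := h.even x hx
  have hsum : ∀ (f : ι → ℤ) (c : ℤ) (A : Finset ι),
      ∑ v ∈ A, (f v - if v = x then c else 0) = ∑ v ∈ A, f v - if x ∈ A then c else 0 := by
    intro f c A
    simp [Finset.sum_sub_distrib, Finset.sum_ite_eq']
  -- A fixed edge of direction `ε` at `x`, which exists by `hrn`, is deleted together with its share
  -- of the prescription. The total of `n` falls by one and the distance of the total prescription
  -- by at most one, so `top` is kept.
  let P' : OrientationProblem ι κ :=
    { P with
      n := fun v => P.n v - if v = x then 1 else 0
      r := fun v => P.r v - if v = x then ε else 0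
      b := fun v => P.b v - if v = x then ε else 0 }
  have hdeg : ∀ A, P'.deg A = P.deg A - if x ∈ A then 1 else 0 := by
    intro A
    simp only [P', deg, cut, hsum]
    ring
  have habs : |ε| = 1 := by rcases hε with rfl | rfl <;> simp
  have hlip : ∀ c, modDist k (c - ε) ≤ modDist k c + 1 := by
    intro c
    have := modDist.add_abs_le hk c (-ε)
    rwa [abs_neg, habs, ← sub_eq_add_neg] at this
  have hlip' : ∀ c, modDist k c ≤ modDist k (c - ε) + 1 := by
    intro c
    have := modDist.le_add_abs hk c (-ε)
    rwa [abs_neg, habs, ← sub_eq_add_neg] at this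
  obtain ⟨σ, hσ, hs⟩ := ih P' (by
    constructor
    · exact h.ends
    · intro v hv
      by_cases hvx : v = x
      · subst hvx
        simp only [P', if_true]
        rw [_root_.abs_le] at h1 ⊢
        rcases hε with rfl | rfl <;> omega
      · simpa [P', hvx] using h.abs_le v hv
    · intro v hv
      have := h.even v hv
      simp only [P']
      split_ifs <;> omega
    · intro A hA
      have := h.parity A hA
      rw [hdeg]
      simp only [P', hsum]
      split_ifs <;> omega
    · have := h.total
      simp only [P', hsum, hx, if_true]
      rwa [sub_sub_sub_cancel_right]
    · have := h.top
      have := hlip' (∑ v ∈ P.V, P.b v)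
      simp only [P', hsum, hx, if_true]
      omega
    · intro A hA hne hA'
      right
      unfold CutCond
      rw [hdeg]
      simp only [P', hsum]
      have h3 := hr.cutCond A hA hne hA'
      unfold CutCond at h3
      split_ifs with hxA
      · by_cases hcard : 2 ≤ A.card
        · have h4 := hr.strict A hA hcard hA'
          have := hlip (∑ v ∈ A, P.b v)
          omega
        · have h4 : A.card = 1 := by have := hne.card_pos; omega
          obtain ⟨v, rfl⟩ := Finset.card_eq_one.1 h4
          rw [Finset.mem_singleton] at hxA
          subst hxA
          rw [Finset.sum_singleton] at *
          omega
      · simpa using h3) rfl (by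
    simp only [P', hsum, hx, if_true]
    omega)
  refine ⟨σ, hσ, fun v hv => ?_⟩
  have h3 := (hs v hv).1
  have h4 : (2 * k : ℤ) ∣ P.r v + P.flow σ v - P.b v := by
    rwa [show P.r v + P.flow σ v - P.b v = P'.r v + P'.flow σ v - P'.b v by
      simp only [P', flow]; ring]
  exact ⟨h4, h.bound_of_deg_le hk hσ hv (hr.deg_le v hv) h4⟩

/-- The case that all prescribed net outflows are positive. -/
lemma solvable_of_positive (hk : 2 ≤ k) (h : P.Valid k v₀) (hr : P.Reduced k)
    (hpos : ∀ v ∈ P.V, (2 * k : ℤ) ∣ P.b v - modDist k (P.b v))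
    (hrn : ∀ v ∈ P.V, P.r v = -P.n v)
    (hopp : ∀ e ∈ P.E, ∀ x y, P.Joins e x y → ¬ (2 * k : ℤ) ∣ P.b x + modDist k (P.b x))
    (ih : P.SmallerSolvable k) : P.Solvable k := by
  have hk0 : 0 < k := by omega
  obtain ⟨v, hv⟩ : P.V.Nonempty := Finset.card_pos.1 (by have := hr.two_le; omega)
  have hve : v ∉ P.V.erase v := by simp
  obtain ⟨e, he, x, -, y, -, hje⟩ := h.exists_edge_between hk (A := {v}) (B := P.V.erase v)
    (by rw [← Finset.insert_eq, Finset.insert_erase hv]) (by simp)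
    (hr.cutCond _ (by simpa using hv) (by simp) (hr.singleton_ne v))
    (hr.cutCond _ (Finset.erase_subset _ _)
      (by rw [← Finset.card_pos, Finset.card_erase_of_mem hv]; have := hr.two_le; omega)
      (fun h1 => by rw [h1] at hve; exact hve hv))
  have hxV := hje.left_mem h he
  have hyV := hje.right_mem h he
  have hxy := hje.ne hr.loopless he
  have hx1 := hopp e he x y hje
  have hx2 := hpos x hxV
  -- At distance `k` the class of `P.b x` is its own negative, so `x` would count as negative too,
  -- against `hopp`.
  have hxk : modDist k (P.b x) < k := by
    refine lt_of_le_of_ne (modDist.le hk0 _) fun h1 => hx1 ?_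
    rw [h1] at hx2 ⊢
    have := dvd_add hx2 (dvd_refl (2 * k : ℤ))
    rwa [show P.b x - k + 2 * k = P.b x + k by ring] at this
  have hsr : ∑ v ∈ P.V, P.r v = -∑ v ∈ P.V, P.n v := by
    rw [← Finset.sum_neg_distrib]
    exact Finset.sum_congr rfl hrn
  -- By `top`, `lt_top` and parity, the total `D` equals `2k - 2 + modDist k D`, and `2k - 1` is the
  -- only solution: the distance is `D` up to `k` and `|D - 2k|` beyond.
  have hD : ∑ v ∈ P.V, P.n v = 2 * k - 1 := by
    have h1 := h.top
    have h2 := hr.lt_top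
    have h3 := h.modDist_r
    rw [hsr, modDist.neg hk0] at h3
    rw [h3] at h1 h2
    generalize ∑ v ∈ P.V, P.n v = D at *
    have h4 := modDist.even_sub k D
    have h5 := modDist.le hk0 D
    have h6 := modDist.nonneg k D
    by_cases h7 : D ≤ k
    · have h8 := modDist.eq_abs (k := k) (x := D) (by rw [abs_of_nonneg] <;> omega)
      rw [abs_of_nonneg (by omega)] at h8
      omega
    · have h8 := modDist.eq_of_dvd_sub (k := k) (x := D) (y := D - 2 * k)
        (by rw [sub_sub_cancel]) (by rw [_root_.abs_le]; omega)
      rcases abs_cases (D - 2 * k) with h9 | h9 <;> omega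
  -- No step towards zero is left. The edge is directed into `x`, and `j` new fixed edges out of `x`
  -- carry the prescription across `k` to `k + 1`, which is congruent to `-(k - 1)`. The degree of
  -- `x` becomes `3k - 3` at most, just what distance `k - 1` requires. The total prescription moves
  -- from the class of `1` to that of `1 + j`, which pays for the `j` new edges in `top`.
  obtain ⟨j, hj⟩ : ∃ j : ℤ, j = k - modDist k (P.b x) := ⟨_, rfl⟩
  have hxp := hr.pos x hxV
  refine eraseEdge_solvable (cx := j) (cy := 0) (rx := j) (ry := 0) (ε := -1) hk0 h he hje
    (by omega) (Or.inr hr.deg_le) (ih _ v₀ (eraseEdge_valid h he hje hxy (by omega)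
      ?_ (by simpa using h.abs_le y hyV) (by omega) (by omega) ?_ ?_) (eraseEdge_card he))
  · have h1 := h.n_nonneg hxV
    rw [hrn x hxV, _root_.abs_le]
    omega
  · rw [add_zero, modDist.eq_of_dvd_sub (y := 1 + j), abs_of_nonneg (by omega)]
    · omega
    · have h1 := h.total
      rw [hsr, hD] at h1
      rw [← dvd_neg]
      convert dvd_add h1 (dvd_refl (2 * k : ℤ)) using 1
      ring
    · rw [abs_of_nonneg] <;> omega
  · intro A hA hne hA'
    right
    have h1 := hr.cutCond A hA hne hA'
    unfold CutCond at h1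
    by_cases hcard : 2 ≤ A.card
    · have h2 := hr.strict A hA hcard hA'
      -- If `A` contains `x` but not `y`, the distance grows by up to `j + 1` while the degree grows
      -- by `j - 1`; this uses up the whole margin.
      have h3 := modDist.add_abs_le hk0 (∑ v ∈ A, P.b v) (j + 1)
      have h4 := modDist.add_abs_le hk0 (∑ v ∈ A, P.b v) j
      have h5 := modDist.sub_one_le hk0 (∑ v ∈ A, P.b v)
      rw [abs_of_nonneg (by omega)] at h3 h4
      by_cases hxA : x ∈ A <;> by_cases hyA : y ∈ A <;>
        simp [hxA, hyA, crossing, ← sub_eq_add_neg] <;> omega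
    · have h4 : A.card = 1 := by have := hne.card_pos; omega
      obtain ⟨v, rfl⟩ := Finset.card_eq_one.1 h4
      rw [Finset.sum_singleton] at *
      by_cases hvx : v = x
      · subst hvx
        have h5 : modDist k (P.b v + (j + 1)) = k - 1 := by
          rw [modDist.eq_of_dvd_sub (y := -(k - 1)), abs_neg, abs_of_nonneg (by omega)]
          · rw [show P.b v + (j + 1) - -((k : ℤ) - 1) = P.b v - modDist k (P.b v) + 2 * k by
              rw [hj]; ring]
            exact dvd_add hx2 (dvd_refl (2 * k : ℤ))
          · rw [abs_neg, abs_of_nonneg] <;> omega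
        simp [crossing, hxy.symm]
        omega
      · by_cases hvy : v = y
        · subst hvy
          have h5 := modDist.sub_one_eq hk0 (hpos v hyV) (hr.pos v hyV)
          simp [crossing, hxy, ← sub_eq_add_neg]
          omega
        · simp [crossing, Ne.symm hvx, Ne.symm hvy]
          exact h1

/-- A vertex is positive or negative according to the sign with which `modDist` represents its
prescription. An edge from a positive to a negative vertex, or a fixed edge directed along the sign
of its vertex, can be deleted. If there are none, `exists_edge_between` forces all vertices to have
one sign, and negation covers the negative case. -/
lemma solvable_of_reduced (hk : 2 ≤ k) (h : P.Valid k v₀) (hr : P.Reduced k)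
    (ih : P.SmallerSolvable k)
    (ih' : ∀ P' : OrientationProblem ι κ, P'.Valid k v₀ →
      P'.V.card + P'.E.card = P.V.card + P.E.card →
      ∑ v ∈ P'.V, P'.n v < ∑ v ∈ P.V, P.n v → P'.Solvable k) : P.Solvable k := by
  have hk0 : 0 < k := by omega
  by_cases hopp : ∃ e ∈ P.E, ∃ x y, P.Joins e x y ∧ (2 * k : ℤ) ∣ P.b x - modDist k (P.b x) ∧
      (2 * k : ℤ) ∣ P.b y + modDist k (P.b y)
  · obtain ⟨e, he, x, y, hje, hx, hy⟩ := hopp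
    exact solvable_of_opposite hk0 h hr he hje hx hy ih
  by_cases hdrop : ∃ v ∈ P.V, (2 * k : ℤ) ∣ P.b v - modDist k (P.b v) ∧ P.r v ≠ -P.n v
  · obtain ⟨v, hv, h1, h2⟩ := hdrop
    exact solvable_of_drop hk0 h hr (Or.inl rfl) hv (modDist.sub_one_eq hk0 h1 (hr.pos v hv))
      (by simpa using h2) ih'
  by_cases hdrop' : ∃ v ∈ P.V, (2 * k : ℤ) ∣ P.b v + modDist k (P.b v) ∧ P.r v ≠ P.n v
  · obtain ⟨v, hv, h1, h2⟩ := hdrop'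
    exact solvable_of_drop hk0 h hr (Or.inr rfl) hv
      (by rw [sub_neg_eq_add]; exact modDist.add_one_eq hk0 h1 (hr.pos v hv))
      (by simpa using h2) ih'
  push Not at hopp hdrop hdrop'
  have hor := fun v => modDist.dvd_sub_or_dvd_add k (P.b v)
  set A : Finset ι := {v ∈ P.V | (2 * k : ℤ) ∣ P.b v - modDist k (P.b v)} with hA
  by_cases hAV : A = P.V
  · have hpos : ∀ v ∈ P.V, (2 * k : ℤ) ∣ P.b v - modDist k (P.b v) := fun v hv => by
      rw [← hAV] at hv
      exact (Finset.mem_filter.1 hv).2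
    exact solvable_of_positive hk h hr hpos (fun v hv => hdrop v hv (hpos v hv))
      (fun e he x y hje => hopp e he y x hje.symm (hpos y (hje.right_mem h he))) ih
  by_cases hAe : A = ∅
  · have hneg : ∀ v ∈ P.V, (2 * k : ℤ) ∣ P.b v + modDist k (P.b v) := fun v hv => by
      refine (hor v).resolve_left fun h1 => ?_
      have : v ∈ A := Finset.mem_filter.2 ⟨hv, h1⟩
      simp [hAe] at this
    refine neg_solvable (solvable_of_positive hk (neg_valid hk0 h) (neg_reduced hk0 hr) ?_ ?_ ?_ ih)
    · intro v hv
      have := (dvd_neg).2 (hneg v hv)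
      simp only [neg, modDist.neg hk0]
      rwa [neg_add'] at this
    · intro v hv
      simpa [neg] using hdrop' v hv (hneg v hv)
    · intro e he x y hje hx
      simp only [neg, modDist.neg hk0] at hx
      refine hopp e he x y hje ?_ (hneg y (Joins.right_mem h hje he))
      rwa [← dvd_neg, neg_sub, sub_eq_neg_add]
  · exfalso
    have hAs : A ⊆ P.V := Finset.filter_subset _ _
    have hBs : P.V \ A ⊆ P.V := Finset.sdiff_subset
    obtain ⟨e, he, x, hx, y, hy, hje⟩ := h.exists_edge_between hk (A := A) (B := P.V \ A)
      (Finset.union_sdiff_of_subset hAs) Finset.disjoint_sdiff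
      (hr.cutCond _ hAs (Finset.nonempty_iff_ne_empty.2 hAe) hAV)
      (hr.cutCond _ hBs (Finset.sdiff_nonempty.2 fun h1 => hAV (hAs.antisymm h1)) (by
        intro h1
        obtain ⟨a, ha⟩ := Finset.nonempty_iff_ne_empty.2 hAe
        have := hAs ha
        rw [← h1] at this
        exact (Finset.mem_sdiff.1 this).2 ha))
    rw [Finset.mem_sdiff] at hy
    refine hopp e he x y hje (Finset.mem_filter.1 hx).2 ((hor y).resolve_left fun h1 => ?_)
    exact hy.2 (Finset.mem_filter.2 ⟨hy.1, h1⟩)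

/-- Every orientation problem satisfying the degree conditions has a solution. -/
theorem Valid.solvable (hk : 2 ≤ k) (h : P.Valid k v₀) : P.Solvable k := by
  have hk0 : 0 < k := by omega
  induction hN : P.V.card + P.E.card using Nat.strong_induction_on generalizing P v₀ with
  | _ N ihN =>
  -- The inner induction serves `solvable_of_drop` alone, which deletes an edge at the further
  -- vertex and keeps `V` and `E`.
  induction hD : (∑ v ∈ P.V, P.n v).toNat using Nat.strong_induction_on generalizing P v₀ with
  | _ D ihD =>
  have ih : P.SmallerSolvable k := fun P' v hP' hlt => ihN _ (hN ▸ hlt) hP' rfl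
  by_cases hV : P.V.card ≤ 1
  · exact solvable_of_card_le_one hk0 h hV
  by_cases hl : ∃ e ∈ P.E, P.p e = P.q e
  · obtain ⟨e, he, hl⟩ := hl
    exact solvable_of_loop h he hl ih
  push Not at hl
  have hsingle : ∀ v, ({v} : Finset ι) ≠ P.V := fun v hv => hV (by rw [← hv]; simp)
  -- If the further vertex has room for two more edges, an edge can be passed through it. Without
  -- any edge, the degree conditions of complementary sets contradict the small total of `n`.
  have htop : ¬(2 * k - 4 + modDist k (∑ v ∈ P.V, P.b v) < ∑ v ∈ P.V, P.n v) →
      P.Solvable k := by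
    intro htop
    by_cases hE : P.E.Nonempty
    · obtain ⟨e, he⟩ := hE
      exact solvable_of_subdivide hk0 h hl he (by omega) ih
    · rw [Finset.not_nonempty_iff_eq_empty] at hE
      exfalso
      obtain ⟨v, hv⟩ : P.V.Nonempty := Finset.card_pos.1 (by omega)
      have key : ∀ x ∈ P.V, P.CutCond k (P.V.erase x) ∨ P.V.erase x = {v₀} ∧
          (2 * k : ℤ) ∣ P.b v₀ := by
        intro x hx
        have hxe : x ∉ P.V.erase x := by simp
        exact (h.cutCond _ (Finset.erase_subset _ _)
          (by rw [← Finset.card_pos, Finset.card_erase_of_mem hx]; omega)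
          (fun h1 => by rw [h1] at hxe; exact hxe hx)).symm
      by_cases h0 : v₀ ∈ P.V ∧ (2 * k : ℤ) ∣ P.b v₀
      · have h1 : P.CutCond k (P.V.erase v₀) := by
          refine (key v₀ h0.1).resolve_right fun h1 => ?_
          have : v₀ ∈ P.V.erase v₀ := by rw [h1.1]; simp
          simp at this
        have hsb := Finset.sum_erase_add P.V P.b h0.1
        have hsn := Finset.sum_erase_add P.V P.n h0.1
        have h2 := h.n_nonneg h0.1
        unfold CutCond deg cut at h1
        rw [hE, Finset.sum_empty, modDist.congr (y := ∑ v ∈ P.V, P.b v) (by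
          rw [← hsb, sub_add_cancel_left]; exact (dvd_neg).2 h0.2)] at h1
        omega
      · have h1 : P.CutCond k (P.V.erase v) := by
          refine (key v hv).resolve_right fun h1 => h0 ⟨?_, h1.2⟩
          have : v₀ ∈ P.V.erase v := by rw [h1.1]; simp
          exact Finset.mem_of_mem_erase this
        have h2 : P.CutCond k {v} := by
          refine (h.cutCond {v} (by simpa using hv) (by simp) (hsingle v)).resolve_left fun h2 => ?_
          rw [Finset.singleton_inj] at h2
          exact h0 ⟨h2.1 ▸ hv, h2.2⟩
        obtain ⟨e, he, -⟩ := h.exists_edge_between hk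
          (by rw [← Finset.insert_eq, Finset.insert_erase hv]) (by simp) h2 h1
        simp [hE] at he
  by_cases htop' : 2 * k - 4 + modDist k (∑ v ∈ P.V, P.b v) < ∑ v ∈ P.V, P.n v
  swap
  · exact htop htop'
  by_cases hst : P.Strict k
  swap
  · unfold Strict at hst
    push Not at hst
    obtain ⟨A, hA, hA2, hAV, hlt⟩ := hst
    refine solvable_of_tight h hA hAV hA2 ?_ ih
    by_contra! hcon
    have := h.add_two_le hA hcon
    omega
  by_cases hcc : ∀ v ∈ P.V, P.CutCond k {v}
  swap
  · push Not at hcc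
    obtain ⟨v, hv, hcc⟩ := hcc
    obtain ⟨h1, h2⟩ := (h.cutCond {v} (by simpa using hv) (by simp) (hsingle v)).resolve_right hcc
    rw [Finset.singleton_inj] at h1
    subst h1
    exact solvable_of_slack hk h hst hl (by omega) hv (Or.inl h2) htop' ih
  have hfull : ∀ A ⊆ P.V, A.Nonempty → A ≠ P.V → P.CutCond k A := by
    intro A hA hne hAV
    refine (h.cutCond A hA hne hAV).elim ?_ id
    rintro ⟨rfl, -⟩
    exact hcc v₀ (by simpa using hA)
  by_cases hsl : ∃ x ∈ P.V, (2 * k : ℤ) ∣ P.b x ∨ 2 * k + modDist k (P.b x) ≤ P.deg {x}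
  · obtain ⟨x, hx, hsl⟩ := hsl
    -- No vertex needs the exemption any more, so it can be handed to `x`.
    exact solvable_of_slack hk { h with cutCond := fun A h1 h2 h3 => Or.inr (hfull A h1 h2 h3) }
      hst hl (by omega) hx hsl htop' ih
  push Not at hsl
  refine solvable_of_reduced hk h ⟨hl, by omega, hst, hfull, ?_, ?_, htop'⟩ ih ?_
  · intro v hv
    by_contra! hcon
    have := h.add_two_le (A := {v}) (by simpa using hv) (by simpa using hcon)
    rw [Finset.sum_singleton] at this
    exact absurd this (not_le.2 (hsl v hv).2)
  · intro v hv
    refine lt_of_le_of_ne (modDist.nonneg _ _) fun h0 => (hsl v hv).1 ?_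
    exact (modDist.eq_zero_iff k _).1 h0.symm
  · intro P' hP' hN' hlt
    refine ihD (∑ v ∈ P'.V, P'.n v).toNat ?_ hP' (hN'.trans hN) rfl
    have := hP'.sum_n_nonneg subset_rfl
    omega

end OrientationProblem

/-! ### Merging odd edges along a spanning tree -/

/-- A bidirected multigraph: `E` is the edge set, `p e` and `q e` are the ends of `e`. An edge with
`c e = 1` points away from both ends or towards both ends, an edge with `c e = -1` points away from
one end and towards the other one. -/
structure Bidirected (ι κ : Type*) where
  E : Finset κ
  p : κ → ι
  q : κ → ι
  c : κ → ℤ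

/-- The edges in `T` build up the vertex set `W` from `{w}`, one vertex at a time. Here `J e x y`
says that `e` joins `x` and `y`. -/
inductive Spans {ι κ : Type*} [DecidableEq ι] [DecidableEq κ] (J : κ → ι → ι → Prop) (w : ι) :
    Finset κ → Finset ι → Prop
  | single : Spans J w ∅ {w}
  | step (f : κ) (u v : ι) (T : Finset κ) (W : Finset ι) : Spans J w T W → u ∈ W → v ∉ W →
      f ∉ T → J f u v → Spans J w (insert f T) (insert v W)

namespace Bidirected

variable {ι κ : Type*} [DecidableEq ι] [DecidableEq κ] {B B₁ B₂ : Bidirected ι κ}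

/-- The net outflow at `v` if each edge `e` is directed according to the sign `σ e`. -/
def net (B : Bidirected ι κ) (σ : κ → ℤ) (v : ι) : ℤ :=
  ∑ e ∈ B.E, σ e * ((if B.p e = v then 1 else 0) + B.c e * (if B.q e = v then 1 else 0))

/-- All net outflows that can be achieved in `B₁` can be achieved in `B`. -/
def Refines (B₁ B : Bidirected ι κ) : Prop :=
  ∀ σ : κ → ℤ, (∀ e, σ e = 1 ∨ σ e = -1) →
    ∃ τ : κ → ℤ, (∀ e, τ e = 1 ∨ τ e = -1) ∧ ∀ v, B.net τ v = B₁.net σ v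

lemma Refines.refl (B : Bidirected ι κ) : B.Refines B := fun σ hσ => ⟨σ, hσ, fun _ => rfl⟩

lemma Refines.trans (h : B₂.Refines B₁) (h' : B₁.Refines B) : B₂.Refines B := by
  intro σ hσ
  obtain ⟨τ, hτ, h1⟩ := h σ hσ
  obtain ⟨ρ, hρ, h2⟩ := h' τ hτ
  exact ⟨ρ, hρ, fun v => (h2 v).trans (h1 v)⟩

/-- The edges that point away from both ends or towards both ends. -/
def oddEdges (B : Bidirected ι κ) : Finset κ := {e ∈ B.E | B.c e = 1}

/-- `x` and `y` are the ends of `e`. -/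
def Joins (B : Bidirected ι κ) (e : κ) (x y : ι) : Prop :=
  B.p e = x ∧ B.q e = y ∨ B.p e = y ∧ B.q e = x

lemma mem_oddEdges {e : κ} : e ∈ B.oddEdges ↔ e ∈ B.E ∧ B.c e = 1 := Finset.mem_filter

/-- Merging the edges `e` and `f` at a common end, with the other ends `a` and `b`. -/
def lift (B : Bidirected ι κ) (e f : κ) (a b : ι) : Bidirected ι κ where
  E := B.E.erase f
  p := Function.update B.p e a
  q := Function.update B.q e b
  c := Function.update B.c e (-B.c f)

section lift

variable {e f : κ} {a b x : ι}

/-- The sign of `f` is chosen so that `e` and `f` cancel at `x`; what is left is the end `a` of `e`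
and the end `b` of `f`. Passing through `x` costs a change of sign, hence the type `-B.c f`. -/
lemma lift_refines (he : e ∈ B.E) (hf : f ∈ B.E) (hef : e ≠ f) (hc : B.c e = 1)
    (hcf : B.c f = 1 ∨ B.c f = -1) (hje : B.Joins e a x) (hjf : B.Joins f x b) :
    (B.lift e f a b).Refines B := by
  intro σ hσ
  obtain ⟨η, hη, hη'⟩ : ∃ η : ℤ, (η = 1 ∨ η = -1) ∧ ∀ v,
      η * ((if B.p f = v then 1 else 0) + B.c f * (if B.q f = v then 1 else 0)) =
        -(if x = v then 1 else 0) - B.c f * (if b = v then 1 else 0) := by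
    rcases hjf with ⟨h1, h2⟩ | ⟨h1, h2⟩
    · exact ⟨-1, Or.inr rfl, fun v => by rw [h1, h2]; ring⟩
    · refine ⟨-B.c f, by omega, fun v => ?_⟩
      rw [h1, h2]
      rcases hcf with h | h <;> rw [h] <;> ring
  refine ⟨Function.update σ f (η * σ e), fun d => ?_, fun v => ?_⟩
  · by_cases hd : d = f
    · subst hd
      rw [Function.update_self]
      rcases hη with h | h <;> rcases hσ e with h' | h' <;> simp [h, h']
    · rw [Function.update_of_ne hd]
      exact hσ d
  · have he' : e ∈ B.E.erase f := Finset.mem_erase.2 ⟨hef, he⟩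
    have hp : (B.lift e f a b).p e = a := by simp [lift]
    have hq : (B.lift e f a b).q e = b := by simp [lift]
    have hc' : (B.lift e f a b).c e = -B.c f := by simp [lift]
    have h1 : ∑ d ∈ (B.E.erase f).erase e, Function.update σ f (η * σ e) d *
        ((if B.p d = v then 1 else 0) + B.c d * (if B.q d = v then 1 else 0)) =
        ∑ d ∈ (B.E.erase f).erase e, σ d *
        ((if (B.lift e f a b).p d = v then 1 else 0) +
          (B.lift e f a b).c d * (if (B.lift e f a b).q d = v then 1 else 0)) := by
      refine Finset.sum_congr rfl fun d hd => ?_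
      have h2 := Finset.ne_of_mem_erase hd
      have h3 := Finset.ne_of_mem_erase (Finset.mem_of_mem_erase hd)
      simp [h2, h3, lift]
    unfold net
    rw [← Finset.add_sum_erase _ _ hf, ← Finset.add_sum_erase _ _ he',
      ← Finset.add_sum_erase (B.lift e f a b).E _ he', h1]
    simp only [Function.update_self, Function.update_of_ne hef, hp, hq, hc']
    have h2 : (if B.p e = v then 1 else 0) + B.c e * (if B.q e = v then 1 else 0) =
        (if a = v then 1 else 0) + (if x = v then (1 : ℤ) else 0) := by
      rcases hje with ⟨h3, h4⟩ | ⟨h3, h4⟩ <;> rw [h3, h4, hc] <;> ring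
    rw [h2, mul_comm η, mul_assoc, hη' v]
    simp only [lift]
    ring

lemma lift_oddEdges_of_odd (he : e ∈ B.E) (hf : f ∈ B.E) (hef : e ≠ f) (hc : B.c e = 1)
    (hcf : B.c f = 1) : (B.lift e f a b).oddEdges.card + 2 = B.oddEdges.card := by
  have h1 : (B.lift e f a b).oddEdges = (B.oddEdges.erase f).erase e := by
    ext d
    simp only [mem_oddEdges, lift, Finset.mem_erase]
    by_cases hd : d = e
    · subst hd; simp [hcf]
    · simp [hd]; tauto
  rw [h1, Finset.card_erase_of_mem, Finset.card_erase_of_mem]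
  · have : ({e, f} : Finset κ) ⊆ B.oddEdges := by
      intro d hd
      rw [Finset.mem_insert, Finset.mem_singleton] at hd
      rcases hd with rfl | rfl <;> simp [mem_oddEdges, *]
    have := Finset.card_le_card this
    rw [Finset.card_pair hef] at this
    omega
  · simp [mem_oddEdges, *]
  · simp [mem_oddEdges, *]

lemma lift_oddEdges_of_even (he : e ∈ B.E) (hef : e ≠ f) (hc : B.c e = 1)
    (hcf : B.c f = -1) : (B.lift e f a b).oddEdges = B.oddEdges := by
  ext d
  simp only [mem_oddEdges, lift, Finset.mem_erase]
  by_cases hd : d = e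
  · subst hd; simp [hcf, hef, he, hc]
  · simp [hd]
    intro _ h1 h2
    subst h2
    omega

lemma lift_joins_self : (B.lift e f a b).Joins e a b := by simp [Joins, lift]

lemma lift_joins_iff {d : κ} (hd : d ≠ e) {x y : ι} :
    (B.lift e f a b).Joins d x y ↔ B.Joins d x y := by
  simp [Joins, lift, hd]

end lift

/-- The properties of a bidirected multigraph `B₁` obtained from `B` by merging edges, so that just
`m` odd edges are left, one of which is incident with `w` if possible. -/
structure Reduction (V : Finset ι) (w : ι) (m : ℕ) (T : Finset κ) (B₁ B : Bidirected ι κ) :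
    Prop where
  refines : B₁.Refines B
  sign : ∀ e ∈ B₁.E, B₁.c e = 1 ∨ B₁.c e = -1
  ends : ∀ e ∈ B₁.E, B₁.p e ∈ V ∧ B₁.q e ∈ V
  card : B₁.oddEdges.card = m
  incident : 0 < m → ∃ e ∈ B₁.oddEdges, ∃ u, B₁.Joins e u w
  keep : ∀ e ∈ B.E, e ∉ T → B.c e = -1 →
    e ∈ B₁.E ∧ B₁.p e = B.p e ∧ B₁.q e = B.q e ∧ B₁.c e = -1

/-- The standing hypotheses on a bidirected multigraph with a spanning tree. -/
structure Admissible (V : Finset ι) (J : κ → ι → ι → Prop) (T : Finset κ) (B : Bidirected ι κ) :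
    Prop where
  sub : T ⊆ B.E
  joins : ∀ e ∈ T, ∀ x y, J e x y → B.Joins e x y
  sign : ∀ e ∈ B.E, B.c e = 1 ∨ B.c e = -1
  ends : ∀ e ∈ B.E, B.p e ∈ V ∧ B.q e ∈ V

variable {V : Finset ι} {J : κ → ι → ι → Prop} {w : ι} {T : Finset κ} {W : Finset ι}

lemma Admissible.left_mem (h : B.Admissible V J T) {e : κ} {x y : ι} (he : e ∈ B.E)
    (hj : B.Joins e x y) : x ∈ V := by
  have := h.ends e he
  rcases hj with ⟨rfl, rfl⟩ | ⟨rfl, rfl⟩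
  · exact this.1
  · exact this.2

lemma Joins.symm {e : κ} {x y : ι} (h : B.Joins e x y) : B.Joins e y x := Or.symm h

lemma Admissible.lift (h : B.Admissible V J T) {T' : Finset κ} (hT' : T' ⊆ T) {e f : κ} {a b x : ι}
    (he : e ∈ B.E) (hf : f ∈ B.E) (heT : e ∉ T) (hfT : f ∉ T')
    (hje : B.Joins e a x) (hjf : B.Joins f x b) : (B.lift e f a b).Admissible V J T' := by
  constructor
  · intro d hd
    refine Finset.mem_erase.2 ⟨?_, h.sub (hT' hd)⟩
    rintro rfl
    exact hfT hd
  · intro d hd x y hj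
    rw [lift_joins_iff]
    · exact h.joins d (hT' hd) x y hj
    · rintro rfl; exact heT (hT' hd)
  · intro d hd
    have h1 := h.sign d (Finset.mem_of_mem_erase hd)
    have h2 := h.sign f hf
    simp only [Bidirected.lift]
    by_cases hde : d = e
    · subst hde; rw [Function.update_self]; omega
    · rwa [Function.update_of_ne hde]
  · intro d hd
    have h1 := h.ends d (Finset.mem_of_mem_erase hd)
    simp only [Bidirected.lift]
    by_cases hde : d = e
    · subst hde
      simp [h.left_mem he hje, h.left_mem hf hjf.symm]
    · simpa [hde] using h1

/-- An even edge is used up only if it belongs to the tree. The even edges outside `T`, which have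
to supply the cuts later, stay untouched. -/
lemma Reduction.of_lift {m : ℕ} {T' : Finset κ} (hT' : T' ⊆ T) (h : B.Admissible V J T) {e f : κ}
    {a b x : ι} (he : e ∈ B.E) (hf : f ∈ B.E) (hef : e ≠ f) (hc : B.c e = 1)
    (hfT : B.c f = 1 ∨ f ∈ T) (hje : B.Joins e a x) (hjf : B.Joins f x b)
    (hr : B₁.Reduction V w m T' (B.lift e f a b)) : B₁.Reduction V w m T B where
  refines := hr.refines.trans (lift_refines he hf hef hc (h.sign f hf) hje hjf)
  sign := hr.sign
  ends := hr.ends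
  card := hr.card
  incident := hr.incident
  keep := by
    intro d hd hdT hcd
    have hde : d ≠ e := by rintro rfl; omega
    have hdf : d ≠ f := by
      rintro rfl
      rcases hfT with h1 | h1
      · omega
      · exact hdT h1
    have := hr.keep d (Finset.mem_erase.2 ⟨hdf, hd⟩) (fun h1 => hdT (hT' h1))
      (by simpa [lift, hde] using hcd)
    simpa [lift, hde] using this

lemma Reduction.mono {m : ℕ} {T' : Finset κ} (hT' : T' ⊆ T) (hr : B₁.Reduction V w m T' B) :
    B₁.Reduction V w m T B :=
  { hr with keep := fun e he heT hc => hr.keep e he (fun h => heT (hT' h)) hc }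

lemma Admissible.mono {T' : Finset κ} (hT' : T' ⊆ T) (h : B.Admissible V J T) :
    B.Admissible V J T' :=
  { h with sub := hT'.trans h.sub, joins := fun e he => h.joins e (hT' he) }

/-- An odd edge can be moved to the root of a spanning tree. -/
lemma exists_reduction_of_card_eq (hS : Spans J w T W) {m : ℕ} (h : B.Admissible V J T)
    (hm : B.oddEdges.card = m)
    (hodd : ∃ e ∈ B.oddEdges, e ∈ T ∨ ∃ x ∈ W, ∃ u, B.Joins e u x) :
    ∃ B₁ : Bidirected ι κ, B₁.Reduction V w m T B := by
  induction hS generalizing B with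
  | single =>
    obtain ⟨e, he, hT | ⟨x, hx, u, hj⟩⟩ := hodd
    · simp at hT
    · rw [Finset.mem_singleton] at hx
      subst hx
      exact ⟨B, Refines.refl B, h.sign, h.ends, hm, fun _ => ⟨e, he, u, hj⟩,
        fun e he _ hc => ⟨he, rfl, rfl, hc⟩⟩
  | step f u v T W hS hu hv hf hJ ih =>
    have hfE : f ∈ B.E := h.sub (Finset.mem_insert_self _ _)
    have hjf : B.Joins f v u := (h.joins f (Finset.mem_insert_self _ _) u v hJ).symm
    have hsub : T ⊆ insert f T := Finset.subset_insert _ _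
    have key : (∃ e ∈ B.oddEdges, e ∈ T ∨ ∃ x ∈ W, ∃ u, B.Joins e u x) →
        ∃ B₁ : Bidirected ι κ, B₁.Reduction V w m (insert f T) B := fun h1 => by
      obtain ⟨B₁, hB₁⟩ := ih (h.mono hsub) hm h1
      exact ⟨B₁, hB₁.mono hsub⟩
    by_cases hcf : B.c f = 1
    · exact key ⟨f, mem_oddEdges.2 ⟨hfE, hcf⟩, Or.inr ⟨u, hu, v, hjf⟩⟩
    obtain ⟨e, he, hT⟩ := hodd
    have heo := mem_oddEdges.1 he
    have hef : e ≠ f := by rintro rfl; exact hcf heo.2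
    by_cases heT : e ∈ T
    · exact key ⟨e, he, Or.inl heT⟩
    rcases hT with hT | ⟨x, hx, a, hj⟩
    · exact absurd hT (by simp [hef, heT])
    · rcases Finset.mem_insert.1 hx with rfl | hx
      -- The edge `e` touches the tree only at its last vertex `v`; merging it with the even tree
      -- edge `f` yields an odd edge at `u`, one step closer to the root.
      · have hcf' : B.c f = -1 := (h.sign f hfE).resolve_left hcf
        have heT' : e ∉ insert f T := by simp [hef, heT]
        obtain ⟨B₁, hB₁⟩ := ih (h.lift hsub heo.1 hfE heT' hf hj hjf)
          (by rw [lift_oddEdges_of_even heo.1 hef heo.2 hcf', hm])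
          ⟨e, by rwa [lift_oddEdges_of_even heo.1 hef heo.2 hcf'],
            Or.inr ⟨u, hu, a, lift_joins_self⟩⟩
        exact ⟨B₁, hB₁.of_lift hsub h heo.1 hfE hef heo.2 (Or.inr (Finset.mem_insert_self _ _))
          hj hjf⟩
      · exact key ⟨e, he, Or.inr ⟨x, hx, a, hj⟩⟩

/-- Along a spanning tree, odd edges can be merged in pairs until a given number of them is left. -/
lemma exists_reduction (hS : Spans J w T W) {m : ℕ} (h : B.Admissible V J T)
    (hm : m ≤ B.oddEdges.card) (hpar : 2 ∣ B.oddEdges.card - m)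
    (hW : ∀ e ∈ B.oddEdges, e ∉ T → ∃ x ∈ W, ∃ u, B.Joins e u x) :
    ∃ B₁ : Bidirected ι κ, B₁.Reduction V w m T B := by
  induction hN : B.E.card + T.card using Nat.strong_induction_on generalizing B T W with
  | _ N ih =>
  by_cases hm0 : B.oddEdges.card = m
  · rcases Nat.eq_zero_or_pos m with rfl | hm'
    · exact ⟨B, Refines.refl B, h.sign, h.ends, hm0, fun h => absurd h (lt_irrefl 0),
        fun e he _ hc => ⟨he, rfl, rfl, hc⟩⟩
    · obtain ⟨e, he⟩ : B.oddEdges.Nonempty := Finset.card_pos.1 (by omega)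
      refine exists_reduction_of_card_eq hS h hm0 ⟨e, he, ?_⟩
      by_cases heT : e ∈ T
      · exact Or.inl heT
      · exact Or.inr (hW e he heT)
  have pair : ∀ v, (∃ e ∈ B.oddEdges, ∃ f ∈ B.oddEdges, e ∉ T ∧ f ∉ T ∧ e ≠ f ∧
      (∃ u, B.Joins e u v) ∧ ∃ u, B.Joins f u v) →
      ∃ B₁ : Bidirected ι κ, B₁.Reduction V w m T B := by
    rintro v ⟨e, he, f, hf, heT, hfT, hef, ⟨a, hje⟩, b, hjf⟩
    rw [mem_oddEdges] at he hf
    have hodd := lift_oddEdges_of_odd (a := a) (b := b) he.1 hf.1 hef he.2 hf.2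
    have hcard := Finset.card_erase_lt_of_mem hf.1
    obtain ⟨B₁, hB₁⟩ := ih _ (by rw [← hN]; exact Nat.add_lt_add_right hcard _) hS
      (h.lift subset_rfl he.1 hf.1 heT hfT hje hjf.symm) (by omega) (by omega) (by
        intro d hd hdT
        have hd' := mem_oddEdges.1 hd
        have hde : d ≠ e := by
          rintro rfl
          have := hd'.2
          simp [lift, hf.2] at this
        obtain ⟨x, hx, u, hj⟩ := hW d (mem_oddEdges.2 ⟨Finset.mem_of_mem_erase hd'.1, by
          simpa [lift, hde] using hd'.2⟩) hdT
        exact ⟨x, hx, u, (lift_joins_iff hde).2 hj⟩) rfl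
    exact ⟨B₁, hB₁.of_lift subset_rfl h he.1 hf.1 hef he.2 (Or.inl hf.2) hje hjf.symm⟩
  cases hS with
  | single =>
    -- Only the root is left. All odd edges touch it, and parity leaves at least two of them.
    obtain ⟨e, he, f, hf, hef⟩ := Finset.one_lt_card.1 (by omega : 1 < B.oddEdges.card)
    obtain ⟨x, hx, hje⟩ := hW e he (by simp)
    obtain ⟨y, hy, hjf⟩ := hW f hf (by simp)
    rw [Finset.mem_singleton] at hx hy
    subst hx hy
    exact pair y ⟨e, he, f, hf, by simp, by simp, hef, hje, hjf⟩
  | step f u v T W hS hu hv hf hJ =>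
    by_cases htwo : ∃ e ∈ B.oddEdges, ∃ f' ∈ B.oddEdges, e ∉ insert f T ∧ f' ∉ insert f T ∧
      e ≠ f' ∧ (∃ u, B.Joins e u v) ∧ ∃ u, B.Joins f' u v
    · exact pair v htwo
    have hfE : f ∈ B.E := h.sub (Finset.mem_insert_self _ _)
    have hjf : B.Joins f v u := (h.joins f (Finset.mem_insert_self _ _) u v hJ).symm
    have hsub : T ⊆ insert f T := Finset.subset_insert _ _
    have hTcard : (insert f T).card = T.card + 1 := Finset.card_insert_of_notMem hf
    -- A single odd edge at the leaf `v` is merged with the tree edge `f` and thereby moved to `u`,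
    -- or neutralized if `f` is odd.
    by_cases hone : ∃ e ∈ B.oddEdges, e ∉ insert f T ∧ ∃ u, B.Joins e u v
    · obtain ⟨e, he, heT, a, hje⟩ := hone
      have heo := mem_oddEdges.1 he
      have hef : e ≠ f := by rintro rfl; simp at heT
      have hcard := Finset.card_erase_lt_of_mem hfE
      have hbound : m ≤ (B.lift e f a u).oddEdges.card ∧
          2 ∣ (B.lift e f a u).oddEdges.card - m := by
        rcases h.sign f hfE with hcf | hcf
        · have := lift_oddEdges_of_odd (a := a) (b := u) heo.1 hfE hef heo.2 hcf
          omega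
        · rw [lift_oddEdges_of_even heo.1 hef heo.2 hcf]
          exact ⟨hm, hpar⟩
      obtain ⟨B₁, hB₁⟩ := ih ((B.lift e f a u).E.card + T.card) (by
          simp only [lift]; omega) hS
        (h.lift hsub heo.1 hfE heT hf hje hjf) hbound.1 hbound.2 (by
          intro d hd hdT
          have hd' := mem_oddEdges.1 hd
          by_cases hde : d = e
          · subst hde
            exact ⟨u, hu, a, lift_joins_self⟩
          · have hdf : d ≠ f := Finset.ne_of_mem_erase hd'.1
            have hdo : d ∈ B.oddEdges := mem_oddEdges.2 ⟨Finset.mem_of_mem_erase hd'.1, by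
              simpa [lift, hde] using hd'.2⟩
            have hdT' : d ∉ insert f T := by simp [hdf, hdT]
            obtain ⟨x, hx, b, hj⟩ := hW d hdo hdT'
            rcases Finset.mem_insert.1 hx with rfl | hx
            · exact absurd ⟨e, he, d, hdo, heT, hdT', Ne.symm hde, ⟨a, hje⟩, b, hj⟩ htwo
            · exact ⟨x, hx, b, (lift_joins_iff hde).2 hj⟩) rfl
      exact ⟨B₁, hB₁.of_lift hsub h heo.1 hfE hef heo.2 (Or.inr (Finset.mem_insert_self _ _))
        hje hjf⟩
    -- With no odd edge outside the tree left at `v`, the leaf is cut off; from then on `f` counts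
    -- as an edge outside the tree, and it touches `u`.
    · obtain ⟨B₁, hB₁⟩ := ih (B.E.card + T.card) (by omega) hS (h.mono hsub) hm hpar (by
        intro d hd hdT
        by_cases hdf : d = f
        · subst hdf
          exact ⟨u, hu, v, hjf⟩
        · have hdT' : d ∉ insert f T := by simp [hdf, hdT]
          obtain ⟨x, hx, b, hj⟩ := hW d hd hdT'
          rcases Finset.mem_insert.1 hx with rfl | hx
          · exact absurd ⟨d, hd, hdT', b, hj⟩ hone
          · exact ⟨x, hx, b, hj⟩) rfl
      exact ⟨B₁, hB₁.mono hsub⟩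

end Bidirected

/-! ### Maximum cuts and the signing with prescribed excess `C` -/

section

variable {ι κ : Type*} [DecidableEq ι] [DecidableEq κ]

/-- The number of the two ends `x`, `y` of an edge that are equal to `v`. -/
def endCount (x y v : ι) : ℤ := (if x = v then 1 else 0) + (if y = v then 1 else 0)

lemma sum_endCount (A : Finset ι) (x y : ι) :
    ∑ v ∈ A, endCount x y v = (if x ∈ A then 1 else 0) + (if y ∈ A then 1 else 0) := by
  simp [endCount, Finset.sum_add_distrib, Finset.sum_ite_eq]

lemma endCount_nonneg (x y v : ι) : 0 ≤ endCount x y v := by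
  unfold endCount; split_ifs <;> simp

/-- The excess at `v` of positive over negative edges in a signed multigraph. -/
def excess (E : Finset κ) (p q : κ → ι) (σ : κ → ℤ) (v : ι) : ℤ :=
  ∑ e ∈ E, σ e * endCount (p e) (q e) v

/-- The sign of a vertex with respect to a set. -/
def side (X : Finset ι) (v : ι) : ℤ := if v ∈ X then 1 else -1

lemma side_eq (X : Finset ι) (v : ι) : side X v = 1 ∨ side X v = -1 := by
  unfold side; split_ifs <;> simp

lemma side_mul_self (X : Finset ι) (v : ι) : side X v * side X v = 1 := by
  unfold side; split_ifs <;> simp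

lemma crossing_eq_one_iff (X : Finset ι) (x y : ι) :
    crossing X x y = 1 ↔ side X x * side X y = -1 := by
  unfold crossing side
  by_cases h1 : x ∈ X <;> by_cases h2 : y ∈ X <;> simp [h1, h2]

/-- There is a set such that at least half of the edges leaving any other set also leave it. -/
lemma exists_max_cut (V : Finset ι) (E : Finset κ) (p q : κ → ι) :
    ∃ X ⊆ V, ∀ A ⊆ V, ∑ e ∈ E, crossing A (p e) (q e) ≤
      2 * ∑ e ∈ E with side X (p e) * side X (q e) = -1, crossing A (p e) (q e) := by
  obtain ⟨X, hX, hmax⟩ := Finset.exists_max_image V.powerset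
    (fun X => ∑ e ∈ E, crossing X (p e) (q e)) ⟨∅, by simp⟩
  rw [Finset.mem_powerset] at hX
  refine ⟨X, hX, fun A hA => ?_⟩
  have h1 := hmax (symmDiff X A) (Finset.mem_powerset.2 (by
    intro x hx
    rcases Finset.mem_symmDiff.1 hx with h | h
    · exact hX h.1
    · exact hA h.1))
  -- Switching the vertices of `A` changes the cut of `X` by the size of the cut of `A` minus twice
  -- the overlap; by maximality this is not positive.
  have h2 : ∀ e ∈ E, crossing (symmDiff X A) (p e) (q e) =
      crossing X (p e) (q e) + crossing A (p e) (q e) -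
        2 * (if side X (p e) * side X (q e) = -1 then crossing A (p e) (q e) else 0) := by
    intro e _
    rw [if_congr (crossing_eq_one_iff X (p e) (q e)).symm rfl rfl]
    simp only [crossing, Finset.mem_symmDiff]
    by_cases h1 : p e ∈ X <;> by_cases h2 : q e ∈ X <;> by_cases h3 : p e ∈ A <;>
      by_cases h4 : q e ∈ A <;> simp [h1, h2, h3, h4]
  simp only [Finset.sum_congr rfl h2, Finset.sum_sub_distrib, Finset.sum_add_distrib,
    ← Finset.mul_sum, ← Finset.sum_filter] at h1
  omega

lemma Bidirected.sum_filter_add {B : Bidirected ι κ} (hc : ∀ e ∈ B.E, B.c e = 1 ∨ B.c e = -1)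
    (f : κ → ℤ) :
    ∑ e ∈ B.E, f e = ∑ e ∈ B.E with B.c e = -1, f e + ∑ e ∈ B.oddEdges, f e := by
  rw [← Finset.sum_filter_add_sum_filter_not B.E (fun e => B.c e = -1)]
  congr 1
  refine Finset.sum_congr ?_ fun _ _ => rfl
  ext e
  rw [Finset.mem_filter, mem_oddEdges]
  constructor
  · rintro ⟨h1, h2⟩; exact ⟨h1, (hc e h1).resolve_right h2⟩
  · rintro ⟨h1, h2⟩; exact ⟨h1, by omega⟩

/-- The net outflow splits into the one of the even edges and the one of the odd edges. -/
lemma Bidirected.net_eq {B : Bidirected ι κ} (hc : ∀ e ∈ B.E, B.c e = 1 ∨ B.c e = -1)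
    (σ : κ → ℤ) (v : ι) :
    B.net σ v = ∑ e ∈ B.E with B.c e = -1, σ e * arc (B.p e) (B.q e) v +
      ∑ e ∈ B.oddEdges, σ e * endCount (B.p e) (B.q e) v := by
  rw [net, sum_filter_add hc]
  congr 1
  · refine Finset.sum_congr rfl fun e he => ?_
    rw [(Finset.mem_filter.1 he).2, arc]; ring
  · refine Finset.sum_congr rfl fun e he => ?_
    rw [(mem_oddEdges.1 he).2, endCount]; ring

/-- Signing the edges of a bidirected multigraph with few odd edges, one of which is incident with
`w`, and sufficiently many even edges in each cut: all odd edges get the sign `s`. -/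
lemma Bidirected.exists_signing {k : ℕ} (hk : 2 ≤ k) {V : Finset ι} {B : Bidirected ι κ} {w : ι}
    (hw : w ∈ V) (hc : ∀ e ∈ B.E, B.c e = 1 ∨ B.c e = -1)
    (hends : ∀ e ∈ B.E, B.p e ∈ V ∧ B.q e ∈ V) {s : ℤ}
    (hs : B.oddEdges.card = 0 ∧ s = 0 ∨ 0 < B.oddEdges.card ∧ (s = 1 ∨ s = -1))
    (hcard : B.oddEdges.card ≤ k)
    (hinc : 0 < B.oddEdges.card → ∃ e ∈ B.oddEdges, ∃ u, B.Joins e u w)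
    (hcut : ∀ A ⊆ V, A.Nonempty → A ≠ V →
      3 * k - 2 ≤ ∑ e ∈ B.E with B.c e = -1, crossing A (B.p e) (B.q e))
    {b : ι → ℤ} (hpar : ∀ v ∈ V, (2 : ℤ) ∣ B.net (fun _ => 1) v - b v)
    (hsum : (2 * k : ℤ) ∣ ∑ v ∈ V, b v - 2 * (s * B.oddEdges.card)) :
    ∃ σ : κ → ℤ, (∀ e, σ e = 1 ∨ σ e = -1) ∧ ∀ v ∈ V, (2 * k : ℤ) ∣ B.net σ v - b v ∧
      |B.net σ v - (if v = w then s else 0)| ≤ 2 * k - 1 := by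
  have hk0 : 0 < k := by omega
  set m := B.oddEdges.card with hm
  set N : ι → ℤ := fun v => ∑ e ∈ B.oddEdges, endCount (B.p e) (B.q e) v with hN
  have hN0 : ∀ v, 0 ≤ N v := fun v => Finset.sum_nonneg fun e _ => endCount_nonneg _ _ _
  have hNz : m = 0 → ∀ v, N v = 0 := by
    intro h v
    simp only [hN, Finset.card_eq_zero.1 h, Finset.sum_empty]
  have hNw : |s| ≤ N w := by
    rcases hs with ⟨h1, rfl⟩ | ⟨h1, h2⟩
    · simpa using hN0 w
    · obtain ⟨e, he, u, hj⟩ := hinc h1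
      have h3 : |s| = 1 := by rcases h2 with rfl | rfl <;> simp
      have h4 : 1 ≤ endCount (B.p e) (B.q e) w := by
        rcases hj with ⟨-, h⟩ | ⟨h, -⟩ <;> rw [h] <;> unfold endCount <;> split_ifs <;> simp_all
      rw [h3]
      exact h4.trans (Finset.single_le_sum (f := fun e => endCount (B.p e) (B.q e) w)
        (fun e _ => endCount_nonneg _ _ _) he)
  have hNV : ∑ v ∈ V, N v = 2 * m := by
    rw [hN, Finset.sum_comm, Finset.sum_congr rfl (g := fun _ => (2 : ℤ)), Finset.sum_const, ← hm]
    · rw [nsmul_eq_mul]; ring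
    · intro e he
      have h1 := hends e (mem_oddEdges.1 he).1
      rw [sum_endCount, if_pos h1.1, if_pos h1.2]; rfl
  have hsabs : s * |s| = s := by
    rcases hs with ⟨-, rfl⟩ | ⟨-, rfl | rfl⟩ <;> simp
  -- The odd edges, all of sign `s`, become fixed edges, one for each end. One end at `w` is
  -- omitted: for `m = k` the total would be `2k` against a prescription divisible by `2k`, which
  -- allows only `2k - 2`, whereas `2k - 1` is allowed at an odd prescription.
  let P : OrientationProblem ι κ :=
    { V := V
      E := {e ∈ B.E | B.c e = -1}
      p := B.p
      q := B.q
      n := fun v => N v - if v = w then |s| else 0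
      r := fun v => s * (N v - if v = w then |s| else 0)
      b := fun v => b v - if v = w then s else 0 }
  have hite : ∀ (f : ι → ℤ) (c : ℤ) (A : Finset ι),
      ∑ v ∈ A, (f v - if v = w then c else 0) = ∑ v ∈ A, f v - if w ∈ A then c else 0 := by
    intro f c A
    simp [Finset.sum_sub_distrib, Finset.sum_ite_eq']
  have hn0 : ∀ v, 0 ≤ P.n v := by
    intro v
    have h1 := hN0 v
    simp only [P]
    split_ifs with h
    · subst h; omega
    · omega
  have hval : P.Valid k w := by
    constructor
    · intro e he
      exact hends e (Finset.mem_filter.1 he).1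
    · intro v _
      have h1 : |s| ≤ 1 := by rcases hs with ⟨-, rfl⟩ | ⟨-, rfl | rfl⟩ <;> simp
      have h2 := hn0 v
      have h3 : P.r v = s * P.n v := rfl
      rw [h3, abs_mul, abs_of_nonneg h2]
      nlinarith
    · intro v _
      have h3 : P.r v = s * P.n v := rfl
      rw [h3]
      rcases hs with ⟨h0, rfl⟩ | ⟨-, rfl | rfl⟩
      · simp [P, hNz h0]
      · simp
      · rw [show P.n v - -1 * P.n v = 2 * P.n v by ring]
        exact Dvd.intro _ rfl
    · intro A hA
      have h1 : (2 : ℤ) ∣ ∑ v ∈ A, (B.net (fun _ => 1) v - b v) :=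
        Finset.dvd_sum fun v hv => hpar v (hA hv)
      have h2 : ∑ v ∈ A, B.net (fun _ => 1) v =
          ∑ e ∈ B.E with B.c e = -1, ∑ v ∈ A, arc (B.p e) (B.q e) v + ∑ v ∈ A, N v := by
        rw [Finset.sum_comm, ← Finset.sum_add_distrib]
        refine Finset.sum_congr rfl fun v _ => ?_
        rw [net_eq hc]
        simp [hN]
      have h3 : (2 : ℤ) ∣ ∑ e ∈ B.E with B.c e = -1, (crossing A (B.p e) (B.q e) -
          ∑ v ∈ A, arc (B.p e) (B.q e) v) := by
        refine Finset.dvd_sum fun e _ => ?_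
        rw [sum_arc]
        unfold crossing
        by_cases h1 : B.p e ∈ A <;> by_cases h2 : B.q e ∈ A <;> simp [h1, h2]
      rw [Finset.sum_sub_distrib] at h1 h3
      have h4 : P.deg A = ∑ e ∈ B.E with B.c e = -1, crossing A (B.p e) (B.q e) +
          (∑ v ∈ A, N v - if w ∈ A then |s| else 0) := by
        simp only [OrientationProblem.deg, OrientationProblem.cut, P, hite]
      have h5 : (2 : ℤ) ∣ |s| - s := by
        rcases hs with ⟨-, rfl⟩ | ⟨-, rfl | rfl⟩ <;> simp
      rw [h4]
      simp only [P, hite]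
      split_ifs <;> omega
    · have h1 : ∑ v ∈ V, P.r v = s * (2 * m - |s|) := by
        simp only [P]
        rw [← Finset.mul_sum, hite, if_pos hw, hNV]
      have h2 : ∑ v ∈ V, P.b v = ∑ v ∈ V, b v - s := by
        simp only [P]
        rw [hite, if_pos hw]
      change (2 * k : ℤ) ∣ ∑ v ∈ V, P.r v - ∑ v ∈ V, P.b v
      rw [h1, h2, mul_sub, hsabs, ← dvd_neg]
      rwa [show -(s * (2 * (m : ℤ)) - s - (∑ v ∈ V, b v - s)) =
        ∑ v ∈ V, b v - 2 * (s * m) by ring]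
    · simp only [P, hite, hw, if_true, hNV]
      have h1 := modDist.nonneg k (∑ v ∈ V, b v - s)
      rcases hs with ⟨h0, rfl⟩ | ⟨h0, h2⟩
      · rw [h0, abs_zero, Nat.cast_zero]; omega
      · have h3 : |s| = 1 := by rcases h2 with rfl | rfl <;> simp
        have h4 := modDist.even_sub k (∑ v ∈ V, b v - s)
        have h5 := (Dvd.intro _ rfl : (2 : ℤ) ∣ 2 * k).trans hsum
        rw [h3]
        omega
    · intro A hA h1 h2
      right
      -- As `modDist` is at most `k`, the `3k - 2` even edges of the cut meet the degree condition
      -- by themselves.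
      have h3 := hcut A hA h1 h2
      have h4 := modDist.le hk0 (∑ v ∈ A, P.b v)
      have h5 : 0 ≤ ∑ v ∈ A, P.n v := Finset.sum_nonneg fun v _ => hn0 v
      have h6 : P.cut A = ∑ e ∈ B.E with B.c e = -1, crossing A (B.p e) (B.q e) := rfl
      unfold OrientationProblem.CutCond OrientationProblem.deg
      omega
  obtain ⟨σ, hσ, hsol⟩ := hval.solvable hk
  refine ⟨fun e => if B.c e = 1 then (if s = -1 then -1 else 1) else σ e, fun e => ?_,
    fun v hv => ?_⟩
  · dsimp only
    split_ifs
    · exact Or.inr rfl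
    · exact Or.inl rfl
    · exact hσ e
  · have h1 : B.net (fun e => if B.c e = 1 then (if s = -1 then -1 else 1) else σ e) v =
        P.r v + P.flow σ v + if v = w then s else 0 := by
      rw [net_eq hc, add_comm, add_right_comm]
      congr 1
      · have h2 : ∑ e ∈ B.oddEdges, (if B.c e = 1 then (if s = -1 then -1 else 1) else σ e) *
            endCount (B.p e) (B.q e) v = (if s = -1 then -1 else 1) * N v := by
          rw [hN, Finset.mul_sum]
          refine Finset.sum_congr rfl fun e he => ?_
          rw [if_pos (mem_oddEdges.1 he).2]
        rw [h2]
        simp only [P, mul_sub]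
        rcases hs with ⟨h0, rfl⟩ | ⟨h0, rfl | rfl⟩
        · simp [hNz h0 v]
        · by_cases h : v = w <;> simp [h]
        · by_cases h : v = w <;> simp [h]
      · refine Finset.sum_congr rfl fun e he => ?_
        have h2 := (Finset.mem_filter.1 he).2
        rw [if_neg (by rw [h2]; norm_num)]
    obtain ⟨h2, h3⟩ := hsol v hv
    rw [h1]
    refine ⟨?_, ?_⟩
    · rwa [show P.r v + P.flow σ v + (if v = w then s else 0) - b v =
        P.r v + P.flow σ v - P.b v by simp only [P]; ring]
    · rwa [add_sub_cancel_right]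

/-- Signing the edges of a highly connected multigraph with prescribed excesses modulo `2 * k`.
Here `C` is the prescribed excess of the edges within `X` over the edges within the complement. -/
theorem exists_signing {k : ℕ} (hk : 2 ≤ k) {V : Finset ι} {E T : Finset κ} {p q : κ → ι} {w : ι}
    (hw : w ∈ V) (hends : ∀ e ∈ E, p e ∈ V ∧ q e ∈ V) (hTE : T ⊆ E)
    (hT : Spans (fun e x y => p e = x ∧ q e = y ∨ p e = y ∧ q e = x) w T V) {X : Finset ι}
    (hcut : ∀ A ⊆ V, A.Nonempty → A ≠ V → 3 * k - 2 ≤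
      ∑ e ∈ E \ T with side X (p e) * side X (q e) = -1, crossing A (p e) (q e))
    {t : ι → ℤ} (hpar : ∀ v ∈ V, (2 : ℤ) ∣ excess E p q (fun _ => 1) v - t v) {C : ℤ}
    (hCk : |C| ≤ k) (hCN : |C| ≤ (E.filter fun e => side X (p e) * side X (q e) = 1).card)
    (hC2 : (2 : ℤ) ∣ (E.filter fun e => side X (p e) * side X (q e) = 1).card - C)
    (hsum : (2 * k : ℤ) ∣ ∑ v ∈ V, side X v * t v - 2 * C) :
    ∃ σ : κ → ℤ, (∀ e, σ e = 1 ∨ σ e = -1) ∧ ∀ v ∈ V, (2 * k : ℤ) ∣ excess E p q σ v - t v ∧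
      |excess E p q σ v - (if v = w then side X w * C.sign else 0)| ≤ 2 * k - 1 := by
  -- With the sign convention reversed outside `X`, the edges across `X` are even and those on one
  -- side are odd; excess and net outflow at `v` differ by the factor `side X v`.
  let B : Bidirected ι κ := { E := E, p := p, q := q, c := fun e => side X (p e) * side X (q e) }
  have hBodd : B.oddEdges = E.filter fun e => side X (p e) * side X (q e) = 1 := rfl
  have hsign : ∀ e ∈ B.E, B.c e = 1 ∨ B.c e = -1 := by
    intro e _
    simp only [B]
    rcases side_eq X (p e) with h | h <;> rcases side_eq X (q e) with h' | h' <;> rw [h, h'] <;>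
      simp
  obtain ⟨m, hm⟩ : ∃ m : ℕ, (m : ℤ) = |C| := ⟨C.natAbs, by simp⟩
  have hmc : C.sign * m = C := by rw [hm, Int.sign_mul_abs]
  have hmle : m ≤ B.oddEdges.card := by rw [hBodd]; omega
  obtain ⟨B₁, hB₁⟩ := Bidirected.exists_reduction (V := V) (B := B) (m := m) hT
    ⟨hTE, fun _ _ _ _ h => h, hsign, hends⟩ hmle (by
      rw [← hBodd] at hC2
      rcases abs_choice C with h | h <;> omega) (by
      intro e he _
      exact ⟨q e, (hends e (Bidirected.mem_oddEdges.1 he).1).2, p e, Or.inl ⟨rfl, rfl⟩⟩)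
  have hnet : ∀ τ : κ → ℤ, ∀ v, excess E p q (fun e => τ e * side X (p e)) v =
      side X v * B.net τ v := by
    intro τ v
    unfold excess Bidirected.net
    rw [Finset.mul_sum]
    refine Finset.sum_congr rfl fun e _ => ?_
    simp only [B, endCount]
    have h1 := side_mul_self X (p e)
    have h2 := side_mul_self X (q e)
    by_cases h3 : p e = v
    · subst h3
      by_cases h4 : q e = p e
      · simp only [h4, if_true, h1]; ring
      · simp only [h4, if_true, if_false]; ring
    · by_cases h4 : q e = v
      · subst h4
        simp only [h3, if_true, if_false]
        linear_combination (-(τ e) * side X (p e)) * h2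
      · simp [h3, h4]
  have hpar' : ∀ v ∈ V, (2 : ℤ) ∣ B₁.net (fun _ => 1) v - side X v * t v := by
    intro v hv
    obtain ⟨τ, hτ, h1⟩ := hB₁.refines (fun _ => 1) fun _ => Or.inl rfl
    have h2 : (2 : ℤ) ∣ excess E p q (fun e => τ e * side X (p e)) v -
        excess E p q (fun _ => 1) v := by
      unfold excess
      rw [← Finset.sum_sub_distrib]
      refine Finset.dvd_sum fun e _ => ?_
      rw [← sub_mul]
      refine Dvd.dvd.mul_right ?_ _
      dsimp only
      rcases hτ e with h | h <;> rcases side_eq X (p e) with h' | h' <;> rw [h, h'] <;> norm_num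
    have h3 := hpar v hv
    rw [← h1 v]
    rw [hnet] at h2
    rcases side_eq X v with h | h <;> rw [h] at h2 ⊢ <;> omega
  obtain ⟨σ, hσ, hs⟩ := Bidirected.exists_signing hk hw hB₁.sign hB₁.ends (s := C.sign)
    (b := fun v => side X v * t v) (by
      rw [hB₁.card]
      rcases Nat.eq_zero_or_pos m with h0 | h0
      · left
        refine ⟨h0, ?_⟩
        have : C = 0 := by rw [h0] at hm; simpa using hm.symm
        simp [this]
      · right
        refine ⟨h0, ?_⟩
        rcases lt_trichotomy C 0 with h | h | h
        · exact Or.inr (Int.sign_eq_neg_one_of_neg h)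
        · simp [h] at hm; omega
        · exact Or.inl (Int.sign_eq_one_of_pos h)) (by rw [hB₁.card]; omega)
    (by rw [hB₁.card]; exact hB₁.incident) (by
      intro A hA h1 h2
      refine (hcut A hA h1 h2).trans ?_
      have h3 : ∀ e ∈ (E \ T).filter fun e => side X (p e) * side X (q e) = -1,
          crossing A (p e) (q e) = crossing A (B₁.p e) (B₁.q e) ∧
          e ∈ B₁.E.filter fun e => B₁.c e = -1 := by
        intro e he
        rw [Finset.mem_filter, Finset.mem_sdiff] at he
        obtain ⟨h4, h5, h6, h7⟩ := hB₁.keep e he.1.1 he.1.2 he.2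
        rw [h5, h6]
        exact ⟨rfl, Finset.mem_filter.2 ⟨h4, h7⟩⟩
      rw [Finset.sum_congr rfl fun e he => (h3 e he).1]
      exact Finset.sum_le_sum_of_subset_of_nonneg (fun e he => (h3 e he).2)
        fun _ _ _ => crossing_nonneg _ _ _) hpar' (by rw [hB₁.card, hmc]; exact hsum)
  obtain ⟨τ, hτ, h1⟩ := hB₁.refines σ hσ
  refine ⟨fun e => τ e * side X (p e), fun e => ?_, fun v hv => ?_⟩
  · rcases hτ e with h | h <;> rcases side_eq X (p e) with h' | h' <;> simp [h, h']
  · obtain ⟨h2, h3⟩ := hs v hv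
    rw [hnet, h1]
    have h4 := side_mul_self X v
    constructor
    · rw [show side X v * B₁.net σ v - t v = side X v * (B₁.net σ v - side X v * t v) by
        linear_combination (t v) * h4]
      exact h2.mul_left _
    · have h5 : side X v * B₁.net σ v - (if v = w then side X w * C.sign else 0) =
          side X v * (B₁.net σ v - if v = w then C.sign else 0) := by
        split_ifs with h
        · rw [h]; ring
        · ring
      rw [h5, abs_mul]
      rcases side_eq X v with h | h <;> rw [h] <;> simpa using h3

end

/-! ### The choice of `C` and the exceptional case -/

section

variable {ι κ : Type*} [DecidableEq ι] [DecidableEq κ] {k : ℕ} {V : Finset ι} {E : Finset κ}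
  {p q : κ → ι} {t : ι → ℤ}

/-- The edges with both ends on the same side of `X`. -/
def sameSide (E : Finset κ) (p q : κ → ι) (X : Finset ι) : Finset κ :=
  {e ∈ E | side X (p e) * side X (q e) = 1}

/-- The multigraph has a spanning tree with root `w` whose deletion leaves at least `6 * k - 3`
edges in each cut. -/
def HasGoodTree (k : ℕ) (V : Finset ι) (E : Finset κ) (p q : κ → ι) (w : ι) : Prop :=
  ∃ T ⊆ E, Spans (fun e x y => p e = x ∧ q e = y ∨ p e = y ∧ q e = x) w T V ∧
    ∀ A ⊆ V, A.Nonempty → A ≠ V → 6 * k - 3 ≤ ∑ e ∈ E \ T, crossing A (p e) (q e)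

/-- The excess `C` of the edges on the side `X` over the edges on the other side is possible in the
presence of the prescribed excesses `t` modulo `2 * k`. -/
structure SideBalanced (k : ℕ) (V : Finset ι) (E : Finset κ) (p q : κ → ι) (t : ι → ℤ) (X : Finset ι)
    (C : ℤ) : Prop where
  le : |C| ≤ (sameSide E p q X).card
  even : (2 : ℤ) ∣ (sameSide E p q X).card - C
  sum : (2 * k : ℤ) ∣ ∑ v ∈ V, side X v * t v - 2 * C

/-- Only the class of `C` modulo `2k` matters for the congruence, and the representative nearest to
zero is no larger and has the same parity. -/
lemma SideBalanced.exists_abs_le (hk : 0 < k) {X : Finset ι} {C : ℤ} (h : SideBalanced k V E p q t X C) :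
    ∃ C' : ℤ, |C'| ≤ k ∧ SideBalanced k V E p q t X C' := by
  have h1 := modDist.dvd_sub_bmod k C
  refine ⟨Int.bmod C (2 * k), modDist.le hk C, (modDist.le_abs hk C).trans h.le, ?_, ?_⟩
  · have h2 := h.even
    have h3 := (Dvd.intro _ rfl : (2 : ℤ) ∣ 2 * k).trans h1
    omega
  · have h2 := dvd_add h.sum (h1.mul_left 2)
    rwa [show ∑ v ∈ V, side X v * t v - 2 * C + 2 * (C - Int.bmod C (2 * k)) =
      ∑ v ∈ V, side X v * t v - 2 * Int.bmod C (2 * k) by ring] at h2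

/-- The cut `X` is fixed before `C`, so that `C` can still be varied for the same `X`. Half of `6k -
3` edges, rounded up, is `3k - 1`, which suffices. -/
lemma exists_signing_at (hk : 2 ≤ k) (hends : ∀ e ∈ E, p e ∈ V ∧ q e ∈ V)
    (hpar : ∀ v ∈ V, (2 : ℤ) ∣ excess E p q (fun _ => 1) v - t v) {w : ι} (hw : w ∈ V)
    (hT : HasGoodTree k V E p q w) :
    ∃ X ⊆ V, ∀ C : ℤ, |C| ≤ k → SideBalanced k V E p q t X C →
      ∃ σ : κ → ℤ, (∀ e, σ e = 1 ∨ σ e = -1) ∧ ∀ v ∈ V, (2 * k : ℤ) ∣ excess E p q σ v - t v ∧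
        |excess E p q σ v - (if v = w then side X w * C.sign else 0)| ≤ 2 * k - 1 := by
  obtain ⟨T, hTE, hS, hcut⟩ := hT
  obtain ⟨X, hX, hmax⟩ := exists_max_cut V (E \ T) p q
  refine ⟨X, hX, fun C hC hb => exists_signing hk hw hends hTE hS ?_ hpar hC hb.le hb.even hb.sum⟩
  intro A hA h1 h2
  have h3 := hcut A hA h1 h2
  have h4 := hmax A hA
  omega

lemma dvd_sum_side {X : Finset ι} (h0 : ∀ v ∈ V, (2 * k : ℤ) ∣ t v) :
    (2 * k : ℤ) ∣ ∑ v ∈ V, side X v * t v :=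
  Finset.dvd_sum fun v hv => (h0 v hv).mul_left _

lemma SideBalanced.dvd {X : Finset ι} {C : ℤ} (h : SideBalanced k V E p q t X C)
    (h0 : ∀ v ∈ V, (2 * k : ℤ) ∣ t v) : (k : ℤ) ∣ C := by
  have h1 := (dvd_sub_right (dvd_sum_side h0)).1 h.sum
  exact Int.dvd_of_mul_dvd_mul_left (by norm_num : (2 : ℤ) ≠ 0) h1

/-- All degrees are even here, so an even number of edges leaves `X`; the other edges are those on
one side. -/
lemma sameSide_card_even_iff {X : Finset ι} (hX : X ⊆ V)
    (hpar : ∀ v ∈ V, (2 : ℤ) ∣ excess E p q (fun _ => 1) v - t v)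
    (h0 : ∀ v ∈ V, (2 * k : ℤ) ∣ t v) : (2 : ℤ) ∣ E.card - (sameSide E p q X).card := by
  have h1 : (2 : ℤ) ∣ ∑ v ∈ X, excess E p q (fun _ => 1) v := Finset.dvd_sum fun v hv => by
    have h2 := hpar v (hX hv)
    have h3 := (Dvd.intro _ rfl : (2 : ℤ) ∣ 2 * k).trans (h0 v (hX hv))
    omega
  have h2 : ((sameSide E p q X).card : ℤ) = ∑ e ∈ E, (1 - crossing X (p e) (q e)) := by
    rw [sameSide, Finset.card_filter, Nat.cast_sum]
    refine Finset.sum_congr rfl fun e _ => ?_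
    unfold side crossing
    by_cases h3 : p e ∈ X <;> by_cases h4 : q e ∈ X <;> simp [h3, h4]
  have h3 : (2 : ℤ) ∣ ∑ e ∈ E, (crossing X (p e) (q e) - ∑ v ∈ X, endCount (p e) (q e) v) := by
    refine Finset.dvd_sum fun e _ => ?_
    rw [sum_endCount]
    unfold crossing
    by_cases h3 : p e ∈ X <;> by_cases h4 : q e ∈ X <;> simp [h3, h4]
  simp only [excess, one_mul] at h1
  rw [Finset.sum_comm] at h1
  rw [h2, Finset.sum_sub_distrib, Finset.sum_const, nsmul_eq_mul, mul_one]
  rw [Finset.sum_sub_distrib] at h3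
  omega

/-- Outside the exceptional case, all excesses can be made less than `2 * k`. -/
theorem exists_signing_of_not_exceptional (hk : 2 ≤ k) (hends : ∀ e ∈ E, p e ∈ V ∧ q e ∈ V)
    (hV : V.Nonempty) (hpar : ∀ v ∈ V, (2 : ℤ) ∣ excess E p q (fun _ => 1) v - t v)
    (hT : ∀ w ∈ V, HasGoodTree k V E p q w) (hC : ∀ X ⊆ V, ∃ C, SideBalanced k V E p q t X C)
    (hne : ¬(Odd k ∧ Odd E.card ∧ ∀ v ∈ V, (2 * k : ℤ) ∣ t v)) :
    ∃ σ : κ → ℤ, (∀ e, σ e = 1 ∨ σ e = -1) ∧ ∀ v ∈ V, (2 * k : ℤ) ∣ excess E p q σ v - t v ∧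
      |excess E p q σ v| ≤ 2 * k - 1 := by
  have hk0 : 0 < k := by omega
  by_cases h0 : ∀ v ∈ V, (2 * k : ℤ) ∣ t v
  · obtain ⟨w, hw⟩ := hV
    obtain ⟨X, hX, hs⟩ := exists_signing_at hk hends hpar hw (hT w hw)
    obtain ⟨C, hC⟩ := hC X hX
    have h1 := sameSide_card_even_iff hX hpar h0
    have h2 := hC.dvd h0
    -- With `C = 0` the shift at `w` vanishes. If parity excludes it, the given `C` is an odd
    -- multiple of `k` and the number of edges is odd: the exceptional case.
    have hb : SideBalanced k V E p q t X 0 := by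
      refine ⟨by simp, ?_, by simpa using dvd_sum_side h0⟩
      by_contra h3
      refine hne ⟨?_, ?_, h0⟩
      · rw [← Int.odd_coe_nat]
        obtain ⟨c, rfl⟩ := h2
        have h4 : Odd ((k : ℤ) * c) := by
          have := hC.even
          rw [Int.odd_iff]
          omega
        exact (Int.odd_mul.1 h4).1
      · rw [← Int.odd_coe_nat, Int.odd_iff]
        omega
    obtain ⟨σ, hσ, hs⟩ := hs 0 (by simp) hb
    exact ⟨σ, hσ, by simpa using hs⟩
  · push Not at h0
    -- The shift at `w` only admits the additional values `2k` and `-2k`, which are not in the class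
    -- of `t w`.
    obtain ⟨w, hw, hwt⟩ := h0
    obtain ⟨X, hX, hs⟩ := exists_signing_at hk hends hpar hw (hT w hw)
    obtain ⟨C, hC⟩ := hC X hX
    obtain ⟨C, hCk, hC⟩ := hC.exists_abs_le hk0
    obtain ⟨σ, hσ, hs⟩ := hs C hCk hC
    refine ⟨σ, hσ, fun v hv => ⟨(hs v hv).1, ?_⟩⟩
    obtain ⟨h1, h2⟩ := hs v hv
    by_cases hvw : v = w
    · subst hvw
      rw [if_pos rfl] at h2
      have h3 : |side X v * C.sign| ≤ 1 := by
        rw [abs_mul]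
        rcases side_eq X v with h | h <;> rcases Int.sign_trichotomy C with h' | h' | h' <;>
          rw [h, h'] <;> simp
      have h4 : |excess E p q σ v| ≠ 2 * k := by
        intro h4
        refine hwt ?_
        have h5 : (2 * k : ℤ) ∣ excess E p q σ v := by
          rw [← dvd_abs, h4]
        exact (dvd_sub_right h5).1 h1
      have h5 := abs_sub_abs_le_abs_sub (excess E p q σ v) (side X v * C.sign)
      omega
    · simpa [hvw] using h2

/-- If all prescribed excesses are zero, they can be achieved up to a possible exception at `z`. -/
theorem exists_signing_of_zero (hk : 2 ≤ k) (hends : ∀ e ∈ E, p e ∈ V ∧ q e ∈ V)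
    (hpar : ∀ v ∈ V, (2 : ℤ) ∣ excess E p q (fun _ => 1) v - t v) {z : ι} (hz : z ∈ V)
    (hT : HasGoodTree k V E p q z) (hC : ∀ X ⊆ V, ∃ C, SideBalanced k V E p q t X C)
    (h0 : ∀ v ∈ V, (2 * k : ℤ) ∣ t v) {δ : ℤ} (hδ : δ = 1 ∨ δ = -1) :
    ∃ σ : κ → ℤ, (∀ e, σ e = 1 ∨ σ e = -1) ∧ ∀ v ∈ V, (2 * k : ℤ) ∣ excess E p q σ v - t v ∧
      |excess E p q σ v - (if v = z then δ else 0)| ≤ 2 * k - 1 := by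
  have hk0 : 0 < k := by omega
  obtain ⟨X, hX, hs⟩ := exists_signing_at hk hends hpar hz hT
  obtain ⟨C, hC⟩ := hC X hX
  obtain ⟨C, hCk, hC⟩ := hC.exists_abs_le hk0
  obtain ⟨c, hc⟩ := hC.dvd h0
  by_cases hC0 : C = 0
  · subst hC0
    obtain ⟨σ, hσ, hs⟩ := hs 0 hCk hC
    refine ⟨σ, hσ, fun v hv => ⟨(hs v hv).1, ?_⟩⟩
    obtain ⟨h1, h2⟩ := hs v hv
    simp only [Int.sign_zero, mul_zero, ite_self, sub_zero] at h2
    have h3 : excess E p q σ v = 0 := by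
      refine Int.eq_zero_of_abs_lt_dvd ((dvd_sub_left (h0 v hv)).1 h1) (by omega)
    rw [h3, zero_sub, abs_neg]
    split_ifs
    · rcases hδ with rfl | rfl <;> simp <;> omega
    · simp; omega
  · have hCabs : |C| = k := by
      refine le_antisymm hCk (Int.le_of_dvd (abs_pos.2 hC0) ?_)
      rw [dvd_abs]
      exact ⟨c, hc⟩
    have hz1 := side_eq X z
    -- Since `2k` and `-2k` agree modulo `2k`, both `C = k` and `C = -k` are balanced; the sign is
    -- chosen to produce the shift `δ` at `z`.
    obtain ⟨η, hη, hη'⟩ : ∃ η : ℤ, (η = 1 ∨ η = -1) ∧ side X z * η = δ :=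
      ⟨side X z * δ, by rcases hz1 with h | h <;> rw [h] <;> omega, by
        rw [← mul_assoc, side_mul_self, one_mul]⟩
    have habs : |η * k| = k := by
      rcases hη with rfl | rfl <;> simp
    have hb : SideBalanced k V E p q t X (η * k) := by
      refine ⟨by rw [habs, ← hCabs]; exact hC.le, ?_, ?_⟩
      · have h1 := hC.even
        rcases abs_choice C with h | h <;> rcases hη with rfl | rfl <;> omega
      · exact dvd_sub (dvd_sum_side h0) ⟨η, by ring⟩
    obtain ⟨σ, hσ, hs⟩ := hs (η * k) habs.le hb
    have hsign : (η * (k : ℤ)).sign = η := by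
      rw [Int.sign_mul, Int.sign_eq_one_of_pos (a := (k : ℤ)) (by omega), mul_one]
      rcases hη with rfl | rfl <;> rfl
    rw [hsign, hη'] at hs
    exact ⟨σ, hσ, hs⟩

end

/-! ### Degrees, compatibility and trees in terms of finite edge sets -/

section

variable {α β : Type*} {G H : Graph α β} {p q : β → α} {e : β} {v : α}

namespace Graph

/-- The ends of each edge `e` are `p e` and `q e`. -/
def IsEnds (G : Graph α β) (p q : β → α) : Prop := ∀ e ∈ E(G), G.IsLink e (p e) (q e)

lemma exists_isEnds [Nonempty α] (G : Graph α β) : ∃ p q, G.IsEnds p q := by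
  have h : ∀ e, ∃ x y, e ∈ E(G) → G.IsLink e x y := fun e => by
    by_cases he : e ∈ E(G)
    · obtain ⟨x, y, h⟩ := G.exists_isLink_of_mem_edgeSet he
      exact ⟨x, y, fun _ => h⟩
    · exact ⟨Classical.arbitrary α, Classical.arbitrary α, fun h => absurd h he⟩
  choose p q h using h
  exact ⟨p, q, h⟩

lemma IsEnds.mono (h : G.IsEnds p q) (hle : H ≤ G) : H.IsEnds p q :=
  fun e he => (hle.isLink_iff he).2 (h e (hle.edgeSet_mono he))

lemma IsEnds.isLink_iff (h : G.IsEnds p q) {x y : α} :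
    G.IsLink e x y ↔ e ∈ E(G) ∧ (p e = x ∧ q e = y ∨ p e = y ∧ q e = x) := by
  refine ⟨fun hl => ⟨hl.edge_mem, ?_⟩, fun ⟨he, hxy⟩ => (h e he).isLink_iff.2 ?_⟩
  · have := (h e hl.edge_mem).isLink_iff.1 hl
    tauto
  · tauto

lemma IsEnds.inc_iff (h : G.IsEnds p q) : G.Inc e v ↔ e ∈ E(G) ∧ (p e = v ∨ q e = v) := by
  simp only [Inc, h.isLink_iff]
  refine ⟨fun ⟨y, he, hy⟩ => ⟨he, by tauto⟩, ?_⟩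
  rintro ⟨he, rfl | rfl⟩
  · exact ⟨q e, he, Or.inl ⟨rfl, rfl⟩⟩
  · exact ⟨p e, he, Or.inr ⟨rfl, rfl⟩⟩

lemma IsEnds.isLoopAt_iff (h : G.IsEnds p q) :
    G.IsLoopAt e v ↔ e ∈ E(G) ∧ p e = v ∧ q e = v := by
  rw [IsLoopAt, h.isLink_iff]
  tauto

variable [DecidableEq α] [DecidableEq β]

lemma IsEnds.degree_eq (h : G.IsEnds p q) (hE : E(G).Finite) (v : α) :
    (G.degree v : ℤ) = ∑ e ∈ hE.toFinset, endCount (p e) (q e) v := by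
  have h1 : {e | G.Inc e v} = ({e ∈ hE.toFinset | p e = v ∨ q e = v} : Finset β) := by
    ext e; simp [h.inc_iff]
  have h2 : {e | G.IsLoopAt e v} = ({e ∈ hE.toFinset | p e = v ∧ q e = v} : Finset β) := by
    ext e; simp [h.isLoopAt_iff]
  rw [degree, h1, h2, Set.ncard_coe_finset, Set.ncard_coe_finset, Finset.card_filter,
    Finset.card_filter, Nat.cast_add, Nat.cast_sum, Nat.cast_sum, ← Finset.sum_add_distrib]
  refine Finset.sum_congr rfl fun e _ => ?_
  unfold endCount
  by_cases h3 : p e = v <;> by_cases h4 : q e = v <;> simp [h3, h4]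

lemma IsEnds.degree_eq_excess (h : G.IsEnds p q) (hE : E(G).Finite) (v : α) :
    (G.degree v : ℤ) = excess hE.toFinset p q (fun _ => 1) v := by
  simp [h.degree_eq hE, excess]

lemma restrict_isSpanningSubgraph (G : Graph α β) (F : Set β) : G.restrict F ≤s G :=
  ⟨restrict_le, rfl⟩

lemma IsEnds.excess_eq (h : G.IsEnds p q) (hE : E(G).Finite) {σ : β → ℤ}
    (hσ : ∀ e, σ e = 1 ∨ σ e = -1) (v : α) :
    excess hE.toFinset p q σ v = 2 * (G.restrict {e | σ e = 1}).degree v - G.degree v := by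
  have hE' : E(G.restrict {e | σ e = 1}).Finite := hE.subset (restrict_le).edgeSet_mono
  have h1 : hE'.toFinset = {e ∈ hE.toFinset | σ e = 1} := by
    ext e; simp
  rw [(h.mono restrict_le).degree_eq hE', h.degree_eq hE, h1, Finset.sum_filter, Finset.mul_sum,
    ← Finset.sum_sub_distrib, excess]
  refine Finset.sum_congr rfl fun e _ => ?_
  rcases hσ e with h2 | h2
  · rw [h2, if_pos rfl]; ring
  · rw [h2, if_neg (by norm_num)]; ring

lemma IsEnds.mem_toFinset (h : G.IsEnds p q) (hV : V(G).Finite) (hE : E(G).Finite) :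
    ∀ e ∈ hE.toFinset, p e ∈ hV.toFinset ∧ q e ∈ hV.toFinset := fun e he => by
  have := h e (hE.mem_toFinset.1 he)
  exact ⟨hV.mem_toFinset.2 this.left_mem, hV.mem_toFinset.2 this.right_mem⟩

lemma IsEnds.sum_degree (h : G.IsEnds p q) (hV : V(G).Finite) (hE : E(G).Finite) :
    ∑ v ∈ hV.toFinset, (G.degree v : ℤ) = 2 * E(G).ncard := by
  simp only [h.degree_eq hE]
  rw [Finset.sum_comm, Set.ncard_eq_toFinset_card _ hE, mul_comm, ← nsmul_eq_mul,
    ← Finset.sum_const]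
  refine Finset.sum_congr rfl fun e he => ?_
  rw [sum_endCount, if_pos (h.mem_toFinset hV hE e he).1, if_pos (h.mem_toFinset hV hE e he).2]
  rfl

lemma IsEnds.edgesWithin_eq (h : G.IsEnds p q) (hE : E(G).Finite) (X : Finset α) :
    G.edgesWithin X = ({e ∈ hE.toFinset | p e ∈ X ∧ q e ∈ X} : Finset β).card := by
  rw [edgesWithin, ← Set.ncard_coe_finset]
  congr 1
  ext e
  simp only [h.isLink_iff, Set.mem_ofPred_eq, Finset.coe_filter, Set.Finite.mem_toFinset,
    Finset.mem_coe]
  constructor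
  · rintro ⟨x, hx, y, hy, he, ⟨rfl, rfl⟩ | ⟨rfl, rfl⟩⟩
    exacts [⟨he, hx, hy⟩, ⟨he, hy, hx⟩]
  · rintro ⟨he, hx, hy⟩
    exact ⟨_, hx, _, hy, he, Or.inl ⟨rfl, rfl⟩⟩

lemma IsEnds.card_sameSide (h : G.IsEnds p q) (hV : V(G).Finite) (hE : E(G).Finite)
    (X : Finset α) : ((sameSide hE.toFinset p q X).card : ℤ) =
      G.edgesWithin X + G.edgesWithin (hV.toFinset \ X : Finset α) := by
  rw [h.edgesWithin_eq hE, h.edgesWithin_eq hE, sameSide, Finset.card_filter, Finset.card_filter,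
    Finset.card_filter, ← Nat.cast_add, ← Finset.sum_add_distrib]
  congr 1
  refine Finset.sum_congr rfl fun e he => ?_
  obtain ⟨h1, h2⟩ := h.mem_toFinset hV hE e he
  unfold side
  by_cases h3 : p e ∈ X <;> by_cases h4 : q e ∈ X <;>
    simp only [h1, h2, h3, h4, Finset.mem_sdiff] <;> norm_num

lemma IsEnds.sum_side_degree (h : G.IsEnds p q) (hV : V(G).Finite) (hE : E(G).Finite)
    (X : Finset α) : ∑ v ∈ hV.toFinset, side X v * (G.degree v : ℤ) =
      2 * G.edgesWithin X - 2 * G.edgesWithin (hV.toFinset \ X : Finset α) := by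
  have h1 : ∑ v ∈ hV.toFinset, side X v * (G.degree v : ℤ) =
      ∑ e ∈ hE.toFinset, (side X (p e) + side X (q e)) := by
    simp only [h.degree_eq hE, Finset.mul_sum]
    rw [Finset.sum_comm]
    refine Finset.sum_congr rfl fun e he => ?_
    obtain ⟨h1, h2⟩ := h.mem_toFinset hV hE e he
    simp only [endCount, mul_add, mul_ite, mul_one, mul_zero, Finset.sum_add_distrib,
      Finset.sum_ite_eq, h1, h2, if_true]
  rw [h1, h.edgesWithin_eq hE, h.edgesWithin_eq hE, Finset.card_filter, Finset.card_filter,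
    Nat.cast_sum, Nat.cast_sum, Finset.mul_sum, Finset.mul_sum, ← Finset.sum_sub_distrib]
  refine Finset.sum_congr rfl fun e he => ?_
  obtain ⟨h1, h2⟩ := h.mem_toFinset hV hE e he
  unfold side
  by_cases h3 : p e ∈ X <;> by_cases h4 : q e ∈ X <;>
    simp [h1, h2, h3, h4]

lemma sum_side_mul {V X : Finset α} (hX : X ⊆ V) (g : α → ℤ) :
    ∑ v ∈ V, side X v * g v = ∑ v ∈ X, g v - ∑ v ∈ V \ X, g v := by
  rw [← Finset.sum_sdiff hX, add_comm, sub_eq_add_neg, ← Finset.sum_neg_distrib]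
  congr 1
  · exact Finset.sum_congr rfl fun v hv => by simp [side, hv]
  · exact Finset.sum_congr rfl fun v hv => by simp [side, (Finset.mem_sdiff.1 hv).2]

lemma IsCompatibleMap.exists_sideBalanced {k : ℕ} {f : α → ZMod k} (hf : G.IsCompatibleMap f)
    (h : G.IsEnds p q) (hV : V(G).Finite) (hE : E(G).Finite) {F : α → ℤ}
    (hF : ∀ v, (F v : ZMod k) = f v) {X : Finset α} (hX : X ⊆ hV.toFinset) :
    ∃ C, SideBalanced k hV.toFinset hE.toFinset p q (fun v => 2 * F v - G.degree v) X C := by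
  set Y := hV.toFinset \ X with hY
  have hsum : ∑ v ∈ hV.toFinset, side X v * (2 * F v - G.degree v) =
      2 * (∑ v ∈ X, F v - ∑ v ∈ Y, F v) -
        (2 * G.edgesWithin X - 2 * G.edgesWithin (Y : Finset α)) := by
    rw [← h.sum_side_degree hV hE X, ← sum_side_mul hX, Finset.mul_sum, ← Finset.sum_sub_distrib]
    exact Finset.sum_congr rfl fun v _ => by ring
  have hcard := h.card_sameSide hV hE X
  rw [← hY] at hcard
  have hsums : ∀ Z : Finset α, ∑ᶠ v ∈ (Z : Set α), f v = ((∑ v ∈ Z, F v : ℤ) : ZMod k) :=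
    fun Z => by
      rw [finsum_mem_coe_finset, Int.cast_sum]
      exact Finset.sum_congr rfl fun v _ => (hF v).symm
  have hXY : (X : Set α) ∪ Y = V(G) := by
    rw [← Finset.coe_union, hY, Finset.union_sdiff_of_subset hX, Set.Finite.coe_toFinset]
  have hdisj : Disjoint (X : Set α) Y := by
    rw [Finset.disjoint_coe]; exact Finset.disjoint_sdiff
  rcases hf X Y hXY hdisj with ⟨x, hx, hxs⟩ | ⟨y, hy, hys⟩
  -- This is the value of `C` when `x` edges within `X` are positive and all edges within `Y` are
  -- negative.
  · refine ⟨2 * x - G.edgesWithin X + G.edgesWithin (Y : Finset α), ?_, ?_, ?_⟩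
    · rw [hcard, abs_le]; omega
    · rw [hcard]; omega
    · rw [hsum]
      rw [hsums, hsums] at hxs
      have h1 : (k : ℤ) ∣ ∑ v ∈ X, F v - 2 * x - ∑ v ∈ Y, F v := by
        rw [← ZMod.intCast_eq_intCast_iff_dvd_sub]
        simpa only [Int.cast_sub, Int.cast_mul, Int.cast_ofNat, Int.cast_natCast] using hxs.symm
      have h2 := mul_dvd_mul_left 2 h1
      refine h2.trans (dvd_of_eq ?_)
      ring
  -- Here all edges within `X` are negative and `y` edges within `Y` are positive.
  · refine ⟨-(2 * y) - G.edgesWithin X + G.edgesWithin (Y : Finset α), ?_, ?_, ?_⟩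
    · rw [hcard, abs_le]; omega
    · rw [hcard]; omega
    · rw [hsum]
      rw [hsums, hsums] at hys
      have h1 : (k : ℤ) ∣ ∑ v ∈ X, F v - (∑ v ∈ Y, F v - 2 * y) := by
        rw [← ZMod.intCast_eq_intCast_iff_dvd_sub]
        simpa only [Int.cast_sub, Int.cast_mul, Int.cast_ofNat, Int.cast_natCast] using hys.symm
      have h2 := mul_dvd_mul_left 2 h1
      refine h2.trans (dvd_of_eq ?_)
      ring

lemma IsConnected.exists_isLink_of_mem_of_notMem (h : G.IsConnected) {A : Set α} {x y : α}
    (hx : x ∈ V(G)) (hy : y ∈ V(G)) (hxA : x ∈ A) (hyA : y ∉ A) :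
    ∃ e, ∃ a ∈ A, ∃ b ∉ A, G.IsLink e a b := by
  by_contra! hcon
  refine hyA ?_
  have h1 := h.2 x hx y hy
  clear hy hyA
  induction h1 with
  | refl => exact hxA
  | tail _ hbc ih =>
    obtain ⟨e, he⟩ := hbc
    by_contra hc
    exact hcon e _ ih _ hc he

lemma IsConnected.exists_spans (hc : G.IsConnected) (h : G.IsEnds p q) (hV : V(G).Finite)
    {w : α} (hw : w ∈ V(G)) : ∃ T : Finset β, (T : Set β) ⊆ E(G) ∧
      Spans (fun e x y => p e = x ∧ q e = y ∨ p e = y ∧ q e = x) w T hV.toFinset := by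
  -- Keeping the ends of the edges of `T` in `W` ensures that an edge leaving `W` is new, so a
  -- largest `W` must contain all vertices.
  let P : Finset α → Finset β → Prop := fun W T => (T : Set β) ⊆ E(G) ∧
    (∀ e ∈ T, p e ∈ W ∧ q e ∈ W) ∧
    Spans (fun e x y => p e = x ∧ q e = y ∨ p e = y ∧ q e = x) w T W
  classical
  obtain ⟨W, hW, hmax⟩ := Finset.exists_max_image
    {W ∈ hV.toFinset.powerset | w ∈ W ∧ ∃ T, P W T} Finset.card
    ⟨{w}, by
      rw [Finset.mem_filter, Finset.mem_powerset, Finset.singleton_subset_iff, hV.mem_toFinset]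
      exact ⟨hw, Finset.mem_singleton_self w, ∅, by simp, by simp, .single⟩⟩
  rw [Finset.mem_filter, Finset.mem_powerset] at hW
  obtain ⟨hWV, hwW, T, hTE, hTW, hS⟩ := hW
  by_cases hWV' : W = hV.toFinset
  · exact ⟨T, hTE, hWV' ▸ hS⟩
  obtain ⟨y, hy, hyW⟩ := Finset.exists_of_ssubset (hWV.ssubset_of_ne hWV')
  obtain ⟨e, a, ha, b, hb, hab⟩ := hc.exists_isLink_of_mem_of_notMem (A := W) hw
    (hV.mem_toFinset.1 hy) hwW hyW
  obtain ⟨he, hab'⟩ := h.isLink_iff.1 hab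
  rw [Finset.mem_coe] at ha hb
  have heT : e ∉ T := fun heT => by
    have := hTW e heT
    rcases hab' with ⟨rfl, rfl⟩ | ⟨rfl, rfl⟩
    exacts [hb this.2, hb this.1]
  have := hmax (insert b W) (by
    rw [Finset.mem_filter, Finset.mem_powerset]
    refine ⟨Finset.insert_subset (hV.mem_toFinset.2 hab.right_mem) hWV,
      Finset.mem_insert_of_mem hwW, insert e T, ?_, ?_, .step e a b T W hS ha hb heT hab'⟩
    · rw [Finset.coe_insert]
      exact Set.insert_subset he hTE
    · intro e' he'
      rw [Finset.mem_insert] at he'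
      rcases he' with rfl | he'
      · rcases hab' with ⟨rfl, rfl⟩ | ⟨rfl, rfl⟩ <;> simp [ha]
      · exact ⟨Finset.mem_insert_of_mem (hTW e' he').1, Finset.mem_insert_of_mem (hTW e' he').2⟩)
  rw [Finset.card_insert_of_notMem hb] at this
  omega

/-- One tree is set aside and rooted at `w`; each of the other `6k - 3` trees contributes an edge of
its own to every cut. -/
lemma IsTreeConnected.hasGoodTree {k : ℕ} (hk : 2 ≤ k) (hG : G.IsTreeConnected (6 * k - 2))
    (h : G.IsEnds p q) (hV : V(G).Finite) (hE : E(G).Finite) {w : α} (hw : w ∈ V(G)) :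
    HasGoodTree k hV.toFinset hE.toFinset p q w := by
  obtain ⟨T, hT, hdisj⟩ := hG
  let i₀ : Fin (6 * k - 2) := ⟨0, by omega⟩
  have hV' : ∀ i, V(T i) = V(G) := fun i => (hT i).1.vertexSet_eq
  have hV₀ : V(T i₀).Finite := by rw [hV']; exact hV
  obtain ⟨S, hSE, hS⟩ := (hT i₀).2.1.exists_spans (h.mono (hT i₀).1.le) hV₀
    (by rw [hV']; exact hw)
  have hVeq : hV₀.toFinset = hV.toFinset := by
    ext v; simp [hV']
  rw [hVeq] at hS
  refine ⟨S, fun e he => hE.mem_toFinset.2 ((hT i₀).1.le.edgeSet_mono (hSE he)), hS, ?_⟩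
  intro A hA hA0 hAV
  obtain ⟨x, hx⟩ := hA0
  obtain ⟨y, hy, hyA⟩ := Finset.exists_of_ssubset (hA.ssubset_of_ne hAV)
  have hcross : ∀ i, ∃ e ∈ E(T i), crossing A (p e) (q e) = 1 := fun i => by
    obtain ⟨e, a, ha, b, hb, hab⟩ := (hT i).2.1.exists_isLink_of_mem_of_notMem (A := A)
      (by rw [hV']; exact hV.mem_toFinset.1 (hA hx)) (by rw [hV']; exact hV.mem_toFinset.1 hy)
      hx hyA
    refine ⟨e, hab.edge_mem, ?_⟩
    rw [Finset.mem_coe] at ha hb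
    rcases ((h.mono (hT i).1.le).isLink_iff.1 hab).2 with ⟨rfl, rfl⟩ | ⟨rfl, rfl⟩ <;>
      simp [crossing, ha, hb]
  choose c hcE hc using hcross
  have hinj : Function.Injective c := fun i j hij => by
    by_contra hne
    exact Set.disjoint_left.1 (hdisj hne) (hcE i) (hij ▸ hcE j)
  have hsub : (Finset.univ.erase i₀).image c ⊆ hE.toFinset \ S := by
    intro e he
    obtain ⟨i, hi, rfl⟩ := Finset.mem_image.1 he
    rw [Finset.mem_sdiff, hE.mem_toFinset]
    exact ⟨(hT i).1.le.edgeSet_mono (hcE i), fun hS' =>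
      Set.disjoint_left.1 (hdisj (Finset.ne_of_mem_erase hi)) (hcE i) (hSE hS')⟩
  have hsum : ∑ e ∈ (Finset.univ.erase i₀).image c, crossing A (p e) (q e) = 6 * k - 3 := by
    rw [Finset.sum_image hinj.injOn, Finset.sum_congr rfl fun i _ => hc i]
    simp [Finset.card_erase_of_mem]
    omega
  rw [← hsum]
  exact Finset.sum_le_sum_of_subset_of_nonneg hsub fun e _ _ => by
    unfold crossing; split_ifs <;> simp

end Graph

end

/-! ### The exceptional case for graphs and the main theorem -/

section

variable {α β : Type*} {G H : Graph α β} {p q : β → α} {k : ℕ} {f : α → ZMod k}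

lemma floor_natCast_div_two (d : ℕ) : ⌊(d : ℚ) / 2⌋ = (d : ℤ) / 2 := by
  obtain ⟨c, rfl | rfl⟩ := Nat.even_or_odd' d
  · rw [Int.floor_eq_iff, show ((2 * c : ℕ) : ℤ) / 2 = c by omega]
    push_cast
    constructor <;> linarith
  · rw [Int.floor_eq_iff, show ((2 * c + 1 : ℕ) : ℤ) / 2 = c by omega]
    push_cast
    constructor <;> linarith

lemma ceil_natCast_div_two (d : ℕ) : ⌈(d : ℚ) / 2⌉ = ((d : ℤ) + 1) / 2 := by
  obtain ⟨c, rfl | rfl⟩ := Nat.even_or_odd' d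
  · rw [Int.ceil_eq_iff, show (((2 * c : ℕ) : ℤ) + 1) / 2 = c by omega]
    push_cast
    constructor <;> linarith
  · rw [Int.ceil_eq_iff, show (((2 * c + 1 : ℕ) : ℤ) + 1) / 2 = c + 1 by omega]
    push_cast
    constructor <;> linarith

namespace Graph

lemma IsTreeConnected.isConnected {m : ℕ} (hm : 0 < m) (hG : G.IsTreeConnected m) :
    G.IsConnected := by
  obtain ⟨T, hT, -⟩ := hG
  obtain ⟨hs, hc, -⟩ := hT ⟨0, hm⟩
  refine ⟨hs.vertexSet_eq ▸ hc.1, fun x hx y hy => ?_⟩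
  rw [← hs.vertexSet_eq] at hx hy
  exact (hc.2 x hx y hy).lift id fun _ _ h => Adj.mono hs.le h

variable [DecidableEq α] [DecidableEq β]

/-- The positive edges of a suitable signing form an `f`-factor modulo `k`. -/
lemma IsEnds.isModFactor_restrict (h : G.IsEnds p q) (hV : V(G).Finite) (hE : E(G).Finite)
    {F : α → ℤ} (hF : ∀ v, (F v : ZMod k) = f v) {σ : β → ℤ} (hσ : ∀ e, σ e = 1 ∨ σ e = -1)
    (hs : ∀ v ∈ hV.toFinset,
      (2 * k : ℤ) ∣ excess hE.toFinset p q σ v - (2 * F v - G.degree v)) :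
    (G.restrict {e | σ e = 1}).IsModFactor G f := by
  refine ⟨restrict_isSpanningSubgraph G _, fun v hv => ?_⟩
  have h1 := hs v (hV.mem_toFinset.2 hv)
  rw [h.excess_eq hE hσ, show ∀ a b c : ℤ, 2 * a - b - (2 * c - b) = 2 * (a - c) by intros; ring]
    at h1
  have h2 := Int.dvd_of_mul_dvd_mul_left (by norm_num : (2 : ℤ) ≠ 0) h1
  rw [← hF v, ← Int.cast_natCast]
  exact ((ZMod.intCast_eq_intCast_iff_dvd_sub _ _ k).2 h2).symm

/-- Divisibility of `2 F v - d_G(v)` by `2k` expresses at once that the degree is even and that `f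
v` is half of it modulo `k`. -/
lemma IsConnected.isExceptional_iff (hc : G.IsConnected) (hV : V(G).Finite) (hE : E(G).Finite)
    {F : α → ℤ} (hF : ∀ v, (F v : ZMod k) = f v) :
    G.IsExceptional f ↔ Odd k ∧ Odd hE.toFinset.card ∧
      ∀ v ∈ hV.toFinset, (2 * k : ℤ) ∣ 2 * F v - G.degree v := by
  have key : ∀ v, Even (G.degree v) → (f v = ((G.degree v / 2 : ℕ) : ZMod k) ↔
      (2 * k : ℤ) ∣ 2 * F v - G.degree v) := fun v hv => by
    obtain ⟨c, hc⟩ := hv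
    rw [hc, show (c + c) / 2 = c by omega, show (2 * F v - ((c + c : ℕ) : ℤ)) = 2 * (F v - c) by
      push_cast; ring, mul_dvd_mul_iff_left (by norm_num : (2 : ℤ) ≠ 0),
      ← ZMod.intCast_eq_intCast_iff_dvd_sub, hF, Int.cast_natCast, eq_comm]
  rw [IsExceptional, IsEulerian, Set.ncard_eq_toFinset_card _ hE]
  constructor
  · rintro ⟨⟨⟨-, hd⟩, ho⟩, hk, hf⟩
    refine ⟨hk, ho, fun v hv => ?_⟩
    rw [hV.mem_toFinset] at hv
    exact (key v (hd v hv)).1 (hf v hv)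
  · rintro ⟨hk, ho, hd⟩
    have hev : ∀ v ∈ V(G), Even (G.degree v) := fun v hv => by
      have h1 := (Dvd.intro _ rfl : (2 : ℤ) ∣ 2 * k).trans (hd v (hV.mem_toFinset.2 hv))
      rw [← Int.even_coe_nat, even_iff_two_dvd]
      omega
    exact ⟨⟨⟨hc, hev⟩, ho⟩, hk, fun v hv => (key v (hev v hv)).2 (hd v (hV.mem_toFinset.2 hv))⟩

/-- The degree in `H` is congruent to half the degree in `G` modulo `k` and differs from it by at
most `k - 1`. -/
lemma IsExceptional.two_mul_degree (hex : G.IsExceptional f) (hH : H.IsModFactor G f) {v : α}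
    (hv : v ∈ V(G)) (hl : ⌊(G.degree v : ℚ) / 2⌋ - ((k : ℤ) - 1) ≤ (H.degree v : ℤ))
    (hu : (H.degree v : ℤ) ≤ ⌈(G.degree v : ℚ) / 2⌉ + ((k : ℤ) - 1)) :
    (G.degree v : ℤ) = 2 * H.degree v := by
  obtain ⟨c, hc⟩ := hex.1.1.2 v hv
  have h1 := (hH.2 v hv).trans (hex.2.2 v hv)
  rw [hc, show (c + c) / 2 = c by omega, ← Int.cast_natCast, ← Int.cast_natCast (n := c),
    ZMod.intCast_eq_intCast_iff_dvd_sub] at h1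
  rw [floor_natCast_div_two] at hl
  rw [ceil_natCast_div_two] at hu
  have h2 := Int.eq_zero_of_abs_lt_dvd h1 (by rw [abs_lt]; omega)
  omega

/-- In the exceptional case, the degrees of an `f`-factor cannot all be near the middle. -/
lemma IsExceptional.not_exists (hex : G.IsExceptional f) (h : G.IsEnds p q) (hV : V(G).Finite)
    (hE : E(G).Finite) : ¬ ∃ H : Graph α β, H.IsModFactor G f ∧
      (∀ v ∈ V(G), ⌊(G.degree v : ℚ) / 2⌋ - ((k : ℤ) - 1) ≤ (H.degree v : ℤ)) ∧
      (∀ v ∈ V(G), (H.degree v : ℤ) ≤ ⌈(G.degree v : ℚ) / 2⌉ + ((k : ℤ) - 1)) := by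
  rintro ⟨H, hH, hl, hu⟩
  have hHV : V(H).Finite := by rw [hH.1.vertexSet_eq]; exact hV
  have hHE : E(H).Finite := hE.subset hH.1.le.edgeSet_mono
  have h1 := h.sum_degree hV hE
  have h2 := (h.mono hH.1.le).sum_degree hHV hHE
  have h3 : hHV.toFinset = hV.toFinset := by
    ext v; simp [hH.1.vertexSet_eq]
  -- Summing the degrees gives that `G` has exactly twice as many edges as `H`, an even number.
  rw [Finset.sum_congr rfl fun v hv => hex.two_mul_degree hH (hV.mem_toFinset.1 hv)
    (hl v (hV.mem_toFinset.1 hv)) (hu v (hV.mem_toFinset.1 hv)), ← Finset.mul_sum, ← h3, h2] at h1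
  have h4 := hex.1.2
  rw [Nat.odd_iff] at h4
  omega

end Graph

end

theorem mainTheorem6 {α β : Type*} (G : Graph α β) (hV : V(G).Finite) (hE : E(G).Finite)
    (z : α) (hz : z ∈ V(G)) (k : ℕ) (hk : 2 ≤ k) (f : α → ZMod k)
    (hf : G.IsCompatibleMap f) (hG : G.IsTreeConnected (6 * k - 2)) :
    (∃ H : Graph α β, H.IsModFactor G f ∧
      (∀ v ∈ V(G), ⌊(G.degree v : ℚ) / 2⌋ - ((k : ℤ) - 1) ≤ (H.degree v : ℤ)) ∧
      (H.degree z : ℤ) ≤ ⌊(G.degree z : ℚ) / 2⌋ + (k : ℤ) ∧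
      (∀ v ∈ V(G), v ≠ z → (H.degree v : ℤ) ≤ ⌈(G.degree v : ℚ) / 2⌉ + ((k : ℤ) - 1))) ∧
    ((¬ ∃ H : Graph α β, H.IsModFactor G f ∧
      (∀ v ∈ V(G), ⌊(G.degree v : ℚ) / 2⌋ - ((k : ℤ) - 1) ≤ (H.degree v : ℤ)) ∧
      (∀ v ∈ V(G), (H.degree v : ℤ) ≤ ⌈(G.degree v : ℚ) / 2⌉ + ((k : ℤ) - 1))) ↔
      G.IsExceptional f) ∧
    (G.IsExceptional f → ∃ H : Graph α β, H.IsModFactor G f ∧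
      ⌈(G.degree z : ℚ) / 2⌉ - (k : ℤ) ≤ (H.degree z : ℤ) ∧
      (∀ v ∈ V(G), v ≠ z → ⌊(G.degree v : ℚ) / 2⌋ - ((k : ℤ) - 1) ≤ (H.degree v : ℤ)) ∧
      (∀ v ∈ V(G), (H.degree v : ℤ) ≤ ⌈(G.degree v : ℚ) / 2⌉ + ((k : ℤ) - 1))) := by
  classical
  have : Nonempty α := ⟨z⟩
  obtain ⟨p, q, h⟩ := G.exists_isEnds
  obtain ⟨F, hF⟩ : ∃ F : α → ℤ, ∀ v, (F v : ZMod k) = f v :=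
    ⟨fun v => (f v).cast, fun v => ZMod.intCast_zmod_cast _⟩
  have hex := (hG.isConnected (by omega)).isExceptional_iff hV hE hF
  have hpar : ∀ v ∈ hV.toFinset,
      (2 : ℤ) ∣ excess hE.toFinset p q (fun _ => 1) v - (2 * F v - G.degree v) := fun v _ => by
    rw [← h.degree_eq_excess hE]
    omega
  have hC := fun X hX => hf.exists_sideBalanced h hV hE hF (X := X) hX
  have hT := fun w hw => hG.hasGoodTree hk h hV hE (w := w) ((hV.mem_toFinset).1 hw)
  have hends := h.mem_toFinset hV hE
  have hz' := hV.mem_toFinset.2 hz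
  have hgood : ¬ G.IsExceptional f → ∃ H : Graph α β, H.IsModFactor G f ∧
      (∀ v ∈ V(G), ⌊(G.degree v : ℚ) / 2⌋ - ((k : ℤ) - 1) ≤ (H.degree v : ℤ)) ∧
      (∀ v ∈ V(G), (H.degree v : ℤ) ≤ ⌈(G.degree v : ℚ) / 2⌉ + ((k : ℤ) - 1)) := fun hne => by
    obtain ⟨σ, hσ, hs⟩ := exists_signing_of_not_exceptional hk hends ⟨z, hz'⟩ hpar hT hC
      (mt hex.2 hne)
    refine ⟨_, h.isModFactor_restrict hV hE hF hσ fun v hv => (hs v hv).1,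
      fun v hv => ?_, fun v hv => ?_⟩ <;>
    · have h1 := (hs v (hV.mem_toFinset.2 hv)).2
      rw [h.excess_eq hE hσ, abs_le] at h1
      simp only [floor_natCast_div_two, ceil_natCast_div_two]
      omega
  refine ⟨?_, ⟨fun hno => ?_, fun he => he.not_exists h hV hE⟩, fun he => ?_⟩
  · by_cases he : G.IsExceptional f
    -- The shift `1` at `z` permits the excess `2k` there, which relaxes the upper bound.
    · obtain ⟨σ, hσ, hs⟩ := exists_signing_of_zero hk hends hpar hz' (hT z hz') hC
        (hex.1 he).2.2 (Or.inl rfl)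
      have hs' : ∀ v ∈ V(G), _ := fun v hv => (hs v (hV.mem_toFinset.2 hv)).2
      simp only [h.excess_eq hE hσ, abs_le] at hs'
      refine ⟨_, h.isModFactor_restrict hV hE hF hσ fun v hv => (hs v hv).1,
        fun v hv => ?_, ?_, fun v hv hvz => ?_⟩
      · have h1 := hs' v hv
        rw [floor_natCast_div_two]
        split_ifs at h1 <;> omega
      · have h1 := hs' z hz
        rw [if_pos rfl] at h1
        rw [floor_natCast_div_two]
        omega
      · have h1 := hs' v hv
        rw [if_neg hvz] at h1
        rw [ceil_natCast_div_two]
        omega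
    · obtain ⟨H, hH, hl, hu⟩ := hgood he
      refine ⟨H, hH, hl, ?_, fun v hv _ => hu v hv⟩
      have h1 := hu z hz
      rw [ceil_natCast_div_two] at h1
      rw [floor_natCast_div_two]
      omega
  · by_contra he
    exact hno (hgood he)
  -- The shift `-1` permits the excess `-2k` at `z` and relaxes the lower bound instead.
  · obtain ⟨σ, hσ, hs⟩ := exists_signing_of_zero hk hends hpar hz' (hT z hz') hC
      (hex.1 he).2.2 (Or.inr rfl)
    have hs' : ∀ v ∈ V(G), _ := fun v hv => (hs v (hV.mem_toFinset.2 hv)).2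
    simp only [h.excess_eq hE hσ, abs_le] at hs'
    refine ⟨_, h.isModFactor_restrict hV hE hF hσ fun v hv => (hs v hv).1,
      ?_, fun v hv hvz => ?_, fun v hv => ?_⟩
    · have h1 := hs' z hz
      rw [if_pos rfl] at h1
      rw [ceil_natCast_div_two]
      omega
    · have h1 := hs' v hv
      rw [if_neg hvz] at h1
      rw [floor_natCast_div_two]
      omega
    · have h1 := hs' v hv
      rw [ceil_natCast_div_two]
      split_ifs at h1 <;> omega
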